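/- A \emph{simple polyhedron} is a compact connected polyhedron $X$ in which every point has a star neighborhood homeomorphic, with the point as the center, to one of the following: (i) a disk; (ii) the product of a tripod (the cone over three points) with an open interval; (iii) the cone over the complete graph $K_4$; (iv) a half-disk around a boundary point; (v) the product of a tripod with a half-open interval $[0,1)$, around the center of its end. Points of type (iii) are the \emph{vertices} of $X$; the \emph{singular set} $S(X)$ consists of the points of types (ii), (iii), (v); the \emph{boundary} $\partial X$ consists of the points of types (iv), (v); $X$ is \emph{closed} if $\partial X=\emptyset$. A polyhedron is \emph{acyclic} (respectively a \emph{homology-$S^1$}) if its integral homology is that of a point (respectively of the circle). Let $X$ be an acyclic simple polyhedron and let $S'$ be a connected component of $S(X)$ that is disjoint from $\partial X$ and contains exactly $n\ge 1$ vertices of $X$. Let $X'=\mathrm{Nbd}(S';X)$ be a regular neighborhood of $S'$ in $X$, let $\partial X'$ be its boundary (the frontier of $X'$ in $X$), and let $m$ be the number of connected components of $\partial X'$. Then: 1. the components of $\partial X'$ are simple closed curves, and $m\ge n+1$; 2. these curves split $X$ into the connected piece $X'$ and the connected components of the closure of $X\setminus X'$, of which exactly $n+1$ are acyclic, exactly $m-n-1$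 are homology-$S^1$'s, and there are no others; 3. if $X$ is closed, then each of the homology-$S^1$ pieces contains at least one vertex of $X$. -/

import Mathlib

open CategoryTheory CategoryTheory.Limits

/-! Compact polyhedra are presented by triangulations, that is, by finite abstract simplicial
complexes (`PreAbstractSimplicialComplex` with finitely many faces).  Points of the polyhedron lie
in the interior of exactly one face, and sets of faces stand for the union of their interiors. -/

namespace SimplePoly

/-! ### Finite graphs up to subdivision -/

/-- A multigraph, given by its branch vertices, its edges and the two ends of each edge. -/
structure ModelGraph where
  W : Type
  E : Type
  fst : E → W
  snd : E → W

/-- The circle, as two vertices joined by two edges. -/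
def circleGraph : ModelGraph := ⟨Fin 2, Fin 2, fun _ => 0, fun _ => 1⟩

/-- The theta graph, two vertices joined by three edges. -/
def thetaGraph : ModelGraph := ⟨Fin 2, Fin 3, fun _ => 0, fun _ => 1⟩

/-- The complete graph with four vertices. -/
def completeGraph4 : ModelGraph :=
  ⟨Fin 4, {p : Fin 4 × Fin 4 // p.1 < p.2}, fun p => p.1.1, fun p => p.1.2⟩

/-- The arc, two vertices joined by one edge. -/
def arcGraph : ModelGraph := ⟨Fin 2, Fin 1, fun _ => 0, fun _ => 1⟩

/-- The tripod, the cone over three points. -/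
def tripodGraph : ModelGraph := ⟨Fin 4, Fin 3, fun _ => 0, fun i => i.succ⟩

/-- The graph formed by the vertices and the edges of a simplicial complex. -/
def edgeGraph {V : Type} [DecidableEq V] (L : PreAbstractSimplicialComplex V) : SimpleGraph V where
  Adj x y := x ≠ y ∧ ({x, y} : Finset V) ∈ L.faces
  symm.symm x y h := ⟨h.1.symm, by rw [Finset.pair_comm]; exact h.2⟩
  loopless.irrefl x h := h.1 rfl

/-- The simplicial complex `L` is a subdivision of the multigraph `H` (for the graphs above:
`L` triangulates a space homeomorphic to `H`).  It has dimension at most one, and the edges of `H`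
become paths that are disjoint away from the branch vertices and that together cover `L`. -/
def IsSubdivisionOf {V : Type} [DecidableEq V] (L : PreAbstractSimplicialComplex V)
    (H : ModelGraph) : Prop :=
  (∀ τ ∈ L.faces, τ.card ≤ 2) ∧
  ∃ (φ : H.W → V) (P : ∀ e : H.E, (edgeGraph L).Walk (φ (H.fst e)) (φ (H.snd e))),
    Function.Injective φ ∧
    (∀ e, (P e).IsPath) ∧
    (∀ e w, φ w ∈ (P e).support → w = H.fst e ∨ w = H.snd e) ∧
    (∀ e f x, e ≠ f → x ∈ (P e).support → x ∈ (P f).support → x ∈ Set.range φ) ∧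
    (∀ x, {x} ∈ L.faces → ∃ e, x ∈ (P e).support) ∧
    (∀ s ∈ (edgeGraph L).edgeSet, ∃! e, s ∈ (P e).edges)

/-! ### Sets of faces: order complex, connectedness, homology -/

/-- The order complex of a subset `Q` of a partially ordered set: vertices are the elements of `Q`
and simplices are the nonempty finite chains in `Q`. -/
def orderComplex {α : Type} [PartialOrder α] (Q : Set α) : PreAbstractSimplicialComplex α where
  faces := {c | c.Nonempty ∧ (∀ a ∈ c, a ∈ Q) ∧ ∀ a ∈ c, ∀ b ∈ c, a ≤ b ∨ b ≤ a}
  isRelLowerSet_faces := fun _ hc =>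
    ⟨hc.1, fun _ hd hne =>
      ⟨hne, fun a ha => hc.2.1 a (hd ha), fun a ha b hb => hc.2.2 a (hd ha) b (hd hb)⟩⟩

/-- The barycentric subdivision: the order complex of the poset of faces. -/
def sd {V : Type} (K : PreAbstractSimplicialComplex V) :
    PreAbstractSimplicialComplex (Finset V) :=
  orderComplex K.faces

/-- `Q` is nonempty and any two of its elements are joined inside `Q` by a zigzag of
comparabilities.  For a set of faces this is connectedness of the union of their interiors, and
it is also connectedness of the order complex of `Q`. -/
def IsConnectedSet {α : Type} [PartialOrder α] (Q : Set α) : Prop :=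
  Q.Nonempty ∧ ∀ a ∈ Q, ∀ b ∈ Q,
    Relation.ReflTransGen (fun x y => y ∈ Q ∧ (x ≤ y ∨ y ≤ x)) a b

/-- `C` is a connected component of `Q`. -/
def IsComponent {α : Type} [PartialOrder α] (C Q : Set α) : Prop :=
  C ⊆ Q ∧ IsConnectedSet C ∧ ∀ a ∈ C, ∀ b ∈ Q, (a ≤ b ∨ b ≤ a) → b ∈ C

/-- The `k`-th integral homology of the order complex of `Q`, computed as the simplicial homology
of the nerve of `Q`.  For `Q` the set of faces of `K` the order complex is the barycentric
subdivision of `K`, so that this is the homology of the polyhedron `|K|`. -/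
noncomputable def homologyOf {α : Type} [PartialOrder α] (Q : Set α) (k : ℕ) : ModuleCat ℤ :=
  SSet.homology (nerve Q) (ModuleCat.of ℤ ℤ) k

/-- The integral homology is that of a point. -/
def IsAcyclic {α : Type} [PartialOrder α] (Q : Set α) : Prop :=
  Nonempty (homologyOf Q 0 ≅ ModuleCat.of ℤ ℤ) ∧ ∀ k, 1 ≤ k → IsZero (homologyOf Q k)

/-- A homology-`S¹`: the integral homology is that of the circle. -/
def IsHomologyCircle {α : Type} [PartialOrder α] (Q : Set α) : Prop :=
  Nonempty (homologyOf Q 0 ≅ ModuleCat.of ℤ ℤ) ∧ Nonempty (homologyOf Q 1 ≅ ModuleCat.of ℤ ℤ) ∧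
    ∀ k, 2 ≤ k → IsZero (homologyOf Q k)

/-! ### Simple polyhedra -/

section

variable {V : Type} [DecidableEq V]

/-- The link of an interior point `x` of the face `σ`: the complex of all simplices `τ` of the
closed star of `σ` that do not contain `σ` (the join of the boundary of `σ` with the usual link
of `σ`; for a vertex `σ = {v}` it is the usual link of `v`).  The star neighbourhood of `x` is the
cone over this complex with apex `x`. -/
def pointLink (K : PreAbstractSimplicialComplex V) (σ : Finset V) :
    PreAbstractSimplicialComplex V where
  faces := {τ | τ.Nonempty ∧ σ ∪ τ ∈ K.faces ∧ ¬ σ ⊆ τ}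
  isRelLowerSet_faces := fun _ hτ =>
    ⟨hτ.1, fun _ hρ hne =>
      ⟨hne,
        (K.isRelLowerSet_faces hτ.2.1).2 (Finset.union_subset_union le_rfl hρ)
          (hne.mono Finset.subset_union_right),
        fun h => hτ.2.2 (h.trans hρ)⟩⟩

/-- The interior points of `σ` have a star neighbourhood that is a cone over `H`. -/
def HasModel (K : PreAbstractSimplicialComplex V) (σ : Finset V) (H : ModelGraph) : Prop :=
  σ ∈ K.faces ∧ IsSubdivisionOf (pointLink K σ) H

/-- A simple polyhedron: compact, connected, and every point has a star neighbourhood of one of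
the five models: the disk, the product of a tripod with an interval, the cone over the complete
graph with four vertices, the half-disk around a boundary point, and the product of a tripod with
a half-open interval around the end of its singular line. -/
def IsSimplePolyhedron (K : PreAbstractSimplicialComplex V) : Prop :=
  K.faces.Finite ∧ IsConnectedSet K.faces ∧
  ∀ σ ∈ K.faces, HasModel K σ circleGraph ∨ HasModel K σ thetaGraph ∨
    HasModel K σ completeGraph4 ∨ HasModel K σ arcGraph ∨ HasModel K σ tripodGraph

/-- The set of (true) vertices of a simple polyhedron; such points are always vertices of the
triangulation. -/
def trueVertices (K : PreAbstractSimplicialComplex V) : Set V :=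
  {v | HasModel K {v} completeGraph4}

/-- The singular set `S(X)`. -/
def singularSet (K : PreAbstractSimplicialComplex V) : Set (Finset V) :=
  {σ | HasModel K σ thetaGraph ∨ HasModel K σ completeGraph4 ∨ HasModel K σ tripodGraph}

/-- The boundary `∂X`. -/
def boundary (K : PreAbstractSimplicialComplex V) : Set (Finset V) :=
  {σ | HasModel K σ arcGraph ∨ HasModel K σ tripodGraph}

end

/-! ### Regular neighbourhoods

The simplices of the second barycentric subdivision `K''` are the chains in `(sd K).faces`, so
`(sd K).faces` is the set of vertices of `K''`.  The three sets below are sets of vertices of `K''`;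
each stands for the full subcomplex of `K''` spanned by it, which is its order complex. -/

section

variable {V : Type} (K : PreAbstractSimplicialComplex V) (S : Set (Finset V))

/-- The regular neighbourhood `Nbd(S; X)` of a subcomplex `S` of `K`: the second derived
neighbourhood, the union of all closed simplices of `K''` that meet `S`.  A vertex `c` of `K''` lies
in it if and only if the simplex `c` of `sd K` meets `S`. -/
def nbd : Set (Finset (Finset V)) := {c ∈ (sd K).faces | ∃ σ ∈ c, σ ∈ S}

/-- The closure of the complement of `Nbd(S; X)`: it is spanned by the vertices of `K''` that do
not lie on `S`. -/
def nbdCompl : Set (Finset (Finset V)) := {c ∈ (sd K).faces | ∃ σ ∈ c, σ ∉ S}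

/-- The boundary `∂Nbd(S; X)`, along which the neighbourhood meets the rest of `X`.  It is the
whole boundary of the polyhedron `Nbd(S; X)` as soon as `S` does not meet `∂X`. -/
def nbdBoundary : Set (Finset (Finset V)) := nbd K S ∩ nbdCompl K S

end

end SimplePoly

open SimplePoly

/-! Write N for `nbd K S'`, Y for `nbdCompl K S'` and D for their intersection `nbdBoundary K S'`.
All three are finite posets of chains of faces, and N and Y cover the acyclic `sd K`. The
bookkeeping uses `h0`, the number of components, and `h1`, the dimension of the first cohomology
over a field.

The local models make D a poset in which every element has exactly two neighbours
(`IsSingularPart.isRegularPoset`), hence a disjoint union of circles with `h1 D = h0 D = m`. The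
neighbourhood N retracts onto a subdivision of S', a connected graph of valence four at the n true
vertices and two elsewhere, so its Euler characteristic gives `h1 N = n + 1`
(`IsSingularPart.h1_nbd`). Mayer-Vietoris in degree one then gives `m = n + 1 + h1 Y`. In degree
zero it gives `m ≤ h0 Y`. Every component of Y meets D because X is connected, so each component of
Y meets D in exactly one circle (`IsSingularPart.components`). Since X has no first cohomology,
restriction from a piece C to its boundary circle is injective on first cohomology, so `h1 C ≤ 1`.
These dimensions add up to `h1 Y = m - n - 1`, which is therefore the number of pieces with `h1 C =
1`. Integrally, the homology of C embeds in that of the graph D, so it is free in degree one and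
zero above; thus `h1 C` decides between acyclic pieces and homology circles
(`IsSingularPart.piece_type`).

For the last claim, let X be closed and suppose that a homology circle B contains no true vertex.
The singular set E inside B is then a union of circles. Remove its neighbourhood from B, and let A
be what remains. Three estimates collide. Mayer-Vietoris for S' ∪ E relates the numbers of
components. The rest A is a surface, so Stokes' theorem modulo two yields `h0 A + h1 A ≤ h0 (∂A)`
(`h0_add_h1_le`). Finally, the boundary of a neighbourhood of a circle of E is a triple cover of
that circle. It cannot be connected, for otherwise the restriction of first cohomology from the
neighbourhood to the boundary would vanish modulo three, while acyclicity makes it injective; so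
there are at least two boundary curves per circle (`IsSingularPart.two_mul_h0_nbd_le`). -/

namespace SimplePoly
open Simplicial MonoidalCategory Opposite

/-! ### Homology of partially ordered sets -/

section Nerve

variable {P Q R : Type} [PartialOrder P] [PartialOrder Q] [PartialOrder R]

/-- The map of nerves induced by a monotone map. -/
def nerveHom (f : P →o Q) : nerve P ⟶ nerve Q := nerveMap f.monotone.functor

lemma nerveHom_id : nerveHom (OrderHom.id : P →o P) = 𝟙 _ := rfl

lemma nerveHom_comp (f : P →o Q) (g : Q →o R) :
    nerveHom (g.comp f) = nerveHom f ≫ nerveHom g := rfl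

/-- The homotopy between the maps of nerves induced by two comparable monotone maps. -/
noncomputable def nerveHomotopy (f g : P →o Q) (h : ∀ x, f x ≤ g x) :
    SSet.Homotopy (nerveHom f) (nerveHom g) where
  -- The second component of `p` is a monotone map to `{0, 1}`. Where it is `0` the vertex is moved
  -- by `f`, afterwards by `g`; since `f ≤ g`, the switch preserves monotonicity.
  h := { app n := ↾fun p => Monotone.functor (f := fun i =>
            if (SSet.stdSimplex.objEquiv p.2).toOrderHom i = 0 then f (p.1.obj i)
              else g (p.1.obj i)) (by
            intro i j hij
            have h1 := (SSet.stdSimplex.objEquiv p.2).toOrderHom.monotone hij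
            have h2 := p.1.monotone hij
            dsimp only
            by_cases hi : (SSet.stdSimplex.objEquiv p.2).toOrderHom i = 0
            · by_cases hj : (SSet.stdSimplex.objEquiv p.2).toOrderHom j = 0
              · rw [if_pos hi, if_pos hj]; exact f.monotone h2
              · rw [if_pos hi, if_neg hj]; exact (f.monotone h2).trans (h _)
            · have hj : (SSet.stdSimplex.objEquiv p.2).toOrderHom j ≠ 0 :=
                fun hj => hi (by rw [hj] at h1; exact Fin.le_zero_iff.1 h1)
              rw [if_neg hi, if_neg hj]; exact g.monotone h2)
         naturality := by
            intro n m φ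
            ext p
            rfl }
  h₀ := by
    ext n x
    rfl
  h₁ := by
    ext n x
    rfl
  rel := by
    ext n ⟨⟨x, hx⟩, t⟩
    exact hx.elim

/-- The coefficients of all homology groups. -/
abbrev ZZ : ModuleCat.{0} ℤ := ModuleCat.of ℤ ℤ

/-- The map in homology induced by a monotone map. -/
noncomputable def hMap (f : P →o Q) (k : ℕ) :
    SSet.homology (nerve P) ZZ k ⟶ SSet.homology (nerve Q) ZZ k :=
  SSet.homologyMap (nerveHom f) ZZ k

lemma hMap_id (k : ℕ) : hMap (OrderHom.id : P →o P) k = 𝟙 _ := by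
  rw [hMap, nerveHom_id, SSet.homologyMap_id]

lemma hMap_comp (f : P →o Q) (g : Q →o R) (k : ℕ) :
    hMap (g.comp f) k = hMap f k ≫ hMap g k := by
  rw [hMap, nerveHom_comp, SSet.homologyMap_comp]; rfl

lemma hMap_eq_of_le (f g : P →o Q) (h : ∀ x, f x ≤ g x) (k : ℕ) : hMap f k = hMap g k :=
  (nerveHomotopy f g h).congr_homologyMap ZZ k

/-- A monotone map with a monotone inverse up to comparability induces isomorphisms in homology. -/
noncomputable def hIso (f : P →o Q) (g : Q →o P) (k : ℕ)
    (h1 : hMap (g.comp f) k = 𝟙 _) (h2 : hMap (f.comp g) k = 𝟙 _) :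
    SSet.homology (nerve P) ZZ k ≅ SSet.homology (nerve Q) ZZ k where
  hom := hMap f k
  inv := hMap g k
  hom_inv_id := by rw [← hMap_comp, h1]
  inv_hom_id := by rw [← hMap_comp, h2]

lemma nerve_hasDimensionLT (d : ℕ)
    (h : ∀ x : Fin (d + 1) → P, ¬ StrictMono x) : (nerve P).HasDimensionLT d where
  degenerate_eq_top n hn := by
    ext x
    simp only [Set.top_eq_univ, Set.mem_univ, iff_true]
    by_contra hx
    rw [SSet.mem_degenerate_iff_notMem_nonDegenerate, not_not,
      PartialOrder.mem_nerve_nonDegenerate_iff_strictMono] at hx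
    exact h _ (hx.comp (Fin.strictMono_castLE (Nat.succ_le_succ hn)))

lemma isZero_homology_of_subsingleton [Subsingleton P] {k : ℕ} (hk : 1 ≤ k) :
    IsZero (SSet.homology (nerve P) ZZ k) := by
  have := nerve_hasDimensionLT (P := P) 1 fun x hx =>
    (hx (show (0 : Fin 2) < 1 by decide)).ne (Subsingleton.elim _ _)
  exact SSet.isZero_homology_of_hasDimensionLT _ _ k 1 hk

lemma isZero_homology_of_isEmpty [IsEmpty P] (k : ℕ) :
    IsZero (SSet.homology (nerve P) ZZ k) := by
  have := nerve_hasDimensionLT (P := P) 0 fun x _ => isEmptyElim (x 0)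
  exact SSet.isZero_homology_of_hasDimensionLT _ _ k 0 (Nat.zero_le _)

/-- A constant map factors through a point, so the identity of the homology factors through zero. -/
lemma isZero_homology_of_const {k : ℕ} (hk : 1 ≤ k) (p : P)
    (h : hMap (OrderHom.const P p) k = 𝟙 (SSet.homology (nerve P) ZZ k)) :
    IsZero (SSet.homology (nerve P) ZZ k) := by
  have h1 : (OrderHom.const P p) =
    (OrderHom.const Unit p).comp (OrderHom.const P () : P →o Unit) := rfl
  rw [h1, hMap_comp] at h
  rw [IsZero.iff_id_eq_zero, ← h,
    (isZero_homology_of_subsingleton (P := Unit) hk).eq_of_tgt (hMap _ k) 0, zero_comp]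

end Nerve

/-- The additive equivalence underlying an isomorphism of modules. -/
def isoAddEquiv {R : Type} [Ring R] {M N : ModuleCat.{0} R} (e : M ≅ N) : M ≃+ N :=
  e.toLinearEquiv.toAddEquiv

/-! ### The Mayer-Vietoris sequence for order complexes -/

section MayerVietoris

variable {α : Type} [PartialOrder α] {A B X : Set α}

/-- The inclusion of sets as a monotone map. -/
def inclHom (h : A ⊆ X) : A →o X := ⟨Set.inclusion h, fun _ _ h => h⟩

/-- The vertices of a simplex of a nerve. -/
def simplexVertex {n : ℕ} (x : (nerve X) _⦋n⦌) (i : Fin (n + 1)) : α :=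
  ((show Fin (n + 1) ⥤ X from x).obj i : X)

lemma simplexVertex_mem {n : ℕ} (x : (nerve X) _⦋n⦌) (i : Fin (n + 1)) :
    simplexVertex x i ∈ X := Subtype.property ((show Fin (n + 1) ⥤ X from x).obj i : X)

lemma simplexVertex_mono {n : ℕ} (x : (nerve X) _⦋n⦌) : Monotone (simplexVertex x) :=
  fun _ _ h => Functor.monotone (show Fin (n + 1) ⥤ X from x) h

/-- The simplex of a nerve with given vertices. -/
def simplexMk {n : ℕ} (x : Fin (n + 1) → α) (hm : Monotone x) (hx : ∀ i, x i ∈ X) :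
    (nerve X) _⦋n⦌ :=
  Monotone.functor (f := fun i => (⟨x i, hx i⟩ : X)) fun _ _ h => hm h

lemma simplexVertex_mk {n : ℕ} (x : Fin (n + 1) → α) (hm : Monotone x) (hx : ∀ i, x i ∈ X) :
    simplexVertex (simplexMk x hm hx) = x := rfl

lemma simplex_ext {n : ℕ} {x y : (nerve X) _⦋n⦌} (h : ∀ i, simplexVertex x i = simplexVertex y i) :
    x = y := nerve.ext_of_isThin (funext fun i => Subtype.ext (h i))

/-- The map of chain complexes induced by an inclusion. -/
noncomputable abbrev chainIncl (h : A ⊆ X) :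
    (nerve A).chainComplex ZZ ⟶ (nerve X).chainComplex ZZ :=
  SSet.chainComplexMap (nerveHom (inclHom h)) ZZ

lemma chainIncl_comp {D : Set α} (h : A ⊆ B) (h' : B ⊆ D) :
    chainIncl h ≫ chainIncl h' = chainIncl (h.trans h') := by
  rw [chainIncl, chainIncl, chainIncl, ← Functor.map_comp]; rfl

/-- Morphisms out of the group of simplicial chains, given on simplices. -/
noncomputable def chainDesc {X : SSet.{0}} {n : ℕ} {M : ModuleCat.{0} ℤ}
    (c : X _⦋n⦌ → (ZZ ⟶ M)) : (X.chainComplex ZZ).X n ⟶ M :=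
  (X.isColimitChainComplexXCofan ZZ n).desc (Cofan.mk _ c)

lemma ι_chainDesc {X : SSet.{0}} {n : ℕ} {M : ModuleCat.{0} ℤ}
    (c : X _⦋n⦌ → (ZZ ⟶ M)) (x : X _⦋n⦌) : X.ιChainComplex x ≫ chainDesc c = c x :=
  (X.isColimitChainComplexXCofan ZZ n).fac (Cofan.mk _ c) ⟨x⟩

lemma ι_chainDesc_assoc {X : SSet.{0}} {n : ℕ} {M N : ModuleCat.{0} ℤ}
    (c : X _⦋n⦌ → (ZZ ⟶ M)) (x : X _⦋n⦌) (f : M ⟶ N) :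
    X.ιChainComplex x ≫ chainDesc c ≫ f = c x ≫ f := by
  rw [← Category.assoc, ι_chainDesc]

/-- The chains of a pair of sets. -/
noncomputable abbrev mvSum (A B : Set α) : ChainComplex (ModuleCat.{0} ℤ) ℕ :=
  (nerve A).chainComplex ZZ ⊞ (nerve B).chainComplex ZZ

/-- The map from the chains of the intersection. -/
noncomputable def mvF (A B : Set α) : (nerve ↥(A ∩ B)).chainComplex ZZ ⟶ mvSum A B :=
  biprod.lift (chainIncl Set.inter_subset_left) (- chainIncl Set.inter_subset_right)

/-- The map to the chains of the union. -/
noncomputable def mvG (A B : Set α) : mvSum A B ⟶ (nerve ↥(A ∪ B)).chainComplex ZZ :=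
  biprod.desc (chainIncl Set.subset_union_left) (chainIncl Set.subset_union_right)

/-- The Mayer-Vietoris sequence of chain complexes. -/
noncomputable def mvShortComplex (A B : Set α) :
    ShortComplex (ChainComplex (ModuleCat.{0} ℤ) ℕ) :=
  ShortComplex.mk (mvF A B) (mvG A B) (by
    rw [mvF, mvG, biprod.lift_desc, Preadditive.neg_comp, chainIncl_comp, chainIncl_comp,
      add_neg_cancel])

lemma biprod_X_hom_ext {K L : ChainComplex (ModuleCat.{0} ℤ) ℕ} {n : ℕ} {M : ModuleCat.{0} ℤ}
    {u v : (K ⊞ L).X n ⟶ M}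
    (h1 : (biprod.inl : K ⟶ K ⊞ L).f n ≫ u = (biprod.inl : K ⟶ K ⊞ L).f n ≫ v)
    (h2 : (biprod.inr : L ⟶ K ⊞ L).f n ≫ u = (biprod.inr : L ⟶ K ⊞ L).f n ≫ v) : u = v := by
  have h3 : (biprod.fst : K ⊞ L ⟶ K).f n ≫ (biprod.inl : K ⟶ K ⊞ L).f n +
      (biprod.snd : K ⊞ L ⟶ L).f n ≫ (biprod.inr : L ⟶ K ⊞ L).f n = 𝟙 _ := by
    rw [← HomologicalComplex.comp_f, ← HomologicalComplex.comp_f,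
      ← HomologicalComplex.add_f_apply, biprod.total]; rfl
  rw [← Category.id_comp u, ← Category.id_comp v, ← h3, Preadditive.add_comp,
    Preadditive.add_comp, Category.assoc, Category.assoc, h1, h2, Category.assoc, Category.assoc]

open Classical in
/-- The section of `mvG` in degree `n`. -/
noncomputable def mvS (A B : Set α) (n : ℕ) :
    ((nerve ↥(A ∪ B)).chainComplex ZZ).X n ⟶ (mvSum A B).X n :=
  -- A simplex of the intersection is assigned to the summand of `A`. The retraction `mvR`,
  -- supported on the summand of `B`, compensates for this choice.
  chainDesc fun x => if h : ∀ i, simplexVertex x i ∈ A then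
      (nerve A).ιChainComplex (simplexMk _ (simplexVertex_mono x) h) ≫ (biprod.inl : _ ⟶ mvSum A B).f n
    else if h : ∀ i, simplexVertex x i ∈ B then
      (nerve B).ιChainComplex (simplexMk _ (simplexVertex_mono x) h) ≫ (biprod.inr : _ ⟶ mvSum A B).f n
    else 0

open Classical in
/-- The retraction of `mvF` in degree `n`. -/
noncomputable def mvR (A B : Set α) (n : ℕ) :
    (mvSum A B).X n ⟶ ((nerve ↥(A ∩ B)).chainComplex ZZ).X n :=
  (biprod.snd : mvSum A B ⟶ _).f n ≫
    chainDesc fun x => if h : ∀ i, simplexVertex x i ∈ A then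
      -- The sign cancels that of the second component of `mvF`.
      - (nerve ↥(A ∩ B)).ιChainComplex (simplexMk _ (simplexVertex_mono x)
          fun i => Set.mem_inter (h i) (simplexVertex_mem x i))
    else 0

lemma mvF_mvR (A B : Set α) (n : ℕ) : (mvF A B).f n ≫ mvR A B n = 𝟙 _ := by
  rw [mvR, ← Category.assoc, ← HomologicalComplex.comp_f, mvF, biprod.lift_snd]
  refine SSet.chainComplex_hom_ext fun x => ?_
  have h : ∀ i, simplexVertex ((nerveHom (inclHom (Set.inter_subset_right (s := A) (t := B)))).app
      _ x) i ∈ A := fun i => (simplexVertex_mem x i).1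
  rw [HomologicalComplex.neg_f_apply, Preadditive.neg_comp, Preadditive.comp_neg,
    SSet.ι_chainComplexMap_f_assoc, ι_chainDesc, dif_pos h, neg_neg, Category.comp_id]
  rfl

lemma mvS_mvG (n : ℕ)
    (hcov : ∀ (n : ℕ) (x : Fin (n + 1) → α), Monotone x → (∀ i, x i ∈ A ∪ B) →
      (∀ i, x i ∈ A) ∨ ∀ i, x i ∈ B) : mvS A B n ≫ (mvG A B).f n = 𝟙 _ := by
  refine SSet.chainComplex_hom_ext fun x => ?_
  rw [mvS, ι_chainDesc_assoc, Category.comp_id, mvG]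
  by_cases h : ∀ i, simplexVertex x i ∈ A
  · rw [dif_pos h, Category.assoc, ← HomologicalComplex.comp_f, biprod.inl_desc,
      SSet.ι_chainComplexMap_f]
    rfl
  · have h' := (hcov n _ (simplexVertex_mono x) (simplexVertex_mem x)).resolve_left h
    rw [dif_neg h, dif_pos h', Category.assoc, ← HomologicalComplex.comp_f, biprod.inr_desc,
      SSet.ι_chainComplexMap_f]
    rfl

lemma mv_total (A B : Set α) (n : ℕ) :
    mvR A B n ≫ (mvF A B).f n + (mvG A B).f n ≫ mvS A B n = 𝟙 _ := by
  apply biprod_X_hom_ext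
  · refine SSet.chainComplex_hom_ext fun x => ?_
    rw [Preadditive.comp_add, mvR, mvG, ← HomologicalComplex.comp_f_assoc, biprod.inl_desc,
      Category.assoc, ← HomologicalComplex.comp_f_assoc, biprod.inl_snd, HomologicalComplex.zero_f,
      zero_comp, zero_add, SSet.ι_chainComplexMap_f_assoc, mvS, ι_chainDesc, Category.comp_id]
    exact dif_pos (fun i => simplexVertex_mem x i)
  · refine SSet.chainComplex_hom_ext fun x => ?_
    rw [Preadditive.comp_add, mvR, mvG, ← HomologicalComplex.comp_f_assoc, biprod.inr_desc,
      Category.assoc, ← HomologicalComplex.comp_f_assoc, biprod.inr_snd, HomologicalComplex.id_f,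
      Category.id_comp, Preadditive.comp_add, SSet.ι_chainComplexMap_f_assoc, mvS, ι_chainDesc,
      ι_chainDesc_assoc, Category.comp_id]
    by_cases h : ∀ i, simplexVertex x i ∈ A
    · have h3 : (mvF A B).f n = (chainIncl Set.inter_subset_left).f n ≫ (biprod.inl : _ ⟶ mvSum A B).f n -
          (chainIncl Set.inter_subset_right).f n ≫
            (biprod.inr : _ ⟶ mvSum A B).f n := by
        rw [mvF, ← HomologicalComplex.comp_f, ← HomologicalComplex.comp_f,
          ← HomologicalComplex.sub_f_apply, biprod.lift_eq, Preadditive.neg_comp, sub_eq_add_neg]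
      have h2 : ∀ i, simplexVertex ((nerveHom (inclHom
        (Set.subset_union_right (s := A) (t := B)))).app _ x) i ∈ A := h
      rw [dif_pos h, dif_pos h2, Preadditive.neg_comp, h3, Preadditive.comp_sub,
        SSet.ι_chainComplexMap_f_assoc, SSet.ι_chainComplexMap_f_assoc, neg_sub]
      exact sub_add_cancel _ _
    · have h2 : ¬ ∀ i, simplexVertex ((nerveHom (inclHom
        (Set.subset_union_right (s := A) (t := B)))).app _ x) i ∈ A := h
      have h3 : ∀ i, simplexVertex ((nerveHom (inclHom
        (Set.subset_union_right (s := A) (t := B)))).app _ x) i ∈ B := simplexVertex_mem x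
      rw [dif_neg h, dif_neg h2, dif_pos h3, zero_comp, zero_add]
      rfl

/-- The sets `A` and `B` cover their union: every chain in the union lies in one of them. -/
def ChainCover (A B : Set α) : Prop :=
  ∀ (n : ℕ) (x : Fin (n + 1) → α), Monotone x → (∀ i, x i ∈ A ∪ B) →
      (∀ i, x i ∈ A) ∨ ∀ i, x i ∈ B

/-- The splittings are made degree by degree and need not commute with the differentials; exactness
in each degree is enough. -/
lemma mv_shortExact (hcov : ChainCover A B) : (mvShortComplex A B).ShortExact :=
  HomologicalComplex.shortExact_of_degreewise_shortExact _ fun n =>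
    ShortComplex.Splitting.shortExact
      { r := mvR A B n
        s := mvS A B n
        f_r := mvF_mvR A B n
        s_g := mvS_mvG n hcov
        id := mv_total A B n }

/-- The homology of a direct sum of chain complexes. -/
noncomputable def homologyBiprod (K L : ChainComplex (ModuleCat.{0} ℤ) ℕ) (k : ℕ) :
    (K ⊞ L).homology k ≅ K.homology k ⊞ L.homology k :=
  have := Functor.preservesFiniteBiproductsOfAdditive
    (HomologicalComplex.homologyFunctor (ModuleCat.{0} ℤ) (ComplexShape.down ℕ) k)
  have := preservesBinaryBiproducts_of_preservesBiproducts
    (HomologicalComplex.homologyFunctor (ModuleCat.{0} ℤ) (ComplexShape.down ℕ) k)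
  (HomologicalComplex.homologyFunctor (ModuleCat.{0} ℤ) (ComplexShape.down ℕ) k).mapBiprod K L

/-- The homology of a direct sum, as a product of modules. -/
noncomputable def mvSumEquiv (A B : Set α) (k : ℕ) :
    (mvSum A B).homology k ≃+ (homologyOf A k × homologyOf B k) :=
  isoAddEquiv (homologyBiprod _ _ k ≪≫ ModuleCat.biprodIsoProd _ _)

lemma isZero_iff_subsingleton {M : ModuleCat.{0} ℤ} : IsZero M ↔ Subsingleton M :=
  ⟨fun h => ModuleCat.subsingleton_of_isZero h, fun _ => ModuleCat.isZero_of_subsingleton M⟩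

/-- If the intersection and the union have no homology in degree `k`, neither have the parts. -/
lemma mv_isZero (hcov : ChainCover A B) {k : ℕ} (h1 : IsZero (homologyOf (A ∩ B) k))
    (h2 : IsZero (homologyOf (A ∪ B) k)) :
    IsZero (homologyOf A k) ∧ IsZero (homologyOf B k) := by
  have h3 : IsZero ((mvSum A B).homology k) :=
    ((mv_shortExact hcov).homology_exact₂ k).isZero_of_both_zeros (h1.eq_of_src _ _)
      (h2.eq_of_tgt _ _)
  rw [isZero_iff_subsingleton] at h3
  have h4 := (mvSumEquiv A B k).symm.injective.subsingleton
  exact ⟨isZero_iff_subsingleton.2 ⟨fun x y => congr_arg Prod.fst (h4.elim (x, 0) (y, 0))⟩,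
    isZero_iff_subsingleton.2 ⟨fun x y => congr_arg Prod.snd (h4.elim (0, x) (0, y))⟩⟩

/-- Mayer-Vietoris when the union is acyclic. -/
lemma mv_equiv_of_union (hcov : ChainCover A B) {k : ℕ} (h1 : IsZero (homologyOf (A ∪ B) (k + 1)))
    (h2 : IsZero (homologyOf (A ∪ B) k)) :
    Nonempty (homologyOf (A ∩ B) k ≃+ (homologyOf A k × homologyOf B k)) := by
  have e1 := (mv_shortExact hcov).homology_exact₂ k
  have e2 := (mv_shortExact hcov).homology_exact₁ (k + 1) k rfl
  have : Mono (HomologicalComplex.homologyMap (mvF A B) k) := e2.mono_g (h1.eq_of_src _ _)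
  have : Epi (HomologicalComplex.homologyMap (mvF A B) k) := e1.epi_f (h2.eq_of_tgt _ _)
  have : IsIso (HomologicalComplex.homologyMap (mvF A B) k) := isIso_of_mono_of_epi _
  exact ⟨(isoAddEquiv (asIso (HomologicalComplex.homologyMap (mvF A B) k))).trans
    (mvSumEquiv A B k)⟩

/-- The homology of a disjoint union. -/
lemma mv_equiv_of_disjoint (hcov : ChainCover A B) (hd : A ∩ B = ∅) (k : ℕ) (hk : 1 ≤ k) :
    Nonempty (homologyOf (A ∪ B) k ≃+ (homologyOf A k × homologyOf B k)) := by
  obtain ⟨k, rfl⟩ : ∃ j, k = j + 1 := ⟨k - 1, by omega⟩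
  have : IsEmpty ↥(A ∩ B) := by rw [hd]; infer_instance
  have e1 := (mv_shortExact hcov).homology_exact₂ (k + 1)
  have e2 := (mv_shortExact hcov).homology_exact₃ (k + 1) k rfl
  have : Mono (HomologicalComplex.homologyMap (mvG A B) (k + 1)) :=
    e1.mono_g ((isZero_homology_of_isEmpty _).eq_of_src _ _)
  have : Epi (HomologicalComplex.homologyMap (mvG A B) (k + 1)) :=
    e2.epi_f ((isZero_homology_of_isEmpty _).eq_of_tgt _ _)
  have : IsIso (HomologicalComplex.homologyMap (mvG A B) (k + 1)) := isIso_of_mono_of_epi _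
  exact ⟨(isoAddEquiv (asIso (HomologicalComplex.homologyMap (mvG A B) (k + 1)))).symm.trans
    (mvSumEquiv A B (k + 1))⟩

end MayerVietoris
end SimplePoly

namespace SimplePoly


/-! ### Contractions, barycentric subdivision -/

/-- The identity and the constant map both lie below `f`, so all three act equally on homology. -/
lemma isZero_homology_of_contraction {P : Type} [PartialOrder P] (f : P →o P) (p : P)
    (h1 : ∀ x, x ≤ f x) (h2 : ∀ x, p ≤ f x) {k : ℕ} (hk : 1 ≤ k) :
    IsZero (SSet.homology (nerve P) ZZ k) := by
  refine isZero_homology_of_const hk p ?_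
  rw [hMap_eq_of_le (OrderHom.const P p) f h2, ← hMap_eq_of_le OrderHom.id f h1, hMap_id]

/-- Isomorphism in homology from two monotone maps, inverse up to comparability. -/
lemma homology_iso_of_le {P Q : Type} [PartialOrder P] [PartialOrder Q] (f : P →o Q) (g : Q →o P)
    (h1 : (∀ x, g (f x) ≤ x) ∨ ∀ x, x ≤ g (f x)) (h2 : ∀ x, f (g x) = x) (k : ℕ) :
    Nonempty (SSet.homology (nerve P) ZZ k ≅ SSet.homology (nerve Q) ZZ k) := by
  refine ⟨hIso f g k ?_ ?_⟩
  · rcases h1 with h1 | h1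
    · rw [hMap_eq_of_le (g.comp f) OrderHom.id h1, hMap_id]
    · rw [← hMap_eq_of_le OrderHom.id (g.comp f) h1, hMap_id]
  · rw [hMap_eq_of_le (f.comp g) OrderHom.id (fun x => (h2 x).le), hMap_id]

/-- Removing a point whose link is acyclic. -/
lemma isZero_homology_remove {α : Type} [PartialOrder α] {Q : Set α} {p : α} (hp : p ∈ Q) {k : ℕ}
    (h : IsZero (homologyOf Q k))
    (hl : IsZero (homologyOf {x | x ∈ Q ∧ x ≠ p ∧ (x ≤ p ∨ p ≤ x)} k)) :
    IsZero (homologyOf (Q \ {p}) k) := by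
  let A := Q \ {p}
  -- `B` is the star of `p` and `A ∩ B` is its link. A chain through `p` lies in the star, every
  -- other chain avoids `p`.
  let B := {x | x ∈ Q ∧ (x ≤ p ∨ p ≤ x)}
  have hu : A ∪ B = Q := by
    ext x
    simp only [A, B, Set.mem_union, Set.mem_sdiff, Set.mem_singleton_iff, Set.mem_ofPred_eq]
    by_cases hx : x = p
    · subst hx; simp
    · tauto
  have hi : A ∩ B = {x | x ∈ Q ∧ x ≠ p ∧ (x ≤ p ∨ p ≤ x)} := by
    ext x
    simp only [A, B, Set.mem_inter_iff, Set.mem_sdiff, Set.mem_singleton_iff, Set.mem_ofPred_eq]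
    tauto
  have hcov : ChainCover A B := by
    intro n x hm hx
    by_cases h : ∃ i, x i = p
    · right
      obtain ⟨i, rfl⟩ := h
      intro j
      refine ⟨hu ▸ hx j, ?_⟩
      exact (le_total j i).imp (fun h => hm h) (fun h => hm h)
    · left
      intro j
      exact ⟨hu ▸ hx j, fun hj => h ⟨j, hj⟩⟩
  rw [← hu] at h
  rw [← hi] at hl
  exact (mv_isZero hcov hl h).1

/-- The mapping cylinder of the map from chains to their maxima. -/
inductive Cyl (α : Type) : Type
  | lo : Finset α → Cyl α
  | hi : α → Cyl α

namespace Cyl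

variable {α : Type} [PartialOrder α]

/-- The order of the mapping cylinder. -/
protected def le : Cyl α → Cyl α → Prop
  | lo c, lo d => c ⊆ d
  | lo c, hi q => ∀ x ∈ c, x ≤ q
  | hi _, lo _ => False
  | hi p, hi q => p ≤ q

instance : PartialOrder (Cyl α) where
  le := Cyl.le
  le_refl a := by cases a <;> simp [Cyl.le]
  le_trans a b c hab hbc := by
    cases a <;> cases b <;> cases c <;> simp only [Cyl.le] at *
    · exact hab.trans hbc
    · exact fun x hx => hbc x (hab hx)
    · exact fun x hx => (hab x hx).trans hbc
    · exact hab.trans hbc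
  le_antisymm a b hab hba := by
    cases a <;> cases b <;> simp only [Cyl.le] at *
    · rw [Finset.Subset.antisymm hab hba]
    · rw [le_antisymm hab hba]

lemma lo_le_hi {c : Finset α} {q : α} : lo c ≤ hi q ↔ ∀ x ∈ c, x ≤ q := Iff.rfl
lemma not_hi_le_lo {c : Finset α} {q : α} : ¬ hi q ≤ lo c := id
/-- The chains of `S` together with the elements of `U`. -/
def part (S U : Set α) : Set (Cyl α)
  | lo c => c ∈ (orderComplex S).faces
  | hi p => p ∈ U

lemma lo_mem_part {S U : Set α} {c : Finset α} :
    lo c ∈ part S U ↔ c ∈ (orderComplex S).faces := Iff.rfl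
lemma hi_mem_part {S U : Set α} {p : α} : hi p ∈ part S U ↔ p ∈ U := Iff.rfl

end Cyl

section

variable {α : Type} [PartialOrder α]

lemma exists_max_of_chain {S : Set α} {c : Finset α} (hc : c ∈ (orderComplex S).faces) :
    ∃ p ∈ c, ∀ x ∈ c, x ≤ p := by
  obtain ⟨p, hp, hmax⟩ := c.exists_maximal hc.1
  exact ⟨p, hp, fun x hx => (hc.2.2 x hx p hp).elim id fun h => hmax hx h⟩

/-- The largest element of a chain. -/
noncomputable def chainMax {S : Set α} {c : Finset α} (hc : c ∈ (orderComplex S).faces) : α :=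
  (exists_max_of_chain hc).choose

lemma chainMax_mem {S : Set α} {c : Finset α} (hc : c ∈ (orderComplex S).faces) :
    chainMax hc ∈ c := (exists_max_of_chain hc).choose_spec.1

lemma le_chainMax {S : Set α} {c : Finset α} (hc : c ∈ (orderComplex S).faces) {x : α}
    (hx : x ∈ c) : x ≤ chainMax hc := (exists_max_of_chain hc).choose_spec.2 x hx

/-- The retraction of the cylinder onto its top. -/
noncomputable def cylTop (S : Set α) : Cyl.part S S →o S where
  toFun
    | ⟨.lo _, hc⟩ => ⟨chainMax hc, hc.2.1 _ (chainMax_mem hc)⟩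
    | ⟨.hi p, hp⟩ => ⟨p, hp⟩
  monotone' := by
    rintro ⟨a, ha⟩ ⟨b, hb⟩ hab
    cases a <;> cases b
    · exact le_chainMax hb (hab (chainMax_mem ha))
    · exact hab _ (chainMax_mem ha)
    · exact hab.elim
    · exact hab

/-- Moving each chain up to its largest element retracts the cylinder onto its top, a copy of `S`.
-/
lemma isZero_homology_cyl {S : Set α} {k : ℕ} (h : IsZero (homologyOf S k)) :
    IsZero (homologyOf (Cyl.part S S) k) := by
  let g : S →o Cyl.part S S := ⟨fun p => ⟨.hi p, p.2⟩, fun _ _ h => h⟩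
  obtain ⟨e⟩ := homology_iso_of_le (cylTop S) g (Or.inr (by
    rintro ⟨a, ha⟩
    cases a
    · exact fun x hx => le_chainMax ha hx
    · exact le_rfl)) (fun x => rfl) k
  exact h.of_iso e

open Classical in
-- The link is contracted by `c ≤ insert p c ≥ {p}` on chains. Minimality of `p` in `U` puts every
-- top element of the link above `p`, hence above the chain `{p}`.
lemma isZero_homology_cyl_link {S U : Set α} (hU : U ⊆ S) {p : α} (hp : p ∈ U)
    (hmin : ∀ q ∈ U, q ≤ p → q = p) {k : ℕ} (hk : 1 ≤ k) :
    IsZero (homologyOf {x | x ∈ Cyl.part S U ∧ x ≠ .hi p ∧ (x ≤ .hi p ∨ .hi p ≤ x)} k) := by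
  set L := {x | x ∈ Cyl.part S U ∧ x ≠ .hi p ∧ (x ≤ .hi p ∨ .hi p ≤ x)} with hL
  have hlo : ∀ {c : Finset α}, .lo c ∈ L ↔ c ∈ (orderComplex S).faces ∧ ∀ x ∈ c, x ≤ p := by
    intro c
    simp only [hL, Set.mem_ofPred_eq, Cyl.lo_mem_part, Cyl.lo_le_hi, Cyl.not_hi_le_lo, ne_eq,
      reduceCtorEq, not_false_eq_true, true_and, or_false]
  have hins : ∀ {c : Finset α}, .lo c ∈ L → .lo (insert p c) ∈ L := by
    intro c hc
    rw [hlo] at hc ⊢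
    refine ⟨⟨Finset.insert_nonempty _ _, ?_, ?_⟩, ?_⟩
    · intro a ha
      rcases Finset.mem_insert.1 ha with rfl | ha
      exacts [hU hp, hc.1.2.1 a ha]
    · intro a ha b hb
      rcases Finset.mem_insert.1 ha with h1 | h1 <;> rcases Finset.mem_insert.1 hb with h2 | h2
      · exact Or.inl (h1.trans h2.symm).le
      · exact Or.inr (h1 ▸ hc.2 _ h2)
      · exact Or.inl (h2 ▸ hc.2 _ h1)
      · exact hc.1.2.2 a h1 b h2
    · intro a ha
      rcases Finset.mem_insert.1 ha with rfl | ha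
      exacts [le_rfl, hc.2 _ ha]
  have hhi : ∀ {q : α}, .hi q ∈ L → p ≤ q := by
    rintro q ⟨h1, h2, h3 | h3⟩
    · exact (h2 (by rw [hmin q h1 h3])).elim
    · exact h3
  have hbase : .lo {p} ∈ L := by
    rw [hlo]
    refine ⟨⟨Finset.singleton_nonempty _, ?_, ?_⟩, ?_⟩ <;> simp [hU hp]
  let f : L →o L :=
    { toFun := fun
        | ⟨.lo c, hc⟩ => ⟨.lo (insert p c), hins hc⟩
        | ⟨.hi q, hq⟩ => ⟨.hi q, hq⟩
      monotone' := by
        rintro ⟨a, ha⟩ ⟨b, hb⟩ hab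
        cases a <;> cases b
        · exact Finset.insert_subset_insert _ hab
        · intro x hx
          rcases Finset.mem_insert.1 hx with rfl | hx
          exacts [hhi hb, hab x hx]
        · exact hab.elim
        · exact hab }
  refine isZero_homology_of_contraction f ⟨_, hbase⟩ ?_ ?_ hk
  · rintro ⟨a, ha⟩
    cases a
    · exact Finset.subset_insert _ _
    · exact le_rfl
  · rintro ⟨a, ha⟩
    cases a
    · exact Finset.singleton_subset_iff.2 (Finset.mem_insert_self _ _)
    · intro x hx
      rw [Finset.mem_singleton.1 hx]
      exact hhi ha

/-- The elements of the top are removed one at a time, minimal ones first, so that each link is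
acyclic in positive degrees. What is left is the bottom, the poset of chains. -/
lemma isZero_homology_cyl_bot {S : Set α} (hS : S.Finite) {k : ℕ} (hk : 1 ≤ k)
    (h : IsZero (homologyOf S k)) : IsZero (homologyOf (Cyl.part S ∅) k) := by
  have key : ∀ (n : ℕ) (U : Set α), U.ncard = n → U ⊆ S →
      IsZero (homologyOf (Cyl.part S U) k) → IsZero (homologyOf (Cyl.part S ∅) k) := by
    intro n
    induction n with
    | zero =>
      intro U hn hU hz
      rw [Set.ncard_eq_zero (hS.subset hU)] at hn
      rwa [hn] at hz
    | succ n ih =>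
      intro U hn hU hz
      obtain ⟨p, hp, hmin⟩ := (hS.subset hU).exists_minimal
        (Set.nonempty_of_ncard_ne_zero (by omega))
      have h1 := isZero_homology_remove (p := Cyl.hi p) (Q := Cyl.part S U) hp hz
        (isZero_homology_cyl_link hU hp (fun q hq hqp => le_antisymm hqp (hmin hq hqp)) hk)
      have h2 : Cyl.part S U \ {Cyl.hi p} = Cyl.part S (U \ {p}) := by
        ext x
        cases x with
        | lo c => simp [Cyl.lo_mem_part]
        | hi q => simp [Cyl.hi_mem_part]
      rw [h2] at h1
      exact ih (U \ {p}) (by rw [Set.ncard_sdiff_singleton_of_mem hp, hn]; rfl)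
        (Set.sdiff_subset.trans hU) h1
  exact key _ S rfl subset_rfl (isZero_homology_cyl h)

/-- Barycentric subdivision does not create homology in positive degrees. -/
theorem isZero_homology_orderComplex {S : Set α} (hS : S.Finite) {k : ℕ} (hk : 1 ≤ k)
    (h : IsZero (homologyOf S k)) : IsZero (homologyOf (orderComplex S).faces k) := by
  let f : Cyl.part S ∅ →o (orderComplex S).faces :=
    { toFun := fun
        | ⟨.lo c, hc⟩ => ⟨c, hc⟩
      monotone' := by
        rintro ⟨a, ha⟩ ⟨b, hb⟩ hab
        cases a <;> cases b
        · exact hab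
        · exact hb.elim
        · exact ha.elim
        · exact ha.elim }
  let g : (orderComplex S).faces →o Cyl.part S ∅ := ⟨fun c => ⟨.lo c, c.2⟩, fun _ _ h => h⟩
  obtain ⟨e⟩ := homology_iso_of_le f g (Or.inl (by
    rintro ⟨a, ha⟩
    cases a
    · exact le_rfl
    · exact ha.elim)) (fun x => rfl) k
  exact (isZero_homology_cyl_bot hS hk h).of_iso e.symm

/-! ### Homology in degree zero -/

lemma nerve_isConnected {Q : Set α} (hQ : IsConnectedSet Q) : (nerve Q).IsConnected := by
  have key : ∀ a b : Q, SSet.π₀.mk (nerveEquiv.symm a) = SSet.π₀.mk (X := nerve Q)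
      (nerveEquiv.symm b) := by
    rintro ⟨a, ha⟩ ⟨b, hb⟩
    have h := hQ.2 a ha b hb
    induction h with
    | refl => rfl
    | @tail c d h1 h2 ih =>
      have hc : c ∈ Q := by
        rcases Relation.ReflTransGen.cases_tail h1 with h | ⟨e, _, h⟩
        · exact h ▸ ha
        · exact h.1
      refine (ih hc).trans ?_
      rcases h2.2 with h | h
      · exact SSet.π₀.sound (nerve.edgeMk (homOfLE (show (⟨c, hc⟩ : Q) ≤ ⟨d, hb⟩ from h)))
      · exact (SSet.π₀.sound (nerve.edgeMk (homOfLE (show (⟨d, hb⟩ : Q) ≤ ⟨c, hc⟩ from h)))).symm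
  rw [SSet.isConnected_iff]
  refine ⟨⟨fun x y => ?_⟩, ?_⟩
  · obtain ⟨x, rfl⟩ := x.mk_surjective
    obtain ⟨y, rfl⟩ := y.mk_surjective
    rw [← nerveEquiv.symm_apply_apply x, ← nerveEquiv.symm_apply_apply y]
    exact key _ _
  · rw [← SSet.π₀.nonempty_iff]
    exact ⟨SSet.π₀.mk (nerveEquiv.symm (⟨hQ.1.some, hQ.1.some_mem⟩ : Q))⟩

lemma homology_zero_iso_of_sSet (X : SSet.{0}) (h : X.IsConnected) :
    Nonempty (X.homology ZZ 0 ≅ ZZ) :=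
  ⟨asIso (SSet.homology₀ε X ZZ)⟩

lemma homology_zero_iso_of_connected {Q : Set α} (hQ : IsConnectedSet Q) :
    Nonempty (homologyOf Q 0 ≅ ModuleCat.of ℤ ℤ) :=
  homology_zero_iso_of_sSet _ (nerve_isConnected hQ)

end
end SimplePoly

namespace SimplePoly

/-! ### One-dimensional cohomology by cocycles -/

section UCT

open Simplicial Opposite

/-- A cocycle on the partially ordered set `Q`. -/
def IsCocycle {α F : Type} [PartialOrder α] [AddCommGroup F] (Q : Set α) (φ : α → α → F) : Prop :=
  ∀ x ∈ Q, ∀ y ∈ Q, ∀ z ∈ Q, x ≤ y → y ≤ z → φ x z = φ x y + φ y z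

/-- A coboundary on the partially ordered set `Q`. -/
def IsCoboundary {α F : Type} [PartialOrder α] [AddCommGroup F] (Q : Set α) (φ : α → α → F) :
    Prop :=
  ∃ f : α → F, ∀ x ∈ Q, ∀ y ∈ Q, x ≤ y → φ x y = f y - f x

variable {α F : Type} [PartialOrder α] [AddCommGroup F] {Q : Set α}

/-- The element of `M` that a morphism from the integers picks. -/
lemma hom_ZZ_eq {M : ModuleCat.{0} ℤ} (u v : ZZ ⟶ M) (h : u (1 : ℤ) = v (1 : ℤ)) : u = v := by
  ext
  exact h

/-- The morphism from the integers that picks a given element. -/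
def homOfElt (a : F) : ZZ ⟶ ModuleCat.of ℤ F := ModuleCat.ofHom (LinearMap.toSpanSingleton ℤ F a)

lemma homOfElt_apply (a : F) : homOfElt a (1 : ℤ) = a := one_smul ℤ a

lemma homOfElt_add (a b : F) : homOfElt (a + b) = homOfElt a + homOfElt b :=
  hom_ZZ_eq _ _ (by
    rw [homOfElt_apply]
    change _ = homOfElt a (1 : ℤ) + homOfElt b (1 : ℤ)
    rw [homOfElt_apply, homOfElt_apply])

/-- A function of two variables as a morphism from the one-chains. -/
noncomputable def cochainHom (Q : Set α) (φ : α → α → F) :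
    ((nerve Q).chainComplex ZZ).X 1 ⟶ ModuleCat.of ℤ F :=
  chainDesc fun x => homOfElt (φ (simplexVertex x 0) (simplexVertex x 1))

lemma simplexVertex_δ {n : ℕ} (x : (nerve Q) _⦋n + 1⦌) (i : Fin (n + 2)) (j : Fin (n + 1)) :
    simplexVertex ((nerve Q).δ i x) j = simplexVertex x (i.succAbove j) := rfl

lemma d_cochainHom {φ : α → α → F} (hφ : IsCocycle Q φ) :
    ((nerve Q).chainComplex ZZ).d 2 1 ≫ cochainHom Q φ = 0 := by
  refine SSet.chainComplex_hom_ext fun x => ?_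
  rw [SSet.ιChainComplex_d_assoc, Preadditive.sum_comp, comp_zero, Fin.sum_univ_three]
  simp only [Preadditive.zsmul_comp, cochainHom, ι_chainDesc, simplexVertex_δ]
  have h := hφ _ (simplexVertex_mem x 0) _ (simplexVertex_mem x 1) _ (simplexVertex_mem x 2)
    (simplexVertex_mono x (by decide)) (simplexVertex_mono x (by decide))
  have e0 : (0 : Fin 3).succAbove (0 : Fin 2) = 1 := rfl
  have e1 : (0 : Fin 3).succAbove (1 : Fin 2) = 2 := rfl
  have e2 : (1 : Fin 3).succAbove (0 : Fin 2) = 0 := rfl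
  have e3 : (1 : Fin 3).succAbove (1 : Fin 2) = 2 := rfl
  have e4 : (2 : Fin 3).succAbove (0 : Fin 2) = 0 := rfl
  have e5 : (2 : Fin 3).succAbove (1 : Fin 2) = 1 := rfl
  rw [e0, e1, e2, e3, e4, e5, h, homOfElt_add]
  simp

/-- The evaluation of a cocycle on homology classes. -/
noncomputable def evCocycle (Q : Set α) (φ : α → α → F) (hφ : IsCocycle Q φ) :
    SSet.homology (nerve Q) ZZ 1 ⟶ ModuleCat.of ℤ F :=
  ((nerve Q).chainComplex ZZ).homologyι 1 ≫
    ((nerve Q).chainComplex ZZ).descOpcycles (cochainHom Q φ) 2 (by simp) (d_cochainHom hφ)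

lemma π_evCocycle (φ : α → α → F) (hφ : IsCocycle Q φ) :
    ((nerve Q).chainComplex ZZ).homologyπ 1 ≫ evCocycle Q φ hφ =
      ((nerve Q).chainComplex ZZ).iCycles 1 ≫ cochainHom Q φ := by
  rw [evCocycle, HomologicalComplex.homology_π_ι_assoc, HomologicalComplex.p_descOpcycles]

/-- The boundary map from one-chains to zero-chains has a quasi-inverse. -/
lemma exists_quasi_inverse (X : SSet.{0}) :
    ∃ r : (X.chainComplex ZZ).X 0 ⟶ (X.chainComplex ZZ).X 1,
      (X.chainComplex ZZ).d 1 0 ≫ r ≫ (X.chainComplex ZZ).d 1 0 = (X.chainComplex ZZ).d 1 0 := by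
  have hproj : Projective (ModuleCat.of ℤ ℤ) :=
    (IsProjective.iff_projective ℤ).1 inferInstance
  have : Epi (SSet.π₀.fromChainComplexXZero X ZZ) :=
    epi_of_isColimit_cofork (SSet.isColimitCokernelCoforkChainComplexDOneZero X ZZ)
  -- The cokernel of the boundary map is free on the path components, so the projection to it has a
  -- section `s`. The projection followed by `s` differs from the identity by a map into the image
  -- of the boundary, and lifting that map on generators produces `r`.
  let s := Projective.factorThru (𝟙 (∐ (fun (_ : SSet.π₀ X) ↦ ZZ)))
    (SSet.π₀.fromChainComplexXZero X ZZ)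
  have hs : s ≫ SSet.π₀.fromChainComplexXZero X ZZ = 𝟙 _ := Projective.factorThru_comp _ _
  have hex : (ShortComplex.mk _ _ (SSet.π₀.d_fromChainComplexXZero X ZZ 1)).Exact :=
    ShortComplex.exact_of_g_is_cokernel _
      (SSet.isColimitCokernelCoforkChainComplexDOneZero X ZZ)
  have h1 : (𝟙 _ - SSet.π₀.fromChainComplexXZero X ZZ ≫ s) ≫
      SSet.π₀.fromChainComplexXZero X ZZ = 0 := by
    rw [Preadditive.sub_comp, Category.assoc, hs, Category.comp_id, Category.id_comp, sub_self]
  have h2 : ∀ x, ∃ m, (X.chainComplex ZZ).d 1 0 m = (X.ιChainComplex (R := ZZ) x ≫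
      (𝟙 _ - SSet.π₀.fromChainComplexXZero X ZZ ≫ s)) (1 : ℤ) := fun x =>
    (ShortComplex.moduleCat_exact_iff _).1 hex _
      (ConcreteCategory.congr_hom h1 (X.ιChainComplex (R := ZZ) x (1 : ℤ)))
  choose m hm using h2
  let r : (X.chainComplex ZZ).X 0 ⟶ (X.chainComplex ZZ).X 1 :=
    chainDesc fun x => ModuleCat.ofHom (LinearMap.toSpanSingleton ℤ _ (m x))
  have h3 : r ≫ (X.chainComplex ZZ).d 1 0 = 𝟙 _ - SSet.π₀.fromChainComplexXZero X ZZ ≫ s := by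
    refine SSet.chainComplex_hom_ext fun x => ?_
    rw [← Category.assoc, show X.ιChainComplex x ≫ r = _ from ι_chainDesc _ x]
    refine hom_ZZ_eq _ _ ((?_ : _ = _).trans (hm x))
    refine congr_arg ((X.chainComplex ZZ).d 1 0) ?_
    exact LinearMap.toSpanSingleton_apply_one ℤ _ (m x)
  refine ⟨r, ?_⟩
  rw [h3, Preadditive.comp_sub, Category.comp_id, SSet.π₀.d_fromChainComplexXZero_assoc, zero_comp,
    sub_zero]

lemma chainDesc_eq {X : SSet.{0}} {n : ℕ} {M : ModuleCat.{0} ℤ}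
    (c : (X.chainComplex ZZ).X n ⟶ M) (g : X _⦋n⦌ → (ZZ ⟶ M))
    (h : ∀ x, X.ιChainComplex x ≫ c = g x) : c = chainDesc g :=
  SSet.chainComplex_hom_ext fun x => by rw [h, ι_chainDesc]

/-- The edge of the nerve between two comparable elements. -/
def edgeSimplex {x y : α} (hx : x ∈ Q) (hy : y ∈ Q) (h : x ≤ y) : (nerve Q) _⦋1⦌ :=
  simplexMk ![x, y] (by
    intro i j hij
    fin_cases i <;> fin_cases j
    · exact le_rfl
    · exact h
    · exact absurd hij (by decide)
    · exact le_rfl) (by intro i; fin_cases i; exacts [hx, hy])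

lemma eq_edgeSimplex (e : (nerve Q) _⦋1⦌) :
    e = edgeSimplex (simplexVertex_mem e 0) (simplexVertex_mem e 1)
      (simplexVertex_mono e (by decide)) :=
  simplex_ext fun i => by fin_cases i <;> rfl

/-- The point of the nerve given by an element. -/
def pointSimplex {x : α} (hx : x ∈ Q) : (nerve Q) _⦋0⦌ :=
  simplexMk (fun _ => x) (fun _ _ _ => le_rfl) fun _ => hx

lemma edgeSimplex_d {x y : α} (hx : x ∈ Q) (hy : y ∈ Q) (h : x ≤ y) :
    (nerve Q).ιChainComplex (R := ZZ) (edgeSimplex hx hy h) ≫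
      ((nerve Q).chainComplex ZZ).d 1 0 =
    (nerve Q).ιChainComplex (pointSimplex hy) - (nerve Q).ιChainComplex (pointSimplex hx) := by
  have h0 : (nerve Q).δ (0 : Fin 2) (edgeSimplex hx hy h) = pointSimplex hy :=
    simplex_ext fun i => by fin_cases i; rfl
  have h1 : (nerve Q).δ (1 : Fin 2) (edgeSimplex hx hy h) = pointSimplex hx :=
    simplex_ext fun i => by fin_cases i; rfl
  rw [SSet.ιChainComplex_d, Fin.sum_univ_two, h0, h1]
  simp [sub_eq_add_neg]

lemma cochainHom_edge (φ : α → α → F) {x y : α} (hx : x ∈ Q) (hy : y ∈ Q) (h : x ≤ y) :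
    (nerve Q).ιChainComplex (R := ZZ) (edgeSimplex hx hy h) ≫ cochainHom Q φ =
      homOfElt (φ x y) := by
  rw [cochainHom, ι_chainDesc]; rfl

open Classical in
/-- A cocycle whose evaluation vanishes is a coboundary. -/
lemma isCoboundary_of_evCocycle {φ : α → α → F} (hφ : IsCocycle Q φ) (h : evCocycle Q φ hφ = 0) :
    IsCoboundary Q φ := by
  obtain ⟨r, hr⟩ := exists_quasi_inverse (nerve Q)
  have h1 : ((nerve Q).chainComplex ZZ).iCycles 1 ≫ cochainHom Q φ = 0 := by
    rw [← π_evCocycle φ hφ, h, comp_zero]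
  -- The endomorphism `𝟙 - d ≫ r` takes values in the cycles, where the cochain vanishes. Hence the
  -- cochain is the coboundary of `r ≫ cochainHom Q φ`.
  have h2 : cochainHom Q φ = ((nerve Q).chainComplex ZZ).d 1 0 ≫ r ≫ cochainHom Q φ := by
    have h3 : (𝟙 _ - ((nerve Q).chainComplex ZZ).d 1 0 ≫ r) ≫
        ((nerve Q).chainComplex ZZ).d 1 0 = 0 := by
      rw [Preadditive.sub_comp, Category.id_comp, Category.assoc, hr, sub_self]
    have h4 := ((nerve Q).chainComplex ZZ).liftCycles_i _ 0 (by simp) h3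
    have h5 : (𝟙 _ - ((nerve Q).chainComplex ZZ).d 1 0 ≫ r) ≫ cochainHom Q φ = 0 := by
      rw [← h4, Category.assoc, h1, comp_zero]
    rwa [Preadditive.sub_comp, Category.id_comp, sub_eq_zero, Category.assoc] at h5
  refine ⟨fun x => if hx : x ∈ Q then
    ((nerve Q).ιChainComplex (pointSimplex hx) ≫ r ≫ cochainHom Q φ) (1 : ℤ) else 0, ?_⟩
  intro x hx y hy hxy
  have h3 := cochainHom_edge φ hx hy hxy
  rw [h2, ← Category.assoc, edgeSimplex_d, Preadditive.sub_comp] at h3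
  simp only [dif_pos hx, dif_pos hy]
  rw [← homOfElt_apply (φ x y), ← h3]
  rfl

open Classical in
/-- Every homomorphism on the homology is the evaluation of a cocycle. -/
lemma exists_cocycle (ψ : SSet.homology (nerve Q) ZZ 1 ⟶ ModuleCat.of ℤ F) :
    ∃ (φ : α → α → F) (hφ : IsCocycle Q φ), evCocycle Q φ hφ = ψ := by
  obtain ⟨r, hr⟩ := exists_quasi_inverse (nerve Q)
  have h3 : (𝟙 _ - ((nerve Q).chainComplex ZZ).d 1 0 ≫ r) ≫
      ((nerve Q).chainComplex ZZ).d 1 0 = 0 := by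
    rw [Preadditive.sub_comp, Category.id_comp, Category.assoc, hr, sub_self]
  -- The map `𝟙 - d ≫ r` is a projection of the one-chains onto the cycles; it extends `ψ` from the
  -- cycles to a cochain.
  let c := ((nerve Q).chainComplex ZZ).liftCycles (i := 1) _ 0 (by simp) h3 ≫
    ((nerve Q).chainComplex ZZ).homologyπ 1 ≫ ψ
  let φ : α → α → F := fun x y => if h : x ∈ Q ∧ y ∈ Q ∧ x ≤ y then
    ((nerve Q).ιChainComplex (edgeSimplex h.1 h.2.1 h.2.2) ≫ c) (1 : ℤ) else 0
  have hc : cochainHom Q φ = c := by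
    refine (chainDesc_eq c _ fun e => ?_).symm
    refine hom_ZZ_eq _ _ ?_
    rw [homOfElt_apply]
    have h : simplexVertex e 0 ∈ Q ∧ simplexVertex e 1 ∈ Q ∧
      simplexVertex e 0 ≤ simplexVertex e 1 :=
      ⟨simplexVertex_mem e 0, simplexVertex_mem e 1, simplexVertex_mono e (by decide)⟩
    simp only [φ, dif_pos h]
    rw [← eq_edgeSimplex]
  have h4 : ((nerve Q).chainComplex ZZ).d 2 1 ≫ c = 0 := by
    have h5 : ((nerve Q).chainComplex ZZ).d 2 1 ≫ ((nerve Q).chainComplex ZZ).liftCycles (i := 1)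
        _ 0 (by simp) h3 = ((nerve Q).chainComplex ZZ).toCycles 2 1 := by
      rw [← cancel_mono (((nerve Q).chainComplex ZZ).iCycles 1), Category.assoc,
        HomologicalComplex.liftCycles_i, HomologicalComplex.toCycles_i, Preadditive.comp_sub,
        Category.comp_id, HomologicalComplex.d_comp_d_assoc, zero_comp, sub_zero]
    rw [reassoc_of% h5, HomologicalComplex.toCycles_comp_homologyπ_assoc, zero_comp]
  have hφ : IsCocycle Q φ := by
    intro x hx y hy z hz hxy hyz
    let t : (nerve Q) _⦋2⦌ := simplexMk ![x, y, z] (by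
      rw [Fin.monotone_iff_le_succ]
      intro i
      fin_cases i
      exacts [hxy, hyz]) (by intro i; fin_cases i; exacts [hx, hy, hz])
    have h5 := congr_arg (fun w => (nerve Q).ιChainComplex (R := ZZ) t ≫ w) h4
    simp only [← hc, comp_zero] at h5
    rw [SSet.ιChainComplex_d_assoc, Preadditive.sum_comp, Fin.sum_univ_three] at h5
    simp only [Preadditive.zsmul_comp, cochainHom, ι_chainDesc, simplexVertex_δ] at h5
    have e0 : (0 : Fin 3).succAbove (0 : Fin 2) = 1 := rfl
    have e1 : (0 : Fin 3).succAbove (1 : Fin 2) = 2 := rfl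
    have e2 : (1 : Fin 3).succAbove (0 : Fin 2) = 0 := rfl
    have e3 : (1 : Fin 3).succAbove (1 : Fin 2) = 2 := rfl
    have e4 : (2 : Fin 3).succAbove (0 : Fin 2) = 0 := rfl
    have e5 : (2 : Fin 3).succAbove (1 : Fin 2) = 1 := rfl
    rw [e0, e1, e2, e3, e4, e5] at h5
    have h6 : homOfElt (φ x z) = homOfElt (φ x y) + homOfElt (φ y z) := by
      have h7 : homOfElt (φ y z) - homOfElt (φ x z) + homOfElt (φ x y) = 0 := by
        rw [← h5]
        simp [t, simplexVertex_mk, sub_eq_add_neg]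
      rw [← sub_eq_zero, ← neg_eq_zero, ← h7]
      abel
    rw [← homOfElt_add] at h6
    rw [← homOfElt_apply (φ x z), h6, homOfElt_apply]
  refine ⟨φ, hφ, ?_⟩
  rw [← cancel_epi (((nerve Q).chainComplex ZZ).homologyπ 1), π_evCocycle, hc]
  have h5 : ((nerve Q).chainComplex ZZ).iCycles 1 ≫ ((nerve Q).chainComplex ZZ).liftCycles (i := 1)
      _ 0 (by simp) h3 = 𝟙 _ := by
    rw [← cancel_mono (((nerve Q).chainComplex ZZ).iCycles 1), Category.assoc,
      HomologicalComplex.liftCycles_i, Preadditive.comp_sub, Category.comp_id, Category.id_comp,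
      HomologicalComplex.iCycles_d_assoc, zero_comp, sub_zero]
  rw [reassoc_of% h5]

end UCT
end SimplePoly

namespace SimplePoly

/-! ### First cohomology over a field and its duality with homology -/

section Cohomology

variable {α F : Type} [PartialOrder α] [Field F] {Q A B : Set α}

variable (F) in
/-- The cocycles on `Q`. -/
def Z1 (Q : Set α) : Submodule F (α → α → F) where
  carrier := {φ | IsCocycle Q φ}
  add_mem' {φ ψ} hφ hψ x hx y hy z hz h h' := by
    simp only [Pi.add_apply, hφ x hx y hy z hz h h', hψ x hx y hy z hz h h']; ring
  zero_mem' x _ y _ z _ _ _ := by simp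
  smul_mem' c φ hφ x hx y hy z hz h h' := by
    simp only [Pi.smul_apply, hφ x hx y hy z hz h h', smul_add]

variable (F) in
/-- The coboundaries on `Q`. -/
def B1 (Q : Set α) : Submodule F (α → α → F) where
  carrier := {φ | IsCoboundary Q φ}
  add_mem' := by
    rintro φ ψ ⟨f, hf⟩ ⟨g, hg⟩
    refine ⟨f + g, fun x hx y hy h => ?_⟩
    simp only [Pi.add_apply, hf x hx y hy h, hg x hx y hy h]; ring
  zero_mem' := ⟨0, fun x _ y _ _ => by simp⟩
  smul_mem' := by
    rintro c φ ⟨f, hf⟩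
    refine ⟨c • f, fun x hx y hy h => ?_⟩
    simp only [Pi.smul_apply, hf x hx y hy h, smul_sub]

lemma IsCocycle.mono {φ : α → α → F} (h : IsCocycle Q φ) (hA : A ⊆ Q) : IsCocycle A φ :=
  fun x hx y hy z hz => h x (hA hx) y (hA hy) z (hA hz)

lemma IsCoboundary.mono {φ : α → α → F} (h : IsCoboundary Q φ) (hA : A ⊆ Q) : IsCoboundary A φ :=
  let ⟨f, hf⟩ := h
  ⟨f, fun x hx y hy => hf x (hA hx) y (hA hy)⟩

lemma IsCoboundary.isCocycle {φ : α → α → F} (h : IsCoboundary Q φ) : IsCocycle Q φ := by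
  obtain ⟨f, hf⟩ := h
  intro x hx y hy z hz h h'
  rw [hf x hx z hz (h.trans h'), hf x hx y hy h, hf y hy z hz h']
  ring

lemma isCocycle_self {φ : α → α → F} (h : IsCocycle Q φ) {x : α} (hx : x ∈ Q) : φ x x = 0 := by
  simpa using h x hx x hx x hx le_rfl le_rfl

variable (F) in
/-- The first cohomology. -/
abbrev H1 (Q : Set α) : Type := Z1 F Q ⧸ (B1 F Q).submoduleOf (Z1 F Q)

variable (F) in
/-- The dimension of the first cohomology. -/
noncomputable def h1 (Q : Set α) : ℕ := Module.finrank F (H1 F Q)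

lemma cochainHom_add (φ ψ : α → α → F) :
    cochainHom Q (φ + ψ) = cochainHom Q φ + cochainHom Q ψ := by
  refine SSet.chainComplex_hom_ext fun x => ?_
  rw [Preadditive.comp_add]
  simp only [cochainHom, ι_chainDesc, Pi.add_apply, homOfElt_add]

/-- Multiplication by a scalar. -/
def scalarHom (c : F) : ModuleCat.of ℤ F ⟶ ModuleCat.of ℤ F :=
  ModuleCat.ofHom (AddMonoidHom.mulLeft c).toIntLinearMap

lemma scalarHom_apply (c a : F) : scalarHom c a = c * a := rfl

lemma cochainHom_smul (c : F) (φ : α → α → F) :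
    cochainHom Q (c • φ) = cochainHom Q φ ≫ scalarHom c := by
  refine SSet.chainComplex_hom_ext fun x => ?_
  rw [← Category.assoc]
  simp only [cochainHom, ι_chainDesc, Pi.smul_apply]
  refine hom_ZZ_eq _ _ ?_
  rw [homOfElt_apply]
  change _ = scalarHom c (homOfElt _ (1 : ℤ))
  rw [homOfElt_apply, scalarHom_apply, smul_eq_mul]

lemma evCocycle_add {φ ψ : α → α → F} (hφ : IsCocycle Q φ) (hψ : IsCocycle Q ψ)
    (h : IsCocycle Q (φ + ψ)) :
    evCocycle Q (φ + ψ) h = evCocycle Q φ hφ + evCocycle Q ψ hψ := by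
  rw [← cancel_epi (((nerve Q).chainComplex ZZ).homologyπ 1), Preadditive.comp_add, π_evCocycle,
    π_evCocycle, π_evCocycle, cochainHom_add, Preadditive.comp_add]

lemma evCocycle_smul (c : F) {φ : α → α → F} (hφ : IsCocycle Q φ) (h : IsCocycle Q (c • φ)) :
    evCocycle Q (c • φ) h = evCocycle Q φ hφ ≫ scalarHom c := by
  rw [← cancel_epi (((nerve Q).chainComplex ZZ).homologyπ 1), π_evCocycle, ← Category.assoc,
    π_evCocycle, cochainHom_smul, Category.assoc]

variable (F) in
/-- The evaluation of cocycles on homology classes. -/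
noncomputable def evMap (Q : Set α) : Z1 F Q →ₗ[F] (homologyOf Q 1 →+ F) where
  toFun φ := (evCocycle Q φ.1 φ.2).hom.toAddMonoidHom
  map_add' φ ψ :=
    congr_arg (fun w => w.hom.toAddMonoidHom) (evCocycle_add φ.2 ψ.2 (φ + ψ).2)
  map_smul' c φ := congr_arg (fun w => w.hom.toAddMonoidHom) (evCocycle_smul c φ.2 (c • φ).2)

lemma evMap_surjective : Function.Surjective (evMap F Q) := by
  intro ψ
  obtain ⟨φ, hφ, h⟩ := exists_cocycle (Q := Q) (F := F) (ModuleCat.ofHom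
    { toFun := ψ, map_add' := ψ.map_add, map_smul' := fun n x => map_intCast_smul ψ ℤ ℤ n x })
  refine ⟨⟨φ, hφ⟩, ?_⟩
  ext x
  exact ConcreteCategory.congr_hom h x

lemma ker_evMap : LinearMap.ker (evMap F Q) = (B1 F Q).submoduleOf (Z1 F Q) := by
  ext φ
  rw [LinearMap.mem_ker]
  change _ ↔ IsCoboundary Q φ.1
  constructor
  · intro h
    refine isCoboundary_of_evCocycle φ.2 ?_
    ext x
    exact DFunLike.congr_fun h x
  · rintro ⟨f, hf⟩
    have h : evCocycle Q φ.1 φ.2 = 0 := by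
      rw [← cancel_epi (((nerve Q).chainComplex ZZ).homologyπ 1), comp_zero]
      refine (π_evCocycle φ.1 φ.2).trans ?_
      have : cochainHom Q φ.1 = ((nerve Q).chainComplex ZZ).d 1 0 ≫
          chainDesc fun x => homOfElt (f (simplexVertex x 0)) := by
        refine SSet.chainComplex_hom_ext fun x => ?_
        rw [eq_edgeSimplex x, cochainHom_edge, ← Category.assoc, edgeSimplex_d,
          Preadditive.sub_comp, ι_chainDesc, ι_chainDesc, hf _ (simplexVertex_mem x 0) _
          (simplexVertex_mem x 1) (simplexVertex_mono x (by decide)), eq_sub_iff_add_eq]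
        refine (homOfElt_add _ _).symm.trans (congr_arg homOfElt ?_)
        exact sub_add_cancel _ _
      rw [this, HomologicalComplex.iCycles_d_assoc, zero_comp]
    change (evCocycle Q φ.1 φ.2).hom.toAddMonoidHom = 0
    rw [h]
    rfl

/-- The first cohomology is dual to the first homology. -/
noncomputable def uct (Q : Set α) : H1 F Q ≃ₗ[F] (homologyOf Q 1 →+ F) :=
  (Submodule.quotEquivOfEq _ _ ker_evMap.symm).trans
    ((evMap F Q).quotKerEquivOfSurjective evMap_surjective)

lemma isCoboundary_of_isZero (h : IsZero (homologyOf Q 1)) {φ : α → α → F} (hφ : IsCocycle Q φ) :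
    IsCoboundary Q φ :=
  isCoboundary_of_evCocycle hφ (h.eq_of_src _ _)

end Cohomology
end SimplePoly

namespace SimplePoly

/-! ### Euler characteristics of graph posets, restriction and gluing of cocycles -/

section CohomologyTools

variable {α F : Type} [PartialOrder α] [Field F] {Q A B X : Set α}

/-- The strictly comparable pairs of elements of `Q`. -/
abbrev Pairs (Q : Set α) : Type := {p : Q × Q // p.1 < p.2}

variable (F) in
/-- The coboundary map. -/
def dmap (Q : Set α) : (Q → F) →ₗ[F] (Pairs Q → F) where
  toFun f p := f p.1.2 - f p.1.1
  map_add' f g := by ext p; simp only [Pi.add_apply]; ring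
  map_smul' c f := by ext p; simp only [Pi.smul_apply, RingHom.id_apply, smul_sub]

variable (F) in
/-- The locally constant functions. -/
def LC (Q : Set α) : Submodule F (Q → F) := LinearMap.ker (dmap F Q)

lemma mem_LC {f : Q → F} : f ∈ LC F Q ↔ ∀ x y : Q, x ≤ y → f x = f y := by
  constructor
  · intro h x y hxy
    rcases hxy.eq_or_lt with rfl | hlt
    · rfl
    · exact (sub_eq_zero.1 (congr_fun (LinearMap.mem_ker.1 h) ⟨(x, y), hlt⟩)).symm
  · intro h
    refine LinearMap.mem_ker.2 (funext fun p => sub_eq_zero.2 (h _ _ p.2.le).symm)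

variable (F) in
/-- The restriction of cocycles to strictly comparable pairs. -/
def pairRes (Q : Set α) : (α → α → F) →ₗ[F] (Pairs Q → F) where
  toFun φ p := φ p.1.1 p.1.2
  map_add' _ _ := rfl
  map_smul' _ _ := rfl

open Classical in
lemma isCoboundary_iff {φ : α → α → F} (hφ : IsCocycle Q φ) :
    IsCoboundary Q φ ↔ pairRes F Q φ ∈ LinearMap.range (dmap F Q) := by
  constructor
  · rintro ⟨f, hf⟩
    exact ⟨fun x => f x, funext fun p => (hf _ p.1.1.2 _ p.1.2.2 p.2.le).symm⟩
  · rintro ⟨f, hf⟩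
    refine ⟨fun x => if h : x ∈ Q then f ⟨x, h⟩ else 0, fun x hx y hy hxy => ?_⟩
    simp only [dif_pos hx, dif_pos hy]
    rcases hxy.eq_or_lt with rfl | hlt
    · rw [isCocycle_self hφ hx, sub_self]
    · exact (congr_fun hf ⟨(⟨x, hx⟩, ⟨y, hy⟩), hlt⟩).symm

instance finite_pairs [Finite Q] : Finite (Pairs Q) := inferInstance

variable (F) in
/-- The first cohomology as a subspace of the cokernel of the coboundary map. -/
noncomputable def H1ToCoker (Q : Set α) : H1 F Q →ₗ[F] (Pairs Q → F) ⧸ LinearMap.range (dmap F Q) :=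
  Submodule.liftQ _ ((Submodule.mkQ _).comp ((pairRes F Q).comp (Z1 F Q).subtype)) (by
    intro φ hφ
    rw [LinearMap.mem_ker]
    exact (Submodule.Quotient.mk_eq_zero _).2 ((isCoboundary_iff φ.2).1 hφ))

/-- This makes `H1` finite-dimensional for finite `Q`, although the cochains in `Z1` have arbitrary
values off `Q`. -/
lemma H1ToCoker_injective : Function.Injective (H1ToCoker F Q) := by
  rw [injective_iff_map_eq_zero]
  intro x hx
  obtain ⟨φ, rfl⟩ := Submodule.mkQ_surjective _ x
  refine (Submodule.Quotient.mk_eq_zero _).2 ((isCoboundary_iff φ.2).2 ?_)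
  exact (Submodule.Quotient.mk_eq_zero _).1 hx

instance [Finite Q] : Module.Finite F (H1 F Q) :=
  Module.Finite.of_injective _ H1ToCoker_injective

/-- There are no three-element chains. -/
def IsGraphPoset (Q : Set α) : Prop := ∀ x ∈ Q, ∀ y ∈ Q, ∀ z ∈ Q, x < y → ¬ y < z

open Classical in
-- Without three-element chains, every instance of the cocycle condition has a repeated element.
lemma IsGraphPoset.isCocycle (hQ : IsGraphPoset Q) {φ : α → α → F} (h : ∀ x ∈ Q, φ x x = 0) :
    IsCocycle Q φ := by
  intro x hx y hy z hz hxy hyz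
  rcases hxy.eq_or_lt with rfl | h1
  · rw [h x hx, zero_add]
  · rcases hyz.eq_or_lt with rfl | h2
    · rw [h y hy, add_zero]
    · exact absurd h2 (hQ x hx y hy z hz h1)

open Classical in
lemma IsGraphPoset.exists_cocycle (hQ : IsGraphPoset Q) (c : Pairs Q → F) :
    ∃ φ : α → α → F, IsCocycle Q φ ∧ pairRes F Q φ = c := by
  refine ⟨fun x y => if h : ∃ p : Pairs Q, p.1.1.1 = x ∧ p.1.2.1 = y then c h.choose else 0,
    hQ.isCocycle fun x hx => ?_, ?_⟩
  · refine dif_neg ?_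
    rintro ⟨⟨⟨a, b⟩, hab⟩, rfl, h⟩
    exact hab.ne (Subtype.ext h.symm)
  · ext p
    have h : ∃ q : Pairs Q, q.1.1.1 = p.1.1.1 ∧ q.1.2.1 = p.1.2.1 := ⟨p, rfl, rfl⟩
    have h2 : h.choose = p :=
      Subtype.ext (Prod.ext (Subtype.ext h.choose_spec.1) (Subtype.ext h.choose_spec.2))
    change (dite _ _ _) = _
    rw [dif_pos h, h2]

lemma IsGraphPoset.h1_eq (hQ : IsGraphPoset Q) :
    h1 F Q = Module.finrank F ((Pairs Q → F) ⧸ LinearMap.range (dmap F Q)) := by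
  refine (LinearEquiv.ofBijective (H1ToCoker F Q) ⟨H1ToCoker_injective, fun x => ?_⟩).finrank_eq
  obtain ⟨c, rfl⟩ := Submodule.mkQ_surjective _ x
  obtain ⟨φ, hφ, rfl⟩ := hQ.exists_cocycle c
  exact ⟨Submodule.mkQ _ ⟨φ, hφ⟩, rfl⟩

lemma finrank_range_dmap [Finite Q] :
    Module.finrank F (LinearMap.range (dmap F Q)) + Module.finrank F (LC F Q) = Nat.card Q := by
  have := Fintype.ofFinite Q
  rw [LC, LinearMap.finrank_range_add_finrank_ker, Module.finrank_fintype_fun_eq_card,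
    Nat.card_eq_fintype_card]

lemma finrank_coker_dmap [Finite Q] :
    Module.finrank F ((Pairs Q → F) ⧸ LinearMap.range (dmap F Q)) +
      Module.finrank F (LinearMap.range (dmap F Q)) = Nat.card (Pairs Q) := by
  have := Fintype.ofFinite (Pairs Q)
  rw [Submodule.finrank_quotient_add_finrank, Module.finrank_fintype_fun_eq_card,
    Nat.card_eq_fintype_card]

/-- This is rank-nullity for the coboundary map from functions on elements to functions on pairs:
the kernel is the zeroth cohomology, the cokernel the first. -/
lemma IsGraphPoset.euler [Finite Q] (hQ : IsGraphPoset Q) :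
    h1 F Q + Nat.card Q = Module.finrank F (LC F Q) + Nat.card (Pairs Q) := by
  rw [hQ.h1_eq, ← finrank_range_dmap (F := F), ← finrank_coker_dmap (F := F)]
  ring

/-! ### Comparison of cohomology groups -/

/-- A linear map of cochains that detects coboundaries does not lower the dimension. -/
lemma h1_le_of_reflects {β : Type} [PartialOrder β] {R : Set β} [Finite R]
    (L : (α → α → F) →ₗ[F] (β → β → F)) (hZ : ∀ φ, IsCocycle Q φ → IsCocycle R (L φ))
    (hB : ∀ φ, IsCocycle Q φ → (IsCoboundary R (L φ) ↔ IsCoboundary Q φ)) : h1 F Q ≤ h1 F R := by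
  let M : Z1 F Q →ₗ[F] Z1 F R := (L.comp (Z1 F Q).subtype).codRestrict _ fun φ => hZ φ.1 φ.2
  have h : (B1 F Q).submoduleOf (Z1 F Q) = ((B1 F R).submoduleOf (Z1 F R)).comap M := by
    ext φ
    exact (hB φ.1 φ.2).symm
  refine LinearMap.finrank_le_finrank_of_injective (f := Submodule.mapQ _ _ M h.le) ?_
  rw [← LinearMap.ker_eq_bot, Submodule.ker_mapQ, ← h, Submodule.mkQ_map_self]

/-- The hypothesis is injectivity of restriction on first cohomology. -/
lemma h1_le_of_restrict [Finite B]
    (hAB : B ⊆ A) (h : ∀ φ : α → α → F, IsCocycle A φ → IsCoboundary B φ → IsCoboundary A φ) :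
    h1 F A ≤ h1 F B :=
  h1_le_of_reflects LinearMap.id (fun _ hφ => hφ.mono hAB)
    fun φ hφ => ⟨h φ hφ, fun h => h.mono hAB⟩

/-- Up-closed subsets. -/
def IsUpClosed (A X : Set α) : Prop := A ⊆ X ∧ ∀ x ∈ A, ∀ y ∈ X, x ≤ y → y ∈ A

/-- The least element of a chain decides in which of the two sets the whole chain lies. -/
lemma IsUpClosed.chainCover (hA : IsUpClosed A (A ∪ B)) (hB : IsUpClosed B (A ∪ B)) :
    ChainCover A B := by
  intro n x hx hxX
  rcases hxX 0 with h | h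
  · exact Or.inl fun i => hA.2 _ h _ (hxX i) (hx (Fin.zero_le i))
  · exact Or.inr fun i => hB.2 _ h _ (hxX i) (hx (Fin.zero_le i))

open Classical in
-- This is extension by zero of a cocycle that vanishes on the intersection. As both sets are
-- up-closed, a pair lies in `A` or in `B` according to its lower element.
lemma isCocycle_piecewise (hA : IsUpClosed A (A ∪ B)) (hB : IsUpClosed B (A ∪ B))
    {φ : α → α → F} (hφ : IsCocycle A φ) (h0 : ∀ x ∈ A ∩ B, ∀ y ∈ A ∩ B, x ≤ y → φ x y = 0) :
    IsCocycle (A ∪ B) fun x y => if x ∈ A then (if x ∈ B then 0 else φ x y) else 0 := by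
  intro x hx y hy z hz hxy hyz
  by_cases hxB : x ∈ B
  · have hyB := hB.2 x hxB y hy hxy
    simp [hxB, hyB]
  · have hxA : x ∈ A := hx.resolve_right hxB
    have hyA := hA.2 x hxA y hy hxy
    have hzA := hA.2 y hyA z hz hyz
    simp only [hxA, hxB, hyA, if_true, if_false]
    rw [hφ x hxA y hyA z hzA hxy hyz]
    split_ifs with hyB
    · rw [h0 y ⟨hyA, hyB⟩ z ⟨hzA, hB.2 y hyB z hz hyz⟩ hyz]
    · rfl

/-- If the first cohomology of `A ∪ B` vanishes, then a cocycle on `A` whose restriction to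
`A ∩ B` is a coboundary is itself a coboundary. -/
lemma isCoboundary_of_inter (hA : IsUpClosed A (A ∪ B)) (hB : IsUpClosed B (A ∪ B))
    (hX : ∀ φ : α → α → F, IsCocycle (A ∪ B) φ → IsCoboundary (A ∪ B) φ)
    {φ : α → α → F} (hφ : IsCocycle A φ) (h : IsCoboundary (A ∩ B) φ) : IsCoboundary A φ := by
  classical
  obtain ⟨f, hf⟩ := h
  -- Subtracting the coboundary of `f` makes the cocycle vanish on the intersection, so that it
  -- extends by zero to the union and has a primitive `u` there.
  let ψ : α → α → F := fun x y => φ x y - (f y - f x)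
  have hψ : IsCocycle A ψ := by
    intro x hx y hy z hz hxy hyz
    simp only [ψ, hφ x hx y hy z hz hxy hyz]
    ring
  have h0 : ∀ x ∈ A ∩ B, ∀ y ∈ A ∩ B, x ≤ y → ψ x y = 0 := fun x hx y hy hxy => by
    simp only [ψ, hf x hx y hy hxy, sub_self]
  obtain ⟨u, hu⟩ := hX _ (isCocycle_piecewise hA hB hψ h0)
  refine ⟨f + u, fun x hx y hy hxy => ?_⟩
  have h1 := hu x (Or.inl hx) y (Or.inl hy) hxy
  have h2 : φ x y - (f y - f x) = u y - u x := by
    rw [← h1]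
    simp only [hx, if_true]
    split_ifs with hxB
    · exact h0 x ⟨hx, hxB⟩ y ⟨hy, hB.2 x hxB y (Or.inl hy) hxy⟩ hxy
    · rfl
  simp only [Pi.add_apply]
  rw [← sub_add_cancel (φ x y) (f y - f x), h2]
  ring

/-- If the first cohomology of `A ∪ B` vanishes, then a locally constant function on `A ∩ B` is
a difference of locally constant functions on `A` and `B`. -/
lemma exists_LC_of_inter (hA : IsUpClosed A (A ∪ B)) (hB : IsUpClosed B (A ∪ B))
    (hX : ∀ φ : α → α → F, IsCocycle (A ∪ B) φ → IsCoboundary (A ∪ B) φ)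
    {f : α → F} (hf : ∀ x ∈ A ∩ B, ∀ y ∈ A ∩ B, x ≤ y → f x = f y) :
    ∃ g h : α → F, (∀ x ∈ A, ∀ y ∈ A, x ≤ y → g x = g y) ∧
      (∀ x ∈ B, ∀ y ∈ B, x ≤ y → h x = h y) ∧ ∀ x ∈ A ∩ B, f x = g x + h x := by
  classical
  -- This is the connecting homomorphism: the coboundary of `f`, taken on `A` only and extended by
  -- zero. A primitive `u` is locally constant on `B`, and `f - u` is locally constant on `A`.
  let ψ : α → α → F := fun x y => f y - f x
  have hψ : IsCocycle A ψ := IsCoboundary.isCocycle ⟨f, fun x _ y _ _ => rfl⟩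
  have h0 : ∀ x ∈ A ∩ B, ∀ y ∈ A ∩ B, x ≤ y → ψ x y = 0 := fun x hx y hy hxy => by
    simp only [ψ, hf x hx y hy hxy, sub_self]
  obtain ⟨u, hu⟩ := hX _ (isCocycle_piecewise hA hB hψ h0)
  refine ⟨f - u, u, fun x hx y hy hxy => ?_, fun x hx y hy hxy => ?_, fun x hx => by simp⟩
  · have h1 := hu x (Or.inl hx) y (Or.inl hy) hxy
    have h2 : f y - f x = u y - u x := by
      rw [← h1]
      simp only [hx, if_true]
      split_ifs with hxB
      · exact h0 x ⟨hx, hxB⟩ y ⟨hy, hB.2 x hxB y (Or.inl hy) hxy⟩ hxy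
      · rfl
    simp only [Pi.sub_apply]
    linear_combination -h2
  · have h1 := hu x (Or.inr hx) y (Or.inr hy) hxy
    simp only [hx, if_true, ite_self] at h1
    linear_combination h1

/-- By `exists_LC_of_inter` the sums of restrictions exhaust the locally constant functions on the
intersection. The extra one comes from the pair `(1, -1)` in the kernel, nonzero because the
intersection is nonempty. -/
lemma finrank_LC_le (hA : IsUpClosed A (A ∪ B)) (hB : IsUpClosed B (A ∪ B)) [Finite A] [Finite B]
    (hX : ∀ φ : α → α → F, IsCocycle (A ∪ B) φ → IsCoboundary (A ∪ B) φ)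
    (hne : (A ∩ B).Nonempty) :
    Module.finrank F (LC F ↑(A ∩ B)) + 1 ≤ Module.finrank F (LC F A) + Module.finrank F (LC F B) := by
  classical
  let L : (LC F A × LC F B) →ₗ[F] LC F ↑(A ∩ B) :=
    { toFun := fun p => ⟨fun x => p.1.1 ⟨x, x.2.1⟩ + p.2.1 ⟨x, x.2.2⟩, mem_LC.2 fun x y hxy => by
        rw [mem_LC.1 p.1.2 ⟨x, x.2.1⟩ ⟨y, y.2.1⟩ hxy, mem_LC.1 p.2.2 ⟨x, x.2.2⟩ ⟨y, y.2.2⟩ hxy]⟩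
      map_add' := fun p q => by
        ext x; simp; ring
      map_smul' := fun c p => by
        ext x; simp; ring }
  have hL : Function.Surjective L := by
    intro f
    obtain ⟨g, h, hg, hh, hgh⟩ := exists_LC_of_inter hA hB hX
      (f := fun x => if hx : x ∈ A ∩ B then f.1 ⟨x, hx⟩ else 0) (fun x hx y hy hxy => by
        simp only [dif_pos hx, dif_pos hy]
        exact mem_LC.1 f.2 ⟨x, hx⟩ ⟨y, hy⟩ hxy)
    refine ⟨(⟨fun x => g x, mem_LC.2 fun x y h => hg _ x.2 _ y.2 h⟩,
      ⟨fun x => h x, mem_LC.2 fun x y h => hh _ x.2 _ y.2 h⟩), ?_⟩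
    ext x
    have := hgh x x.2
    simp only [dif_pos x.2] at this
    exact this.symm
  have h1 := LinearMap.finrank_range_add_finrank_ker L
  rw [LinearMap.range_eq_top.2 hL, finrank_top, Module.finrank_prod] at h1
  rw [← h1]
  have hk : Nontrivial (LinearMap.ker L) := by
    obtain ⟨x, hx⟩ := hne
    refine ⟨⟨⟨(⟨fun _ => 1, mem_LC.2 fun _ _ _ => rfl⟩, ⟨fun _ => -1, mem_LC.2 fun _ _ _ => rfl⟩),
      ?_⟩, 0, ?_⟩⟩
    · rw [LinearMap.mem_ker]
      ext x
      simp [L]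
    · intro h
      have := congr_arg (fun w => w.1.1.1 ⟨x, hx.1⟩) h
      exact one_ne_zero this
  have := Module.finrank_pos (R := F) (M := LinearMap.ker L)
  omega

/-- The first cohomology of a disjoint union. -/
lemma h1_union_of_disjoint (hA : IsUpClosed A (A ∪ B)) (hB : IsUpClosed B (A ∪ B))
    (hd : Disjoint A B) [Finite A] [Finite B] : h1 F (A ∪ B : Set α) = h1 F A + h1 F B := by
  classical
  have hn : ∀ x ∈ A, x ∉ B := fun x hx hx' => Set.disjoint_left.1 hd hx hx'
  let M : Z1 F (A ∪ B) →ₗ[F] H1 F A × H1 F B :=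
    ((Submodule.mkQ _).comp ((Z1 F (A ∪ B)).subtype.codRestrict (Z1 F A)
      fun φ => IsCocycle.mono φ.2 Set.subset_union_left)).prod
    ((Submodule.mkQ _).comp ((Z1 F (A ∪ B)).subtype.codRestrict (Z1 F B)
      fun φ => IsCocycle.mono φ.2 Set.subset_union_right))
  have hker : LinearMap.ker M = (B1 F (A ∪ B)).submoduleOf (Z1 F (A ∪ B)) := by
    ext φ
    rw [LinearMap.mem_ker]
    have h1 : M φ = 0 ↔ IsCoboundary A φ.1 ∧ IsCoboundary B φ.1 := by
      rw [Prod.ext_iff]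
      exact and_congr (Submodule.Quotient.mk_eq_zero _) (Submodule.Quotient.mk_eq_zero _)
    rw [h1]
    change _ ↔ IsCoboundary (A ∪ B) φ.1
    constructor
    · rintro ⟨⟨f, hf⟩, ⟨g, hg⟩⟩
      refine ⟨fun x => if x ∈ A then f x else g x, ?_⟩
      rintro x (hx | hx) y hy hxy
      · have hy' := hA.2 x hx y hy hxy
        simp only [hx, hy', if_true, hf x hx y hy' hxy]
      · have hy' := hB.2 x hx y hy hxy
        have hx2 : x ∉ A := fun h => hn x h hx
        have hy2 : y ∉ A := fun h => hn y h hy'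
        simp only [hx2, hy2, if_false, hg x hx y hy' hxy]
    · exact fun h => ⟨h.mono Set.subset_union_left, h.mono Set.subset_union_right⟩
  have hsurj : Function.Surjective M := by
    rintro ⟨a, b⟩
    obtain ⟨φ, rfl⟩ := Submodule.mkQ_surjective _ a
    obtain ⟨ψ, rfl⟩ := Submodule.mkQ_surjective _ b
    let χ : α → α → F := fun x y => if x ∈ A then φ.1 x y else ψ.1 x y
    have hχA : ∀ x ∈ A, χ x = φ.1 x := fun x hx => by simp only [χ, hx, if_true]
    have hχB : ∀ x ∈ B, χ x = ψ.1 x := fun x hx => by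
      have : x ∉ A := fun h => hn x h hx
      simp only [χ, this, if_false]
    have hχ : IsCocycle (A ∪ B) χ := by
      rintro x (hx | hx) y hy z hz hxy hyz
      · have hy' := hA.2 x hx y hy hxy
        have hz' := hA.2 y hy' z hz hyz
        rw [hχA x hx, hχA y hy']
        exact φ.2 x hx y hy' z hz' hxy hyz
      · have hy' := hB.2 x hx y hy hxy
        have hz' := hB.2 y hy' z hz hyz
        rw [hχB x hx, hχB y hy']
        exact ψ.2 x hx y hy' z hz' hxy hyz
    refine ⟨⟨χ, hχ⟩, Prod.ext ?_ ?_⟩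
    · refine (Submodule.Quotient.eq _).2 ?_
      refine ⟨0, fun x hx y hy hxy => ?_⟩
      change χ x y - φ.1 x y = 0 - 0
      rw [hχA x hx, sub_self, sub_self]
    · refine (Submodule.Quotient.eq _).2 ?_
      refine ⟨0, fun x hx y hy hxy => ?_⟩
      change χ x y - ψ.1 x y = 0 - 0
      rw [hχB x hx, sub_self, sub_self]
  rw [h1, h1, h1, ← Module.finrank_prod]
  exact ((Submodule.quotEquivOfEq _ _ hker.symm).trans
    (M.quotKerEquivOfSurjective hsurj)).finrank_eq

/-- A monotone retraction that lowers elements induces an isomorphism in cohomology. -/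
lemma h1_eq_of_retract {S N : Set α} [Finite N] (hSN : S ⊆ N) (r : α → α) (hr : ∀ x ∈ N, r x ∈ S)
    (hmono : ∀ x ∈ N, ∀ y ∈ N, x ≤ y → r x ≤ r y) (hle : ∀ x ∈ N, r x ≤ x)
    (hid : ∀ x ∈ S, r x = x) : h1 F N = h1 F S := by
  have : Finite S := Finite.Set.subset N hSN
  apply le_antisymm
  -- A primitive `f` on `S` is carried to `N` by adding the value of `φ` on the edge from `r x` to
  -- `x`.
  · refine h1_le_of_restrict hSN fun φ hφ ⟨f, hf⟩ => ⟨fun x => f (r x) + φ (r x) x, ?_⟩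
    intro x hx y hy hxy
    have e1 := hφ (r x) (hSN (hr x hx)) x hx y hy (hle x hx) hxy
    have e2 := hφ (r x) (hSN (hr x hx)) (r y) (hSN (hr y hy)) y hy (hmono x hx y hy hxy) (hle y hy)
    have e3 := hf (r x) (hr x hx) (r y) (hr y hy) (hmono x hx y hy hxy)
    linear_combination e2 - e1 + e3
  · let L : (α → α → F) →ₗ[F] (α → α → F) :=
      { toFun := fun φ x y => φ (r x) (r y), map_add' := fun _ _ => rfl, map_smul' := fun _ _ => rfl }
    refine h1_le_of_reflects L (fun φ hφ x hx y hy z hz hxy hyz =>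
      hφ _ (hr x hx) _ (hr y hy) _ (hr z hz) (hmono x hx y hy hxy) (hmono y hy z hz hyz)) ?_
    intro φ hφ
    constructor
    · rintro ⟨f, hf⟩
      refine ⟨f, fun x hx y hy hxy => ?_⟩
      have := hf x (hSN hx) y (hSN hy) hxy
      change φ (r x) (r y) = _ at this
      rwa [hid x hx, hid y hy] at this
    · rintro ⟨f, hf⟩
      exact ⟨fun x => f (r x), fun x hx y hy hxy =>
        hf _ (hr x hx) _ (hr y hy) (hmono x hx y hy hxy)⟩

end CohomologyTools
end SimplePoly

namespace SimplePoly

/-! ### Connected components and their counting -/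

section Components

variable {α : Type} [PartialOrder α] {Q A B C : Set α}

/-- The type of connected components of `Q`. -/
abbrev Comp (Q : Set α) : Type := Quot fun x y : Q => x ≤ y

/-- The number of connected components of `Q`. -/
noncomputable def h0 (Q : Set α) : ℕ := Nat.card (Comp Q)

/-- The elements of `Q` in a given component. -/
def compSet (c : Comp Q) : Set α := {x | ∃ h : x ∈ Q, Quot.mk _ ⟨x, h⟩ = c}

/-- The component of an element. -/
abbrev comp {x : α} (hx : x ∈ Q) : Comp Q := Quot.mk _ ⟨x, hx⟩

/-- One step of a zigzag inside `Q`. -/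
abbrev Step (Q : Set α) (x y : α) : Prop := y ∈ Q ∧ (x ≤ y ∨ y ≤ x)

lemma comp_eq_of_comparable {x y : α} (hx : x ∈ Q) (hy : y ∈ Q) (h : x ≤ y ∨ y ≤ x) :
    comp hx = comp hy :=
  h.elim (fun h => Quot.sound h) fun h =>
    (Quot.sound (r := fun x y : Q => x ≤ y) (a := ⟨y, hy⟩) (b := ⟨x, hx⟩) h).symm

lemma comp_eq_iff {x y : α} (hx : x ∈ Q) (hy : y ∈ Q) :
    comp hx = comp hy ↔ Relation.ReflTransGen (Step Q) x y := by
  constructor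
  · intro h
    have key : ∀ a b : Q, Relation.EqvGen (fun x y : Q => x ≤ y) a b →
        Relation.ReflTransGen (Step Q) a b ∧ Relation.ReflTransGen (Step Q) b a := by
      intro a b h
      induction h with
      | rel a b h => exact ⟨.single ⟨b.2, Or.inl h⟩, .single ⟨a.2, Or.inr h⟩⟩
      | refl a => exact ⟨.refl, .refl⟩
      | symm a b _ ih => exact ih.symm
      | trans a b c _ _ ih ih' => exact ⟨ih.1.trans ih'.1, ih'.2.trans ih.2⟩
    exact (key _ _ (Quot.eqvGen_exact h)).1
  · intro h
    have key : ∃ hy : y ∈ Q, comp hx = comp hy := by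
      clear hy
      induction h with
      | refl => exact ⟨hx, rfl⟩
      | tail _ h ih =>
        obtain ⟨hb, ih⟩ := ih
        exact ⟨h.1, ih.trans (comp_eq_of_comparable hb h.1 h.2)⟩
    exact key.2

lemma reflTransGen_of_closed (hcl : ∀ a ∈ C, ∀ b ∈ Q, (a ≤ b ∨ b ≤ a) → b ∈ C)
    {x y : α} (hx : x ∈ C) (h : Relation.ReflTransGen (Step Q) x y) :
    y ∈ C ∧ Relation.ReflTransGen (Step C) x y := by
  induction h with
  | refl => exact ⟨hx, .refl⟩
  | tail _ h ih => 
    have := hcl _ ih.1 _ h.1 h.2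
    exact ⟨this, ih.2.tail ⟨this, h.2⟩⟩

lemma compSet_nonempty (c : Comp Q) : (compSet c).Nonempty := by
  obtain ⟨x, rfl⟩ := Quot.exists_rep c
  exact ⟨x, x.2, rfl⟩

lemma compSet_subset (c : Comp Q) : compSet c ⊆ Q := fun _ h => h.1

lemma mem_compSet_comp {x : α} (hx : x ∈ Q) : x ∈ compSet (comp hx) := ⟨hx, rfl⟩

lemma isComponent_compSet (c : Comp Q) : IsComponent (compSet c) Q := by
  have hcl : ∀ a ∈ compSet c, ∀ b ∈ Q, (a ≤ b ∨ b ≤ a) → b ∈ compSet c :=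
    fun a ha b hb h => ⟨hb, (comp_eq_of_comparable ha.1 hb h).symm.trans ha.2⟩
  refine ⟨compSet_subset c, ⟨compSet_nonempty c, fun a ha b hb => ?_⟩, hcl⟩
  exact (reflTransGen_of_closed hcl ha
    ((comp_eq_iff ha.1 hb.1).1 (ha.2.trans hb.2.symm))).2

lemma IsComponent.eq_compSet (hC : IsComponent C Q) {x : α} (hx : x ∈ C) :
    C = compSet (comp (hC.1 hx)) := by
  ext y
  constructor
  · intro hy
    refine ⟨hC.1 hy, ?_⟩
    rw [comp_eq_iff]
    exact Relation.ReflTransGen.mono (fun a b h => ⟨hC.1 h.1, h.2⟩) _ _ (hC.2.1.2 y hy x hx)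
  · rintro ⟨hy, h⟩
    exact (reflTransGen_of_closed hC.2.2 hx ((comp_eq_iff (hC.1 hx) hy).1 h.symm)).1

lemma compSet_injective : Function.Injective (compSet : Comp Q → Set α) := by
  intro c d h
  obtain ⟨x, hx⟩ := compSet_nonempty c
  exact hx.2.symm.trans (h ▸ hx : x ∈ compSet d).2

lemma isComponent_iff : IsComponent C Q ↔ C ∈ Set.range (compSet : Comp Q → Set α) := by
  constructor
  · intro h
    obtain ⟨x, hx⟩ := h.2.1.1
    exact ⟨_, (h.eq_compSet hx).symm⟩
  · rintro ⟨c, rfl⟩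
    exact isComponent_compSet c

lemma ncard_components : {C | IsComponent C Q}.ncard = h0 Q := by
  have : {C | IsComponent C Q} = Set.range (compSet : Comp Q → Set α) :=
    Set.ext fun C => isComponent_iff
  rw [this, ← Set.image_univ, Set.ncard_image_of_injective _ compSet_injective, Set.ncard_univ, h0]

lemma isConnectedSet_iff : IsConnectedSet Q ↔ Q.Nonempty ∧ Subsingleton (Comp Q) := by
  refine and_congr_right fun _ => ⟨fun h => ⟨?_⟩, fun h a ha b hb => ?_⟩
  · rintro ⟨x⟩ ⟨y⟩
    exact (comp_eq_iff x.2 y.2).2 (h x x.2 y y.2)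
  · exact (comp_eq_iff ha hb).1 (Subsingleton.elim _ _)

lemma h0_eq_one_iff : h0 Q = 1 ↔ IsConnectedSet Q := by
  rw [isConnectedSet_iff, h0, Nat.card_eq_one_iff_unique, and_comm]
  refine and_congr_left fun _ => ⟨fun ⟨c⟩ => ?_, fun ⟨x, hx⟩ => ⟨comp hx⟩⟩
  obtain ⟨x, hx⟩ := compSet_nonempty c
  exact ⟨x, hx.1⟩

lemma IsConnectedSet.isComponent (hQ : IsConnectedSet Q) : IsComponent Q Q :=
  ⟨le_rfl, hQ, fun _ _ _ h _ => h⟩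

/-- A locally constant map is constant on a connected set. -/
lemma IsConnectedSet.eq_of_locallyConstant {β : Type} (hQ : IsConnectedSet Q) {f : α → β}
    (hf : ∀ x ∈ Q, ∀ y ∈ Q, x ≤ y → f x = f y) {x y : α} (hx : x ∈ Q) (hy : y ∈ Q) : f x = f y := by
  have : comp hx = comp hy := (isConnectedSet_iff.1 hQ).2.elim _ _
  exact congr_arg (Quot.lift (fun x : Q => f x) fun a b h => hf a a.2 b b.2 h) this

/-- A nonempty subset of a connected set that is closed under comparability is everything. -/
lemma IsConnectedSet.eq_of_closed (hQ : IsConnectedSet Q) (hC : C ⊆ Q) (hne : C.Nonempty)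
    (hcl : ∀ a ∈ C, ∀ b ∈ Q, (a ≤ b ∨ b ≤ a) → b ∈ C) : C = Q := by
  refine hC.antisymm fun y hy => ?_
  obtain ⟨x, hx⟩ := hne
  exact (reflTransGen_of_closed hcl hx (hQ.2 x (hC hx) y hy)).1

/-- Two disjoint sets without comparabilities between them. -/
def IsSeparated (A B : Set α) : Prop := Disjoint A B ∧ ∀ a ∈ A, ∀ b ∈ B, ¬ (a ≤ b ∨ b ≤ a)

lemma IsSeparated.symm (h : IsSeparated A B) : IsSeparated B A :=
  ⟨h.1.symm, fun b hb a ha h' => h.2 a ha b hb h'.symm⟩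

lemma IsSeparated.upClosed_left (h : IsSeparated A B) : IsUpClosed A (A ∪ B) :=
  ⟨Set.subset_union_left, fun x hx y hy hxy => hy.resolve_right fun hy => h.2 x hx y hy (Or.inl hxy)⟩

lemma IsSeparated.upClosed_right (h : IsSeparated A B) : IsUpClosed B (A ∪ B) :=
  ⟨Set.subset_union_right, fun x hx y hy hxy =>
    hy.resolve_left fun hy => h.2 y hy x hx (Or.inr hxy)⟩

lemma IsComponent.isSeparated (hC : IsComponent C Q) : IsSeparated C (Q \ C) :=
  ⟨Set.disjoint_sdiff_right, fun a ha b hb h => hb.2 (hC.2.2 a ha b hb.1 h)⟩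

lemma IsComponent.union_sdiff (hC : IsComponent C Q) : C ∪ Q \ C = Q :=
  Set.union_sdiff_cancel hC.1

lemma IsSeparated.isComponent_union (h : IsSeparated A B) :
    IsComponent C (A ∪ B) ↔ IsComponent C A ∨ IsComponent C B := by
  constructor
  · intro hC
    obtain ⟨x, hx⟩ := hC.2.1.1
    have key : ∀ A B : Set α, IsSeparated A B → IsComponent C (A ∪ B) → x ∈ A →
        IsComponent C A := by
      intro A B h hC hxA
      have hsub : C ⊆ A := by
        have := hC.2.1.eq_of_closed (C := C ∩ A) Set.inter_subset_left ⟨x, hx, hxA⟩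
          fun a ha b hb hab => ⟨hb, (hC.1 hb).resolve_right fun hb => h.2 a ha.2 b hb hab⟩
        rw [← this]
        exact Set.inter_subset_right
      exact ⟨hsub, hC.2.1, fun a ha b hb => hC.2.2 a ha b (Or.inl hb)⟩
    rcases hC.1 hx with hxA | hxB
    · exact Or.inl (key A B h hC hxA)
    · exact Or.inr (key B A h.symm (by rwa [Set.union_comm]) hxB)
  · rintro (hC | hC)
    · exact ⟨hC.1.trans Set.subset_union_left, hC.2.1, fun a ha b hb hab =>
        hC.2.2 a ha b (hb.resolve_right fun hb => h.2 a (hC.1 ha) b hb hab) hab⟩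
    · exact ⟨hC.1.trans Set.subset_union_right, hC.2.1, fun a ha b hb hab =>
        hC.2.2 a ha b (hb.resolve_left fun hb => h.2 b hb a (hC.1 ha) hab.symm) hab⟩

lemma finite_components [Finite Q] : {C | IsComponent C Q}.Finite := by
  have : {C | IsComponent C Q} = Set.range (compSet : Comp Q → Set α) :=
    Set.ext fun C => isComponent_iff
  rw [this]
  have : Finite (Comp Q) := inferInstance
  exact Set.finite_range _

lemma IsSeparated.not_both (h : IsSeparated A B) (hA : IsComponent C A) (hB : IsComponent C B) :
    False := by
  obtain ⟨x, hx⟩ := hA.2.1.1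
  exact Set.disjoint_left.1 h.1 (hA.1 hx) (hB.1 hx)

lemma IsSeparated.ncard_union (h : IsSeparated A B) [Finite A] [Finite B] (p : Set α → Prop) :
    {C | IsComponent C (A ∪ B) ∧ p C}.ncard =
      {C | IsComponent C A ∧ p C}.ncard + {C | IsComponent C B ∧ p C}.ncard := by
  rw [← Set.ncard_union_eq (Set.disjoint_left.2 fun C h1 h2 => h.not_both h1.1 h2.1)
    (finite_components.subset fun _ h => h.1) (finite_components.subset fun _ h => h.1)]
  congr 1
  ext C
  simp only [Set.mem_ofPred_eq, Set.mem_union, h.isComponent_union]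
  tauto

lemma h0_union (h : IsSeparated A B) [Finite A] [Finite B] :
    h0 (A ∪ B) = h0 A + h0 B := by
  have := h.ncard_union fun _ => True
  simpa only [and_true, ncard_components] using this

lemma h0_sdiff [Finite Q] (hC : IsComponent C Q) : h0 Q = h0 (Q \ C) + 1 := by
  have : Finite C := Finite.Set.subset Q hC.1
  have h := h0_union hC.isSeparated
  rw [hC.union_sdiff, h0_eq_one_iff.2 hC.2.1] at h
  omega

lemma finrank_LC (F : Type) [Field F] (Q : Set α) [Finite Q] : Module.finrank F (LC F Q) = h0 Q := by
  have := Fintype.ofFinite (Comp Q)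
  rw [h0, Nat.card_eq_fintype_card, ← Module.finrank_fintype_fun_eq_card F]
  refine LinearEquiv.finrank_eq
    { toFun := fun f c => Quot.lift f.1 (fun x y h => mem_LC.1 f.2 x y h) c
      invFun := fun g => ⟨fun x => g (Quot.mk _ x), mem_LC.2 fun x y h => congr_arg g (Quot.sound h)⟩
      map_add' := fun f g => by
        ext c
        obtain ⟨x, rfl⟩ := Quot.exists_rep c
        rfl
      map_smul' := fun a g => by
        ext c
        obtain ⟨x, rfl⟩ := Quot.exists_rep c
        rfl
      left_inv := fun f => rfl
      right_inv := fun g => by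
        ext c
        obtain ⟨x, rfl⟩ := Quot.exists_rep c
        rfl }

/-- The map of components induced by an inclusion. -/
def compMap (h : A ⊆ B) : Comp A → Comp B := Quot.map (Set.inclusion h) fun _ _ h => h

/-- If every component of `B` meets `A` and `A` has at most as many components as `B`, then every
component of `B` meets `A` in one component of `A`. -/
lemma isComponent_inter [Finite A] (h : A ⊆ B)
    (hm : ∀ C, IsComponent C B → (C ∩ A).Nonempty) (hle : h0 A ≤ h0 B) :
    (∀ C, IsComponent C B → IsComponent (C ∩ A) A) ∧ h0 A = h0 B := by
  have hsurj : Function.Surjective (compMap h) := by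
    intro c
    obtain ⟨x, hx, hxA⟩ := hm _ (isComponent_compSet c)
    exact ⟨comp hxA, hx.2⟩
  have : Finite (Comp B) := Finite.of_surjective _ hsurj
  -- A surjection onto a set that is at least as large as its finite source is a bijection.
  have hbij : Function.Bijective (compMap h) := hsurj.bijective_of_nat_card_le hle
  refine ⟨fun C hC => ?_, Nat.card_eq_of_bijective _ hbij⟩
  obtain ⟨c, rfl⟩ := isComponent_iff.1 hC
  obtain ⟨d, rfl⟩ := hsurj c
  have : compSet (compMap h d) ∩ A = compSet d := by
    ext x
    constructor
    · rintro ⟨hx, hxA⟩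
      exact ⟨hxA, hbij.1 hx.2⟩
    · intro hx
      exact ⟨⟨h hx.1, congr_arg (compMap h) hx.2⟩, hx.1⟩
  rw [this]
  exact isComponent_compSet d

lemma finrank_eq_zero_of_isEmpty (F : Type) [Field F] (Q : Set α) [IsEmpty Q] : h1 F Q = 0 := by
  have h := H1ToCoker_injective (F := F) (Q := Q)
  have : Subsingleton (H1 F Q) := h.subsingleton
  exact Module.finrank_zero_of_subsingleton

/-- If all components have first cohomology of dimension at most one, then this dimension counts
the components with nontrivial cohomology. -/
lemma ncard_components_h1 (F : Type) [Field F] (Q : Set α) (hQ : Q.Finite)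
    (h : ∀ C, IsComponent C Q → h1 F C ≤ 1) :
    {C | IsComponent C Q ∧ h1 F C = 1}.ncard = h1 F Q := by
  induction hn : Q.ncard using Nat.strong_induction_on generalizing Q with
  | _ n ih =>
    rcases Q.eq_empty_or_nonempty with rfl | ⟨x, hx⟩
    · rw [finrank_eq_zero_of_isEmpty]
      convert Set.ncard_empty (Set α) using 2
      refine Set.eq_empty_of_forall_notMem fun C hC => ?_
      obtain ⟨x, hx⟩ := hC.1.2.1.1
      exact hC.1.1 hx
    · set C := compSet (comp hx)
      have hC : IsComponent C Q := isComponent_compSet _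
      have hsep := hC.isSeparated
      have : Finite Q := hQ
      have : Finite C := Finite.Set.subset Q hC.1
      have h2 := ih (Q \ C).ncard (by
        rw [← hn]
        exact Set.ncard_lt_ncard ⟨Set.sdiff_subset, fun h => (h hx).2 (mem_compSet_comp hx)⟩ hQ)
        (Q \ C) (hQ.subset Set.sdiff_subset) (fun D hD => h D (by
          rw [← hC.union_sdiff]
          exact hsep.isComponent_union.2 (Or.inr hD))) rfl
      have h3 := hsep.ncard_union fun C => h1 F C = 1
      have h4 : h1 F (C ∪ Q \ C : Set α) = _ :=
        h1_union_of_disjoint (F := F) hsep.upClosed_left hsep.upClosed_right hsep.1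
      rw [hC.union_sdiff] at h3 h4
      rw [h3, h4, h2]
      congr 1
      have h5 : ∀ D, IsComponent D C ↔ D = C := fun D =>
        ⟨fun hD => hC.2.1.eq_of_closed hD.1 hD.2.1.1 hD.2.2, fun h => h ▸ hC.2.1.isComponent⟩
      have h6 : {D | IsComponent D C ∧ h1 F D = 1} = if h1 F C = 1 then {C} else ∅ := by
        ext D
        split_ifs with h7
        · simp only [Set.mem_ofPred_eq, h5, Set.mem_singleton_iff]
          exact ⟨fun h => h.1, fun h => ⟨h, h ▸ h7⟩⟩
        · simp only [Set.mem_ofPred_eq, h5, Set.mem_empty_iff_false, iff_false]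
          rintro ⟨rfl, h⟩
          exact h7 h
      rw [h6]
      have := h C hC
      split_ifs with h7
      · rw [Set.ncard_singleton, h7]
      · rw [Set.ncard_empty]; omega

end Components
end SimplePoly

namespace SimplePoly

/-! ### Integral homology of graph posets, and freeness -/

section IntegralHomology

open Simplicial

variable {α : Type} [PartialOrder α] {Q : Set α}

open Classical in
/-- The indicator cochain of a pair. -/
noncomputable def pairIndicator (p : Pairs Q) : α → α → ℤ :=
  fun x y => if x = p.1.1 ∧ y = p.1.2 then 1 else 0

lemma IsGraphPoset.isCocycle_pairIndicator (hQ : IsGraphPoset Q) (p : Pairs Q) :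
    IsCocycle Q (pairIndicator p) := by
  have h0 : ∀ x, pairIndicator p x x = 0 := fun x =>
    if_neg fun h => p.2.ne (Subtype.ext (h.1.symm.trans h.2))
  intro x hx y hy z hz hxy hyz
  rcases hxy.eq_or_lt with rfl | h1
  · rw [h0 x, zero_add]
  · rcases hyz.eq_or_lt with rfl | h2
    · rw [h0 y, add_zero]
    · exact absurd h2 (hQ x hx y hy z hz h1)

/-- The degenerate simplex at a point. -/
def degenerateSimplex {x : α} (hx : x ∈ Q) (n : ℕ) : (nerve Q) _⦋n⦌ :=
  simplexMk (fun _ => x) (fun _ _ _ => le_rfl) fun _ => hx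

open Classical in
/-- A homology class of degree one of a one-dimensional order complex is determined by its
coordinates. -/
lemma IsGraphPoset.eq_zero_of_ev (hQ : IsGraphPoset Q) [Finite Q] (x : homologyOf Q 1)
    (hx : ∀ p, evCocycle Q _ (hQ.isCocycle_pairIndicator p) x = 0) : x = 0 := by
  have := Fintype.ofFinite (Pairs Q)
  let K := (nerve Q).chainComplex ZZ
  obtain ⟨z, rfl⟩ := (ModuleCat.epi_iff_surjective (K.homologyπ 1)).1 inferInstance x
  have hz : ∀ p, cochainHom Q (pairIndicator p) (K.iCycles 1 z) = 0 := fun p => by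
    rw [← hx p]
    exact (ConcreteCategory.congr_hom (π_evCocycle _ (hQ.isCocycle_pairIndicator p)) z).symm
  -- A degenerate edge is filled by the constant two-simplex at its point: the three faces all equal
  -- the edge, and their alternating sum is the edge itself. Nondegenerate edges are expanded in
  -- coordinates by `q`. Hence a cycle with zero coordinates is a boundary.
  let s : K.X 1 ⟶ K.X 2 := chainDesc fun e =>
    if simplexVertex e 0 = simplexVertex e 1 then
      (nerve Q).ιChainComplex (degenerateSimplex (simplexVertex_mem e 0) 2) else 0
  let q : K.X 1 ⟶ K.X 1 := ∑ p : Pairs Q, cochainHom Q (pairIndicator p) ≫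
    (nerve Q).ιChainComplex (R := ZZ) (edgeSimplex p.1.1.2 p.1.2.2 p.2.le)
  have hsq : s ≫ K.d 2 1 + q = 𝟙 _ := by
    refine SSet.chainComplex_hom_ext fun e => ?_
    have he := eq_edgeSimplex e
    rw [Preadditive.comp_add, Category.comp_id, ← Category.assoc,
      show (nerve Q).ιChainComplex e ≫ s = _ from ι_chainDesc _ e]
    have hq : (nerve Q).ιChainComplex e ≫ q = ∑ p : Pairs Q, homOfElt (pairIndicator p
        (simplexVertex e 0) (simplexVertex e 1)) ≫
        (nerve Q).ιChainComplex (R := ZZ) (edgeSimplex p.1.1.2 p.1.2.2 p.2.le) := by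
      rw [Preadditive.comp_sum]
      refine Finset.sum_congr rfl fun p _ => ?_
      rw [← Category.assoc, cochainHom, ι_chainDesc]
    rw [hq]
    have hzero : homOfElt (0 : ℤ) = 0 := hom_ZZ_eq _ _ (homOfElt_apply 0)
    have hone : homOfElt (1 : ℤ) = 𝟙 ZZ := hom_ZZ_eq _ _ (homOfElt_apply 1)
    by_cases h : simplexVertex e 0 = simplexVertex e 1
    · rw [if_pos h, Finset.sum_eq_zero, add_zero]
      · have hδ : ∀ i, (nerve Q).δ i (degenerateSimplex (simplexVertex_mem e 0) 2) = e := by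
          intro i
          refine simplex_ext fun j => ?_
          fin_cases j
          · rfl
          · exact h
        rw [SSet.ιChainComplex_d, Fin.sum_univ_three]
        simp only [hδ]
        simp
      · intro p _
        rw [pairIndicator, if_neg, hzero, zero_comp]
        exact fun h' => p.2.ne (Subtype.ext (h'.1.symm.trans (h.trans h'.2)))
    · rw [if_neg h, zero_comp, zero_add]
      have hlt : simplexVertex e 0 < simplexVertex e 1 :=
        lt_of_le_of_ne (simplexVertex_mono e (by decide)) h
      rw [Finset.sum_eq_single (⟨(⟨_, simplexVertex_mem e 0⟩, ⟨_, simplexVertex_mem e 1⟩), hlt⟩ :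
        Pairs Q)]
      · rw [pairIndicator, if_pos ⟨rfl, rfl⟩, hone, Category.id_comp, ← he]
      · intro p _ hp
        rw [pairIndicator, if_neg, hzero, zero_comp]
        exact fun h' => hp (Subtype.ext (Prod.ext (Subtype.ext h'.1.symm) (Subtype.ext h'.2.symm)))
      · exact fun h => absurd (Finset.mem_univ _) h
  have hqz : q (K.iCycles 1 z) = 0 := by
    have : q (K.iCycles 1 z) = ∑ p : Pairs Q, (nerve Q).ιChainComplex (R := ZZ)
        (edgeSimplex p.1.1.2 p.1.2.2 p.2.le) (cochainHom Q (pairIndicator p) (K.iCycles 1 z)) := by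
      simp only [q, ModuleCat.hom_sum, LinearMap.coe_sum, Finset.sum_apply]
      rfl
    rw [this]
    exact Finset.sum_eq_zero fun p _ => by rw [hz p, map_zero]
  have h1 : K.iCycles 1 z = K.iCycles 1 (K.toCycles 2 1 (s (K.iCycles 1 z))) := by
    have h2 := ConcreteCategory.congr_hom hsq (K.iCycles 1 z)
    have h3 : (K.d 2 1) (s (K.iCycles 1 z)) + q (K.iCycles 1 z) = K.iCycles 1 z := h2
    rw [hqz, add_zero] at h3
    refine h3.symm.trans ?_
    exact (ConcreteCategory.congr_hom (K.toCycles_i 2 1) (s (K.iCycles 1 z))).symm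
  rw [(ModuleCat.mono_iff_injective (K.iCycles 1)).1 inferInstance h1]
  exact ConcreteCategory.congr_hom (K.toCycles_comp_homologyπ 2 1) (s (K.iCycles 1 z))

/-- The first homology of a one-dimensional order complex embeds in a free abelian group. -/
lemma IsGraphPoset.exists_embedding (hQ : IsGraphPoset Q) [Finite Q] :
    ∃ f : homologyOf Q 1 →+ (Pairs Q → ℤ), Function.Injective f := by
  refine ⟨{ toFun := fun x p => evCocycle Q _ (hQ.isCocycle_pairIndicator p) x
            map_zero' := funext fun p => map_zero _
            map_add' := fun x y => funext fun p => map_add _ x y }, ?_⟩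
  rw [injective_iff_map_eq_zero]
  exact fun x hx => hQ.eq_zero_of_ev x fun p => congr_fun hx p

/-- A group that embeds in a free abelian group of finite rank is free. -/
lemma exists_linearEquiv_of_embedding {M : Type} [AddCommGroup M] [Module ℤ M] {ι : Type} [Finite ι]
    (f : M →+ (ι → ℤ)) (hf : Function.Injective f) : ∃ r : ℕ, Nonempty (M ≃ₗ[ℤ] (Fin r → ℤ)) := by
  let g : M →ₗ[ℤ] (ι → ℤ) :=
    { toFun := f, map_add' := f.map_add, map_smul' := fun n x => map_intCast_smul f ℤ ℤ n x }
  have hg : Function.Injective g := hf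
  obtain ⟨r, b⟩ := Submodule.basisOfPid (Pi.basisFun ℤ ι) (LinearMap.range g)
  exact ⟨r, ⟨(LinearEquiv.ofInjective g hg).trans b.equivFun⟩⟩

lemma finrank_addHom (F : Type) [Field F] (r : ℕ) :
    Module.finrank F ((Fin r → ℤ) →+ F) = r := by
  let e : ((Fin r → ℤ) →+ F) ≃ₗ[F] (Fin r → F) :=
    { toFun := fun f i => f (Pi.single i 1)
      map_add' := fun _ _ => rfl
      map_smul' := fun _ _ => rfl
      invFun := fun a => 
        { toFun := fun x => ∑ i, (x i : F) * a i
          map_zero' := by simp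
          map_add' := fun x y => by simp [add_mul, Finset.sum_add_distrib] }
      left_inv := fun f => by
        refine AddMonoidHom.ext fun x => ?_
        have h : x = ∑ i, x i • Pi.single i (1 : ℤ) := by
          ext j
          simp [Finset.sum_apply, Pi.single_apply]
        conv_rhs => rw [h, map_sum]
        change ∑ i, (x i : F) * f _ = _
        exact Finset.sum_congr rfl fun i _ => by rw [map_zsmul, zsmul_eq_mul]
      right_inv := fun a => by
        ext i
        simp [Pi.single_apply] }
  rw [e.finrank_eq, Module.finrank_fin_fun]

lemma finrank_addHom_congr (F : Type) [Field F] {M N : Type} [AddCommGroup M] [AddCommGroup N]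
    (e : M ≃+ N) : Module.finrank F (M →+ F) = Module.finrank F (N →+ F) :=
  LinearEquiv.finrank_eq
    { toFun := fun f => f.comp e.symm.toAddMonoidHom
      map_add' := fun _ _ => rfl
      map_smul' := fun _ _ => rfl
      invFun := fun f => f.comp e.toAddMonoidHom
      left_inv := fun f => by ext; simp
      right_inv := fun f => by ext; simp }

/-- The first cohomology of the parts when the first two homology groups of the union vanish. -/
lemma h1_inter (F : Type) [Field F] {A B : Set α} [Finite A] [Finite B] (hcov : ChainCover A B)
    (h1' : IsZero (homologyOf (A ∪ B) 2))
    (h2 : IsZero (homologyOf (A ∪ B) 1)) : h1 F (A ∩ B : Set α) = h1 F A + h1 F B := by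
  obtain ⟨e⟩ := mv_equiv_of_union hcov h1' h2
  rw [h1, h1, h1, (uct _).finrank_eq, finrank_addHom_congr F e, ← Module.finrank_prod]
  refine LinearEquiv.finrank_eq (LinearEquiv.symm ?_)
  exact (((uct A).prodCongr (uct B)).trans
    { toFun := fun p => p.1.coprod p.2
      map_add' := fun p q => by ext; simp; ring
      map_smul' := fun c p => by ext; simp; ring
      invFun := fun f => (f.comp (AddMonoidHom.inl _ _), f.comp (AddMonoidHom.inr _ _))
      left_inv := fun p => by ext <;> simp
      right_inv := fun f => by ext x <;> simp })

/-- A poset whose first homology embeds in a free abelian group of finite rank and is of dimension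
zero or one. -/
lemma isZero_of_h1 (F : Type) [Field F] {ι : Type} [Finite ι]
    (f : homologyOf Q 1 →+ (ι → ℤ)) (hf : Function.Injective f) (h : h1 F Q = 0) :
    IsZero (homologyOf Q 1) := by
  obtain ⟨r, ⟨e⟩⟩ := exists_linearEquiv_of_embedding f hf
  rw [h1, (uct _).finrank_eq, finrank_addHom_congr F e.toAddEquiv, finrank_addHom] at h
  subst h
  exact isZero_iff_subsingleton.2 e.injective.subsingleton

/-- The dimension over a single field need not detect torsion. The embedding excludes torsion, and
then `h1` is the rank. -/
lemma iso_of_h1 (F : Type) [Field F] {ι : Type} [Finite ι]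
    (f : homologyOf Q 1 →+ (ι → ℤ)) (hf : Function.Injective f) (h : h1 F Q = 1) :
    Nonempty (homologyOf Q 1 ≅ ModuleCat.of ℤ ℤ) := by
  obtain ⟨r, ⟨e⟩⟩ := exists_linearEquiv_of_embedding f hf
  rw [h1, (uct _).finrank_eq, finrank_addHom_congr F e.toAddEquiv, finrank_addHom] at h
  subst h
  exact ⟨(e.trans (LinearEquiv.funUnique (Fin 1) ℤ ℤ)).toModuleIso⟩

lemma h1_of_isZero (F : Type) [Field F] (h : IsZero (homologyOf Q 1)) : h1 F Q = 0 := by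
  rw [h1, (uct _).finrank_eq]
  have := isZero_iff_subsingleton.1 h
  exact Module.finrank_zero_of_subsingleton

lemma h1_of_iso (F : Type) [Field F] (h : Nonempty (homologyOf Q 1 ≅ ModuleCat.of ℤ ℤ)) :
    h1 F Q = 1 := by
  obtain ⟨e⟩ := h
  rw [h1, (uct _).finrank_eq, finrank_addHom_congr F (isoAddEquiv e), finrank_addHom_congr F
    (LinearEquiv.funUnique (Fin 1) ℤ ℤ).symm.toAddEquiv, finrank_addHom]

lemma IsGraphPoset.isZero_homology (hQ : IsGraphPoset Q) {k : ℕ} (hk : 2 ≤ k) :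
    IsZero (homologyOf Q k) := by
  have : (nerve Q).HasDimensionLT 2 := nerve_hasDimensionLT 2 fun x hx =>
    hQ _ (x 0).2 _ (x 1).2 _ (x 2).2 (hx (by decide)) (hx (by decide))
  exact SSet.isZero_homology_of_hasDimensionLT _ _ k 2 hk

end IntegralHomology
end SimplePoly

namespace SimplePoly

/-! ### Degrees and flows along paths in a graph -/

section Paths

variable {V : Type} [DecidableEq V] {G : SimpleGraph V}

lemma path_nbr_finite {u v : V} (p : G.Walk u v) (a : V) :
    {b | s(a, b) ∈ p.edges}.Finite :=
  p.support.finite_toSet.subset fun _ hb => p.snd_mem_support_of_mem_edges hb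

/-- The neighbours of a vertex along a path. -/
lemma ncard_path_nbr {u v : V} (p : G.Walk u v) (hp : p.IsPath) (a : V) :
    {b | s(a, b) ∈ p.edges}.ncard + (if a = u then 1 else 0) + (if a = v then 1 else 0) =
      if a ∈ p.support then 2 else 0 := by
  induction p with
  | nil =>
    simp only [SimpleGraph.Walk.edges_nil, List.not_mem_nil, Set.ofPred_false, Set.ncard_empty,
      SimpleGraph.Walk.support_nil, List.mem_singleton]
    split_ifs <;> rfl
  | @cons u w v h p ih =>
    rw [SimpleGraph.Walk.cons_isPath_iff] at hp
    have ih := ih hp.1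
    have hne : u ≠ w := h.ne
    have hv : v ∈ p.support := p.end_mem_support
    have hw : w ∈ p.support := p.start_mem_support
    have huv : u ≠ v := fun h => hp.2 (h ▸ hv)
    by_cases hau : a = u
    · subst hau
      have : {b | s(a, b) ∈ (SimpleGraph.Walk.cons h p).edges} = {w} := by
        ext b
        simp only [SimpleGraph.Walk.edges_cons, List.mem_cons, Set.mem_ofPred_eq,
          Set.mem_singleton_iff]
        constructor
        · rintro (h | h)
          · exact Sym2.congr_right.1 h
          · exact absurd (p.fst_mem_support_of_mem_edges h) hp.2
        · rintro rfl
          exact Or.inl rfl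
      rw [this, Set.ncard_singleton]
      simp [huv]
    · have hsupp : a ∈ (SimpleGraph.Walk.cons h p).support ↔ a ∈ p.support := by
        simp [hau]
      simp only [hsupp, ← ih, hau, if_false, add_zero]
      congr 1
      by_cases haw : a = w
      · subst haw
        have : {b | s(a, b) ∈ (SimpleGraph.Walk.cons h p).edges} =
            insert u {b | s(a, b) ∈ p.edges} := by
          ext b
          simp only [SimpleGraph.Walk.edges_cons, List.mem_cons, Set.mem_ofPred_eq,
            Set.mem_insert_iff]
          refine or_congr_left ?_
          rw [Sym2.eq_swap, Sym2.congr_left]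
        have hu : u ∉ {b | s(a, b) ∈ p.edges} := fun h => hp.2 (p.snd_mem_support_of_mem_edges h)
        rw [this, Set.ncard_insert_of_notMem hu (path_nbr_finite p a), if_pos rfl]
      · rw [if_neg haw, add_zero]
        congr 1
        ext b
        simp only [SimpleGraph.Walk.edges_cons, List.mem_cons, Set.mem_ofPred_eq,
          or_iff_right_iff_imp]
        intro h
        rcases Sym2.eq_iff.1 h with h | h
        · exact absurd h.1 hau
        · exact absurd h.1 haw

/-- The unit flow along a walk. -/
def walkFlow : ∀ {u v : V}, G.Walk u v → V → V → ℤ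
  | _, _, .nil, _, _ => 0
  | _, _, .cons (u := u) (v := w) _ p, x, y =>
    (if x = u ∧ y = w then 1 else 0) - (if x = w ∧ y = u then 1 else 0) + walkFlow p x y

lemma walkFlow_antisymm {u v : V} (p : G.Walk u v) (x y : V) :
    walkFlow p x y = - walkFlow p y x := by
  induction p with
  | nil => rfl
  | @cons u w v h p ih =>
    have e : ∀ a b : V, (if x = a ∧ y = b then (1 : ℤ) else 0) = if y = b ∧ x = a then 1 else 0 :=
      fun a b => by simp only [and_comm]
    rw [walkFlow, walkFlow, ih, e u w, e w u]
    ring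

lemma walkFlow_eq_zero {u v : V} (p : G.Walk u v) {x y : V} (h : s(x, y) ∉ p.edges) :
    walkFlow p x y = 0 := by
  induction p with
  | nil => rfl
  | cons h p ih =>
    rw [SimpleGraph.Walk.edges_cons, List.mem_cons, not_or, Sym2.eq_iff, not_or] at h
    rw [walkFlow, ih h.2, if_neg h.1.1, if_neg h.1.2]
    rfl

/-- Kirchhoff's law: the net flow out of `x` telescopes along the walk, leaving only the two ends.
-/
lemma sum_walkFlow {u v : V} (p : G.Walk u v) (B : Finset V) (hB : ∀ x ∈ p.support, x ∈ B) (x : V) :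
    ∑ y ∈ B, walkFlow p x y = (if x = u then 1 else 0) - (if x = v then 1 else 0) := by
  induction p with
  | nil => simp [walkFlow]
  | @cons u w v h p ih =>
    have hw : w ∈ B := hB w (by simp)
    have hu : u ∈ B := hB u (by simp)
    simp only [walkFlow, Finset.sum_add_distrib, Finset.sum_sub_distrib]
    rw [ih fun x hx => hB x (by simp [hx])]
    have h1 : ∀ a b : V, b ∈ B →
        (∑ y ∈ B, if x = a ∧ y = b then (1 : ℤ) else 0) = if x = a then 1 else 0 := by
      intro a b hb
      by_cases hx : x = a <;> simp [hx, hb]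
    rw [h1 u w hw, h1 w u hu]
    ring

lemma walkFlow_start {u v : V} (p : G.Walk u v) (hp : p.IsPath) {y : V} (h : s(u, y) ∈ p.edges) :
    walkFlow p u y = 1 := by
  cases p with
  | nil => simp at h
  | @cons _ w _ hadj p =>
    rw [SimpleGraph.Walk.cons_isPath_iff] at hp
    have h1 : s(u, y) ∉ p.edges := fun h => hp.2 (p.fst_mem_support_of_mem_edges h)
    rw [SimpleGraph.Walk.edges_cons, List.mem_cons] at h
    have h2 := Sym2.congr_right.1 (h.resolve_right h1)
    subst h2
    rw [walkFlow, walkFlow_eq_zero p h1, if_pos ⟨rfl, rfl⟩, if_neg fun h => hadj.ne h.1]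
    rfl

lemma walkFlow_end {u v : V} (p : G.Walk u v) (hp : p.IsPath) {y : V} (h : s(v, y) ∈ p.edges) :
    walkFlow p v y = -1 := by
  rw [walkFlow_antisymm]
  congr 1
  induction p with
  | nil => simp at h
  | @cons u w v hadj p ih =>
    rw [SimpleGraph.Walk.cons_isPath_iff] at hp
    rw [SimpleGraph.Walk.edges_cons, List.mem_cons] at h
    have huv : v ≠ u := fun h => hp.2 (h ▸ p.end_mem_support)
    rcases h with h | h
    · rcases Sym2.eq_iff.1 h with h | h
      · exact absurd h.1 huv
      · obtain ⟨rfl, rfl⟩ := h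
        have hnil : p = .nil := (SimpleGraph.Walk.isPath_iff_nil.1 hp.1).eq_nil
        subst hnil
        rw [walkFlow, if_pos ⟨rfl, rfl⟩, if_neg fun h => huv h.2]
        rfl
    · have h3 : y ≠ u := fun hy => hp.2 (hy ▸ p.snd_mem_support_of_mem_edges h)
      rw [walkFlow, ih hp.1 h, if_neg fun h => h3 h.1, if_neg fun h => huv h.2]
      rfl

end Paths

/-! ### Degrees in subdivided graphs and the flow on a theta graph -/

section Subdivision

variable {V : Type} [DecidableEq V] {L : PreAbstractSimplicialComplex V} {H : ModelGraph}

instance : Fintype circleGraph.E := inferInstanceAs (Fintype (Fin 2))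
instance : DecidableEq circleGraph.W := inferInstanceAs (DecidableEq (Fin 2))
instance : Fintype thetaGraph.E := inferInstanceAs (Fintype (Fin 3))
instance : DecidableEq thetaGraph.W := inferInstanceAs (DecidableEq (Fin 2))
instance : Fintype completeGraph4.E :=
  inferInstanceAs (Fintype {p : Fin 4 × Fin 4 // p.1 < p.2})
instance : DecidableEq completeGraph4.W := inferInstanceAs (DecidableEq (Fin 4))
instance : Fintype arcGraph.E := inferInstanceAs (Fintype (Fin 1))
instance : DecidableEq arcGraph.W := inferInstanceAs (DecidableEq (Fin 2))
instance : Fintype tripodGraph.E := inferInstanceAs (Fintype (Fin 3))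
instance : DecidableEq tripodGraph.W := inferInstanceAs (DecidableEq (Fin 4))

/-- The number of neighbours of a vertex of a complex. -/
noncomputable def linkDeg (L : PreAbstractSimplicialComplex V) (a : V) : ℕ :=
  {b | (edgeGraph L).Adj a b}.ncard

/-- The number of edge ends at a branch vertex. -/
def ModelGraph.deg (H : ModelGraph) [Fintype H.E] [DecidableEq H.W] (w : H.W) : ℕ :=
  ∑ e, ((if w = H.fst e then 1 else 0) + if w = H.snd e then 1 else 0)

lemma linkDeg_eq_sum [Fintype H.E] {φ : H.W → V}
    (P : ∀ e : H.E, (edgeGraph L).Walk (φ (H.fst e)) (φ (H.snd e)))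
    (hE : ∀ s ∈ (edgeGraph L).edgeSet, ∃! e, s ∈ (P e).edges) (a : V) :
    linkDeg L a = ∑ e, {b | s(a, b) ∈ (P e).edges}.ncard := by
  have := fun e => (path_nbr_finite (P e) a).to_subtype
  simp only [linkDeg, ← Nat.card_coe_set_eq]
  rw [← Nat.card_sigma]
  refine (Nat.card_congr (Equiv.ofBijective (fun x => ⟨x.2.1, (P x.1).adj_of_mem_edges x.2.2⟩)
    ⟨?_, ?_⟩)).symm
  · rintro ⟨e, b, hb⟩ ⟨f, c, hc⟩ h
    obtain rfl : b = c := congr_arg Subtype.val h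
    obtain rfl : e = f := (hE _ ((P e).adj_of_mem_edges hb)).unique hb hc
    rfl
  · rintro ⟨b, hb⟩
    obtain ⟨e, he, -⟩ := hE s(a, b) hb
    exact ⟨⟨e, b, he⟩, rfl⟩

/-- The degrees of the vertices of a subdivision: those of the branch vertices are the degrees in
the model, and all others are two. -/
lemma degrees_of_paths [Fintype H.E] [DecidableEq H.W] (hloop : ∀ e, H.fst e ≠ H.snd e)
    {φ : H.W → V} (P : ∀ e : H.E, (edgeGraph L).Walk (φ (H.fst e)) (φ (H.snd e)))
    (hφ : Function.Injective φ) (hP : ∀ e, (P e).IsPath)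
    (hw : ∀ e w, φ w ∈ (P e).support → w = H.fst e ∨ w = H.snd e)
    (hd : ∀ e f x, e ≠ f → x ∈ (P e).support → x ∈ (P f).support → x ∈ Set.range φ)
    (hV : ∀ x, {x} ∈ L.faces → ∃ e, x ∈ (P e).support)
    (hE : ∀ s ∈ (edgeGraph L).edgeSet, ∃! e, s ∈ (P e).edges) :
    (∀ w, linkDeg L (φ w) = H.deg w) ∧
      ∀ a, {a} ∈ L.faces → a ∉ Set.range φ → linkDeg L a = 2 := by
  have hdeg := linkDeg_eq_sum P hE
  refine ⟨fun w => ?_, fun a ha hna => ?_⟩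
  · rw [hdeg, ModelGraph.deg]
    refine Finset.sum_congr rfl fun e _ => ?_
    have h1 := ncard_path_nbr (P e) (hP e) (φ w)
    simp only [hφ.eq_iff] at h1
    have h2 : φ w ∈ (P e).support ↔ w = H.fst e ∨ w = H.snd e := by
      refine ⟨hw e w, ?_⟩
      rintro (rfl | rfl)
      · exact (P e).start_mem_support
      · exact (P e).end_mem_support
    have h3 := hloop e
    by_cases h4 : w = H.fst e
    · have h5 : w ≠ H.snd e := fun h => h3 (h4.symm.trans h)
      rw [if_pos h4, if_neg h5, if_pos (h2.2 (Or.inl h4))] at h1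
      rw [if_pos h4, if_neg h5]
      omega
    · by_cases h5 : w = H.snd e
      · rw [if_neg h4, if_pos h5, if_pos (h2.2 (Or.inr h5))] at h1
        rw [if_neg h4, if_pos h5]
        omega
      · simp only [h2, h4, h5, or_false, if_false] at h1 ⊢
        omega
  · rw [hdeg]
    obtain ⟨e, he⟩ := hV a ha
    have hne : ∀ w, a ≠ φ w := fun w h => hna ⟨w, h.symm⟩
    rw [Finset.sum_eq_single e]
    · have h1 := ncard_path_nbr (P e) (hP e) a
      rwa [if_neg (hne _), if_neg (hne _), if_pos he] at h1
    · intro f _ hf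
      have h1 := ncard_path_nbr (P f) (hP f) a
      rwa [if_neg (hne _), if_neg (hne _), if_neg fun h => hna (hd f e a hf h he)] at h1
    · exact fun h => absurd (Finset.mem_univ _) h

lemma IsSubdivisionOf.degrees [Fintype H.E] [DecidableEq H.W] (h : IsSubdivisionOf L H)
    (hloop : ∀ e, H.fst e ≠ H.snd e) :
    ∃ φ : H.W → V, Function.Injective φ ∧ (∀ w, linkDeg L (φ w) = H.deg w) ∧
      ∀ a, {a} ∈ L.faces → a ∉ Set.range φ → linkDeg L a = 2 := by
  obtain ⟨-, φ, P, hφ, hP, hw, hd, hV, hE⟩ := h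
  exact ⟨φ, hφ, degrees_of_paths hloop P hφ hP hw hd hV hE⟩

/-- The flow from one branch vertex of a theta graph to the other. -/
lemma exists_theta_flow (h : IsSubdivisionOf L thetaGraph) :
    ∃ (x₀ x₁ : V) (f : V → V → ℤ), x₀ ≠ x₁ ∧ linkDeg L x₀ = 3 ∧ linkDeg L x₁ = 3 ∧
      (∀ a, {a} ∈ L.faces → a ≠ x₀ → a ≠ x₁ → linkDeg L a = 2) ∧
      (∀ x y, f x y = - f y x) ∧ (∀ y, (edgeGraph L).Adj x₀ y → f x₀ y = 1) ∧
      (∀ y, (edgeGraph L).Adj x₁ y → f x₁ y = -1) ∧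
      (∀ x y, ¬ (edgeGraph L).Adj x y → f x y = 0) ∧
      ∀ x, x ≠ x₀ → x ≠ x₁ → ∀ B : Finset V, (∀ y, (edgeGraph L).Adj x y → y ∈ B) →
        ∑ y ∈ B, f x y = 0 := by
  have hdeg : ∀ e : thetaGraph.E, thetaGraph.fst e ≠ thetaGraph.snd e :=
    fun _ => (by decide : (0 : Fin 2) ≠ 1)
  obtain ⟨-, φ, P, hφ, hP, hw, hd, hV, hE⟩ := h
  obtain ⟨h1, h2⟩ := degrees_of_paths hdeg P hφ hP hw hd hV hE
  let w₀ : thetaGraph.W := (0 : Fin 2)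
  let w₁ : thetaGraph.W := (1 : Fin 2)
  have hrange : ∀ a, a ≠ φ w₀ → a ≠ φ w₁ → a ∉ Set.range φ := by
    rintro a h0 h1 ⟨w, rfl⟩
    rcases (show ∀ w : Fin 2, w = 0 ∨ w = 1 by decide) w with h | h
    · exact h0 (congr_arg φ h)
    · exact h1 (congr_arg φ h)
  have hflow : ∀ x y, (edgeGraph L).Adj x y → ∃ e, s(x, y) ∈ (P e).edges ∧
      ∑ e, walkFlow (P e) x y = walkFlow (P e) x y := by
    intro x y hxy
    obtain ⟨e, he, he'⟩ := hE s(x, y) hxy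
    refine ⟨e, he, Finset.sum_eq_single e (fun f _ hf => walkFlow_eq_zero _ fun h => hf (he' f h))
      fun h => absurd (Finset.mem_univ _) h⟩
  have hzero : ∀ x y, ¬ (edgeGraph L).Adj x y → ∑ e, walkFlow (P e) x y = 0 := fun x y h =>
    Finset.sum_eq_zero fun e _ => walkFlow_eq_zero _ fun h' => h ((P e).adj_of_mem_edges h')
  -- The three paths each carry a unit flow from one branch vertex to the other. Every edge lies on
  -- only one path, so the values at the branch vertices are `1` and `-1`.
  refine ⟨φ w₀, φ w₁, fun x y => ∑ e, walkFlow (P e) x y, fun h => ?_, h1 _, h1 _,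
    fun a ha h0 h1 => h2 a ha (hrange a h0 h1), fun x y => ?_, fun y hy => ?_, fun y hy => ?_, hzero,
    fun x hx0 hx1 B hB => ?_⟩
  · exact absurd (hφ h) (by decide : (0 : Fin 2) ≠ 1)
  · rw [← Finset.sum_neg_distrib]
    exact Finset.sum_congr rfl fun e _ => walkFlow_antisymm _ _ _
  · obtain ⟨e, he, h⟩ := hflow _ y hy
    exact h.trans (walkFlow_start (P e) (hP e) he)
  · obtain ⟨e, he, h⟩ := hflow _ y hy
    exact h.trans (walkFlow_end (P e) (hP e) he)
  -- The set `B` is enlarged to contain the supports of all paths, as `sum_walkFlow` requires; the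
  -- added terms are zero.
  · have h3 : ∑ y ∈ B, ∑ e, walkFlow (P e) x y =
        ∑ y ∈ B ∪ Finset.univ.biUnion (fun e => (P e).support.toFinset),
          ∑ e, walkFlow (P e) x y :=
      Finset.sum_subset Finset.subset_union_left fun y _ hy => hzero x y fun h => hy (hB y h)
    rw [h3, Finset.sum_comm]
    refine Finset.sum_eq_zero fun e _ => ?_
    rw [sum_walkFlow]
    · exact (congr_arg₂ (· - ·) (if_neg hx0) (if_neg hx1)).trans (sub_zero 0)
    · intro y hy
      exact Finset.mem_union_right _ (Finset.mem_biUnion.2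
        ⟨e, Finset.mem_univ _, List.mem_toFinset.2 hy⟩)

end Subdivision
end SimplePoly

namespace SimplePoly

/-! ### Posets with two neighbours at every element: unions of circles -/

section Regular

variable {α : Type} [PartialOrder α] {Q : Set α}

/-- The elements of `Q` comparable with `x` and different from `x`. -/
def nbrs (Q : Set α) (x : α) : Set α := {y ∈ Q | x < y ∨ y < x}

/-- Every element is comparable with exactly two others. -/
def IsRegularPoset (Q : Set α) : Prop := IsGraphPoset Q ∧ ∀ x ∈ Q, (nbrs Q x).ncard = 2

/-- The handshake lemma: each comparable pair is counted once at either end. -/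
lemma sum_ncard_nbrs [Finite Q] [Fintype Q] :
    ∑ x : Q, (nbrs Q x).ncard = Nat.card (Pairs Q) + Nat.card (Pairs Q) := by
  have := fun x => (Set.Finite.subset (Set.toFinite Q) fun y hy => hy.1 : (nbrs Q x).Finite).to_subtype
  simp only [← Nat.card_coe_set_eq]
  rw [← Nat.card_sigma, ← Nat.card_sum]
  refine (Nat.card_congr (Equiv.ofBijective (fun p : Pairs Q ⊕ Pairs Q =>
    (p.elim (fun p => ⟨p.1.1, p.1.2, p.1.2.2, Or.inl p.2⟩)
      (fun p => ⟨p.1.2, p.1.1, p.1.1.2, Or.inr p.2⟩) : Σ x : Q, nbrs Q x)) ⟨?_, ?_⟩)).symm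
  · rintro (⟨⟨⟨a, ha⟩, ⟨b, hb⟩⟩, h⟩ | ⟨⟨⟨a, ha⟩, ⟨b, hb⟩⟩, h⟩)
      (⟨⟨⟨c, hc⟩, ⟨d, hd⟩⟩, h'⟩ | ⟨⟨⟨c, hc⟩, ⟨d, hd⟩⟩, h'⟩) heq <;>
    have h1 := congr_arg (fun z : Σ x : Q, nbrs Q x => (z.1.1, z.2.1)) heq <;>
    obtain ⟨rfl, rfl⟩ := Prod.ext_iff.1 h1
    · rfl
    · exact absurd h h'.not_gt
    · exact absurd h h'.not_gt
    · rfl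
  · rintro ⟨x, y, hy, h | h⟩
    · exact ⟨Sum.inl ⟨(x, ⟨y, hy⟩), h⟩, rfl⟩
    · exact ⟨Sum.inr ⟨(⟨y, hy⟩, x), h⟩, rfl⟩

/-- The number of comparable pairs when all degrees are two, except for degrees four on `W`. -/
lemma card_pairs [Finite Q] {W : Set α} (hW : W ⊆ Q) (h4 : ∀ x ∈ W, (nbrs Q x).ncard = 4)
    (h2 : ∀ x ∈ Q, x ∉ W → (nbrs Q x).ncard = 2) :
    Nat.card (Pairs Q) = Nat.card Q + W.ncard := by
  classical
  have := Fintype.ofFinite Q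
  have h := sum_ncard_nbrs (Q := Q)
  have h3 : ∑ x : Q, (nbrs Q x).ncard = ∑ x : Q, (2 + if (x : α) ∈ W then 2 else 0) := by
    refine Finset.sum_congr rfl fun x _ => ?_
    split_ifs with hx
    · exact h4 x hx
    · exact h2 x x.2 hx
  rw [h3, Finset.sum_add_distrib, ← Finset.sum_filter, Finset.sum_const, Finset.sum_const,
    smul_eq_mul, smul_eq_mul, Finset.card_univ, ← Nat.card_eq_fintype_card] at h
  have h5 : (Finset.univ.filter fun x : Q => (x : α) ∈ W).card = W.ncard := by
    have : (((Finset.univ.filter fun x : Q => (x : α) ∈ W).map (Function.Embedding.subtype _) :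
        Finset α) : Set α) = W := by
      ext x
      simp only [Finset.coe_map, Finset.coe_filter, Finset.mem_univ, true_and, Set.mem_image]
      exact ⟨by rintro ⟨y, hy, rfl⟩; exact hy, fun hx => ⟨⟨x, hW hx⟩, hx, rfl⟩⟩
    conv_rhs => rw [← this]
    rw [Set.ncard_coe_finset, Finset.card_map]
  omega

/-- By Euler's formula `h1 - h0` is the number of pairs minus the number of elements, which
`card_pairs` evaluates. -/
lemma IsGraphPoset.h1_eq_add (F : Type) [Field F] [Finite Q] (hQ : IsGraphPoset Q) {W : Set α}
    (hW : W ⊆ Q) (h4 : ∀ x ∈ W, (nbrs Q x).ncard = 4)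
    (h2 : ∀ x ∈ Q, x ∉ W → (nbrs Q x).ncard = 2) : h1 F Q = h0 Q + W.ncard := by
  have h := hQ.euler (F := F)
  rw [card_pairs hW h4 h2, finrank_LC] at h
  omega

lemma IsRegularPoset.h1_eq (F : Type) [Field F] [Finite Q] (hQ : IsRegularPoset Q) :
    h1 F Q = h0 Q := by
  have := hQ.1.h1_eq_add F (W := ∅) (Set.empty_subset _) (fun _ h => h.elim) fun x hx _ => hQ.2 x hx
  rwa [Set.ncard_empty, add_zero] at this

lemma IsRegularPoset.component (hQ : IsRegularPoset Q) {C : Set α} (hC : IsComponent C Q) :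
    IsRegularPoset C := by
  refine ⟨fun x hx y hy z hz => hQ.1 x (hC.1 hx) y (hC.1 hy) z (hC.1 hz), fun x hx => ?_⟩
  rw [← hQ.2 x (hC.1 hx)]
  congr 1
  ext y
  exact ⟨fun h => ⟨hC.1 h.1, h.2⟩, fun h => ⟨hC.2.2 x hx y h.1 (h.2.imp le_of_lt le_of_lt), h.2⟩⟩

variable [DecidableEq α]

lemma edgeGraph_orderComplex_adj {x y : α} :
    (edgeGraph (orderComplex Q)).Adj x y ↔ x ∈ Q ∧ y ∈ nbrs Q x := by
  constructor
  · rintro ⟨hne, -, h1, h2⟩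
    refine ⟨h1 x (by simp), h1 y (by simp), ?_⟩
    exact (h2 x (by simp) y (by simp)).imp (lt_of_le_of_ne · hne) (lt_of_le_of_ne · hne.symm)
  · rintro ⟨hx, hy, h⟩
    have hle : x ≤ y ∨ y ≤ x := h.imp le_of_lt le_of_lt
    refine ⟨by rintro rfl; exact h.elim (lt_irrefl _) (lt_irrefl _), by simp, ?_, ?_⟩
    · simp [hx, hy]
    · intro a ha b hb
      simp only [Finset.mem_insert, Finset.mem_singleton] at ha hb
      rcases ha with rfl | rfl <;> rcases hb with rfl | rfl
      exacts [Or.inl le_rfl, hle, hle.symm, Or.inl le_rfl]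

/-- A connected regular poset is a circle. -/
theorem IsRegularPoset.isSubdivisionOf_circle [Finite Q] (hQ : IsRegularPoset Q)
    (hc : IsConnectedSet Q) : IsSubdivisionOf (orderComplex Q) circleGraph := by
  set G := edgeGraph (orderComplex Q) with hG
  have hadj : ∀ {x y}, G.Adj x y ↔ x ∈ Q ∧ y ∈ nbrs Q x := edgeGraph_orderComplex_adj
  obtain ⟨u, hu⟩ := hc.1
  obtain ⟨v, hv⟩ : (nbrs Q u).Nonempty := by
    rw [← Set.ncard_pos (Set.finite_of_ncard_ne_zero (by rw [hQ.2 u hu]; decide)), hQ.2 u hu]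
    decide
  have huv : G.Adj u v := hadj.2 ⟨hu, hv⟩
  -- In a two-regular finite graph every edge lies on a cycle, so its ends stay joined once it is
  -- deleted. The resulting path and the edge itself become the two edges of `circleGraph`.
  have hreach : (G.deleteEdges {s(u, v)}).Reachable u v := by
    let G' : SimpleGraph Q := G.comap Subtype.val
    have hcyc : G'.IsCycles := by
      intro x _
      rw [← hQ.2 x x.2, ← Set.ncard_image_of_injective _ Subtype.val_injective]
      congr 1
      ext y
      constructor
      · rintro ⟨y, hy, rfl⟩
        exact (hadj.1 hy).2
      · exact fun hy => ⟨⟨y, hy.1⟩, hadj.2 ⟨x.2, hy⟩, rfl⟩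
    have h1 := hcyc.reachable_deleteEdges (v := ⟨u, hu⟩) (w := ⟨v, hv.1⟩) huv
    let f : G'.deleteEdges {s(⟨u, hu⟩, ⟨v, hv.1⟩)} →g G.deleteEdges {s(u, v)} :=
      ⟨Subtype.val, fun {x y} h => by
        rw [SimpleGraph.deleteEdges_adj] at h ⊢
        refine ⟨h.1, fun h' => h.2 ?_⟩
        exact Sym2.map.injective Subtype.val_injective h'⟩
    exact h1.map f
  obtain ⟨p', hp'⟩ := hreach.exists_isPath
  let p : G.Walk u v := p'.mapLe (G.deleteEdges_le _)
  have hp : p.IsPath := hp'.mapLe _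
  have hpe : s(u, v) ∉ p.edges := by
    intro h
    rw [SimpleGraph.Walk.edges_mapLe_eq_edges] at h
    have := p'.adj_of_mem_edges h
    rw [SimpleGraph.deleteEdges_adj] at this
    exact this.2 rfl
  let q : G.Walk u v := huv.toWalk
  have hq : q.IsPath := SimpleGraph.Walk.IsPath.of_adj huv
  have hqe : ∀ s, s ∈ q.edges ↔ s = s(u, v) := fun s => by
    simp [q]
  have hqs : ∀ s, s ∈ q.support ↔ s = u ∨ s = v := fun s => by
    simp [q]
  have hpQ : ∀ a ∈ p.support, a ∈ Q := by
    intro a ha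
    by_cases hau : a = u
    · exact hau ▸ hu
    · have h1 := ncard_path_nbr p hp a
      rw [if_neg hau, if_pos ha] at h1
      obtain ⟨b, hb⟩ : {b | s(a, b) ∈ p.edges}.Nonempty := by
        rw [← Set.ncard_pos (path_nbr_finite p a)]
        split_ifs at h1 <;> omega
      exact (hadj.1 (p.adj_of_mem_edges hb)).1
  -- The path and the edge together already give each vertex of `p` two neighbours, hence all of
  -- them. So the support of `p` is closed under comparability and, by connectedness, is everything.
  have hdeg : ∀ a ∈ p.support, ∀ b, G.Adj a b → s(a, b) ∈ p.edges ∨ s(a, b) ∈ q.edges := by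
    intro a ha
    have h1 := ncard_path_nbr p hp a
    have h2 := ncard_path_nbr q hq a
    simp only [hqs] at h2
    have hd : Disjoint {b | s(a, b) ∈ p.edges} {b | s(a, b) ∈ q.edges} :=
      Set.disjoint_left.2 fun b hb hb' => hpe ((hqe _).1 hb' ▸ hb)
    have h3 := Set.ncard_union_eq hd (path_nbr_finite p a) (path_nbr_finite q a)
    have h4 : {b | s(a, b) ∈ p.edges} ∪ {b | s(a, b) ∈ q.edges} ⊆ nbrs Q a := by
      rintro b (hb | hb)
      · exact (hadj.1 (p.adj_of_mem_edges hb)).2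
      · exact (hadj.1 (q.adj_of_mem_edges hb)).2
    have h5 : (nbrs Q a).Finite := (Set.toFinite Q).subset fun y hy => hy.1
    have h6 := Set.eq_of_subset_of_ncard_le h4 (by
      rw [h3, hQ.2 a (hpQ a ha)]
      have huv' : u ≠ v := huv.ne
      rw [if_pos ha] at h1
      by_cases hau : a = u
      · have hav : a ≠ v := hau ▸ huv'
        rw [if_pos hau, if_neg hav] at h1 h2
        rw [if_pos (Or.inl hau)] at h2
        omega
      · by_cases hav : a = v
        · rw [if_neg hau, if_pos hav] at h1 h2
          rw [if_pos (Or.inr hav)] at h2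
          omega
        · rw [if_neg hau, if_neg hav] at h1
          omega) h5
    intro b hb
    have h7 : b ∈ nbrs Q a := (hadj.1 hb).2
    rw [← h6] at h7
    exact h7
  have hall : ∀ a ∈ Q, a ∈ p.support := by
    have := hc.eq_of_closed (C := {a | a ∈ p.support}) hpQ ⟨u, p.start_mem_support⟩
      fun a ha b hb hab => ?_
    · exact fun a ha => (this ▸ ha : a ∈ {a | a ∈ p.support})
    · by_cases hne : a = b
      · exact hne ▸ ha
      rcases hdeg a ha b (hadj.2 ⟨hpQ a ha, hb, hab.imp (lt_of_le_of_ne · hne)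
        (lt_of_le_of_ne · (Ne.symm hne))⟩) with h | h
      · exact p.snd_mem_support_of_mem_edges h
      · rcases (hqs b).1 (q.snd_mem_support_of_mem_edges h) with rfl | rfl
        · exact p.start_mem_support
        · exact p.end_mem_support
  have hcard : ∀ τ ∈ (orderComplex Q).faces, τ.card ≤ 2 := by
    intro τ hτ
    by_contra hcon
    obtain ⟨a, ha, b, hb, c, hc, hab, hac, hbc⟩ := Finset.two_lt_card.1 (not_le.1 hcon)
    have hcmp : ∀ x ∈ τ, ∀ y ∈ τ, x ≠ y → x < y ∨ y < x := fun x hx y hy hne =>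
      (hτ.2.2 x hx y hy).imp (lt_of_le_of_ne · hne) (lt_of_le_of_ne · hne.symm)
    have hno : ∀ x ∈ τ, ∀ y ∈ τ, ∀ z ∈ τ, x < y → ¬ y < z := fun x hx y hy z hz =>
      hQ.1 x (hτ.2.1 x hx) y (hτ.2.1 y hy) z (hτ.2.1 z hz)
    rcases hcmp a ha b hb hab with h1 | h1 <;> rcases hcmp a ha c hc hac with h2 | h2 <;>
      rcases hcmp b hb c hc hbc with h3 | h3
    · exact hno a ha b hb c hc h1 h3
    · exact hno a ha c hc b hb h2 h3
    · exact hno a ha b hb c hc h1 h3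
    · exact hno c hc a ha b hb h2 h1
    · exact hno b hb a ha c hc h1 h2
    · exact hno b hb a ha c hc h1 h2
    · exact hno b hb c hc a ha h3 h2
    · exact hno c hc b hb a ha h3 h1
  let P : Fin 2 → G.Walk u v := ![p, q]
  have hinj : Function.Injective ![u, v] := by
    intro i j hij
    have huv' : u ≠ v := huv.ne
    fin_cases i <;> fin_cases j
    exacts [rfl, absurd hij huv', absurd hij huv'.symm, rfl]
  refine ⟨hcard, ![u, v], P, hinj, ?_, ?_, ?_, ?_, ?_⟩
  · intro e
    fin_cases e
    exacts [hp, hq]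
  · intro e w _
    exact (by decide : ∀ w : Fin 2, w = 0 ∨ w = 1) w
  · have key : ∀ x ∈ q.support, x ∈ Set.range ![u, v] := by
      intro x hx
      rcases (hqs x).1 hx with rfl | rfl
      exacts [⟨0, rfl⟩, ⟨1, rfl⟩]
    intro e f x hef he hf
    fin_cases e <;> fin_cases f
    exacts [absurd rfl hef, key x hf, key x he, absurd rfl hef]
  · intro x hx
    exact ⟨(0 : Fin 2), hall x (hx.2.1 x (by simp))⟩
  · intro s
    induction s using Sym2.ind with
    | _ x y =>
      intro h
      have h' : G.Adj x y := h
      rcases hdeg x (hall x (hadj.1 h').1) y h' with h1 | h1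
      · refine ⟨(0 : Fin 2), h1, fun e he => ?_⟩
        fin_cases e
        · rfl
        · exact absurd ((hqe _).1 he ▸ h1) hpe
      · refine ⟨(1 : Fin 2), h1, fun e he => ?_⟩
        fin_cases e
        · exact absurd ((hqe _).1 h1 ▸ he) hpe
        · rfl

end Regular
end SimplePoly

namespace SimplePoly

/-! ### Degree counts of the five model links -/

section LinkDegrees

variable {V : Type} [DecidableEq V] {L : PreAbstractSimplicialComplex V} {H : ModelGraph}

lemma face_of_adj {a b : V} (h : (edgeGraph L).Adj a b) : {a} ∈ L.faces :=
  (L.isRelLowerSet_faces h.2).2 (by simp) (Finset.singleton_nonempty a)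

lemma linkDeg_eq_zero {a : V} (ha : {a} ∉ L.faces) : linkDeg L a = 0 := by
  rw [linkDeg]
  convert Set.ncard_empty V
  exact Set.eq_empty_of_forall_notMem fun b hb => ha (face_of_adj hb)

/-- The vertices of a given degree different from zero and two are branch vertices. -/
lemma IsSubdivisionOf.setOf_linkDeg [Fintype H.E] [DecidableEq H.W] [Fintype H.W]
    (h : IsSubdivisionOf L H) (hloop : ∀ e, H.fst e ≠ H.snd e) {d : ℕ} (h0 : d ≠ 0) (h2 : d ≠ 2) :
    {a | linkDeg L a = d}.ncard = (Finset.univ.filter fun w => H.deg w = d).card ∧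
      ({a | linkDeg L a = d}.Nonempty ↔ (Finset.univ.filter fun w => H.deg w = d).Nonempty) := by
  obtain ⟨φ, hφ, h1, h3⟩ := h.degrees hloop
  have : {a | linkDeg L a = d} = φ '' (Finset.univ.filter fun w => H.deg w = d : Finset H.W) := by
    ext a
    simp only [Set.mem_ofPred_eq, Finset.coe_filter, Finset.mem_univ, true_and, Set.mem_image]
    constructor
    · intro ha
      by_cases hr : a ∈ Set.range φ
      · obtain ⟨w, rfl⟩ := hr
        exact ⟨w, (h1 w).symm.trans ha, rfl⟩
      · by_cases hf : {a} ∈ L.faces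
        · exact absurd (ha.symm.trans (h3 a hf hr)) h2
        · exact absurd (ha.symm.trans (linkDeg_eq_zero hf)) h0
    · rintro ⟨w, hw, rfl⟩
      rw [h1, hw]
  rw [this, Set.ncard_image_of_injective _ hφ, Set.ncard_coe_finset, Set.image_nonempty,
    Finset.coe_nonempty]
  exact ⟨rfl, Iff.rfl⟩

lemma IsSubdivisionOf.linkDeg_mem [Fintype H.E] [DecidableEq H.W]
    (h : IsSubdivisionOf L H) (hloop : ∀ e, H.fst e ≠ H.snd e) (hH : ∀ w, 1 ≤ H.deg w ∧ H.deg w ≤ 3)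
    {a : V} (ha : {a} ∈ L.faces) : 1 ≤ linkDeg L a ∧ linkDeg L a ≤ 3 := by
  obtain ⟨φ, hφ, h1, h3⟩ := h.degrees hloop
  by_cases hr : a ∈ Set.range φ
  · obtain ⟨w, rfl⟩ := hr
    rw [h1]
    exact hH w
  · rw [h3 a ha hr]
    decide

instance : Fintype circleGraph.W := inferInstanceAs (Fintype (Fin 2))
instance : Fintype thetaGraph.W := inferInstanceAs (Fintype (Fin 2))
instance : Fintype completeGraph4.W := inferInstanceAs (Fintype (Fin 4))
instance : Fintype arcGraph.W := inferInstanceAs (Fintype (Fin 2))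
instance : Fintype tripodGraph.W := inferInstanceAs (Fintype (Fin 4))

lemma circle_loop : ∀ e, circleGraph.fst e ≠ circleGraph.snd e :=
  fun _ => (by decide : (0 : Fin 2) ≠ 1)
lemma theta_loop : ∀ e, thetaGraph.fst e ≠ thetaGraph.snd e :=
  fun _ => (by decide : (0 : Fin 2) ≠ 1)
lemma complete_loop : ∀ e, completeGraph4.fst e ≠ completeGraph4.snd e := fun e => e.2.ne
lemma arc_loop : ∀ e, arcGraph.fst e ≠ arcGraph.snd e :=
  fun _ => (by decide : (0 : Fin 2) ≠ 1)
lemma tripod_loop : ∀ e, tripodGraph.fst e ≠ tripodGraph.snd e :=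
  fun e => (Fin.succ_ne_zero e).symm

/-- The numbers of vertices of degree three and one. -/
structure DegreeCount (L : PreAbstractSimplicialComplex V) (p q : ℕ) : Prop where
  three : {a | linkDeg L a = 3}.ncard = p
  three' : {a | linkDeg L a = 3}.Nonempty ↔ 0 < p
  one' : {a | linkDeg L a = 1}.Nonempty ↔ 0 < q
  bound : ∀ a, {a} ∈ L.faces → 1 ≤ linkDeg L a ∧ linkDeg L a ≤ 3

lemma IsSubdivisionOf.degreeCount [Fintype H.E] [DecidableEq H.W] [Fintype H.W]
    (h : IsSubdivisionOf L H) (hloop : ∀ e, H.fst e ≠ H.snd e) {p q : ℕ}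
    (hp : (Finset.univ.filter fun w => H.deg w = 3).card = p)
    (hq : (Finset.univ.filter fun w => H.deg w = 1).card = q)
    (hH : ∀ w, 1 ≤ H.deg w ∧ H.deg w ≤ 3) : DegreeCount L p q where
  three := (h.setOf_linkDeg hloop (by decide) (by decide)).1.trans hp
  three' := by
    rw [(h.setOf_linkDeg hloop (d := 3) (by decide) (by decide)).2, ← hp, Finset.card_pos]
  one' := by
    rw [(h.setOf_linkDeg hloop (d := 1) (by decide) (by decide)).2, ← hq, Finset.card_pos]
  bound _ ha := h.linkDeg_mem hloop hH ha

lemma degreeCount_circle (h : IsSubdivisionOf L circleGraph) : DegreeCount L 0 0 :=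
  h.degreeCount circle_loop (by decide +revert) (by decide +revert) (by decide +revert)
lemma degreeCount_theta (h : IsSubdivisionOf L thetaGraph) : DegreeCount L 2 0 :=
  h.degreeCount theta_loop (by decide +revert) (by decide +revert) (by decide +revert)
lemma degreeCount_complete (h : IsSubdivisionOf L completeGraph4) : DegreeCount L 4 0 :=
  h.degreeCount complete_loop (by decide +revert) (by decide +revert) (by decide +revert)
lemma degreeCount_arc (h : IsSubdivisionOf L arcGraph) : DegreeCount L 0 2 :=
  h.degreeCount arc_loop (by decide +revert) (by decide +revert) (by decide +revert)
lemma degreeCount_tripod (h : IsSubdivisionOf L tripodGraph) : DegreeCount L 1 3 :=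
  h.degreeCount tripod_loop (by decide +revert) (by decide +revert) (by decide +revert)

end LinkDegrees

/-! ### Links of edges and triangles in a simple polyhedron -/

section Local

variable {V : Type} [DecidableEq V] {K : PreAbstractSimplicialComplex V}

lemma face_mono {σ τ : Finset V} (hσ : σ ∈ K.faces) (h : τ ⊆ σ) (hne : τ.Nonempty) : τ ∈ K.faces :=
  (K.isRelLowerSet_faces hσ).2 h hne

lemma face_nonempty {σ : Finset V} (hσ : σ ∈ K.faces) : σ.Nonempty :=
  (K.isRelLowerSet_faces hσ).1

/-- The vertices that span a face together with the given face. -/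
def cofaces (K : PreAbstractSimplicialComplex V) (e : Finset V) : Set V :=
  {x | x ∉ e ∧ insert x e ∈ K.faces}

/-- The counts `(p, q)` are `(0, 0)`, `(2, 0)`, `(4, 0)`, `(0, 2)` and `(1, 3)` for circle, theta
graph, complete graph, arc and tripod. So `p` and the positivity of `q` already tell the models
apart, and the type of a point can be read off from degrees in its link. -/
lemma IsSimplePolyhedron.degreeCount (hX : IsSimplePolyhedron K) {σ : Finset V} (hσ : σ ∈ K.faces) :
    ∃ p q, DegreeCount (pointLink K σ) p q ∧ (σ ∈ singularSet K ↔ 0 < p) ∧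
      (σ ∈ boundary K ↔ 0 < q) ∧ (HasModel K σ completeGraph4 ↔ p = 4) ∧
      (HasModel K σ thetaGraph ↔ p = 2) ∧ (q = 0 → p = 0 ∨ p = 2 ∨ p = 4) := by
  have key : ∀ p q, DegreeCount (pointLink K σ) p q → ∀ p' q', DegreeCount (pointLink K σ) p' q' →
      p = p' ∧ (0 < q ↔ 0 < q') := fun p q h p' q' h' =>
    ⟨h.three.symm.trans h'.three, h.one'.symm.trans h'.one'⟩
  have c1 : HasModel K σ circleGraph → DegreeCount (pointLink K σ) 0 0 :=
    fun h => degreeCount_circle h.2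
  have c2 : HasModel K σ thetaGraph → DegreeCount (pointLink K σ) 2 0 :=
    fun h => degreeCount_theta h.2
  have c3 : HasModel K σ completeGraph4 → DegreeCount (pointLink K σ) 4 0 :=
    fun h => degreeCount_complete h.2
  have c4 : HasModel K σ arcGraph → DegreeCount (pointLink K σ) 0 2 :=
    fun h => degreeCount_arc h.2
  have c5 : HasModel K σ tripodGraph → DegreeCount (pointLink K σ) 1 3 :=
    fun h => degreeCount_tripod h.2
  have main : ∀ p q, DegreeCount (pointLink K σ) p q →
      (HasModel K σ thetaGraph → p = 2 ∧ ¬ 0 < q) ∧ (HasModel K σ completeGraph4 → p = 4 ∧ ¬ 0 < q) ∧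
      (HasModel K σ arcGraph → p = 0 ∧ 0 < q) ∧ (HasModel K σ tripodGraph → p = 1 ∧ 0 < q) := by
    intro p q h
    refine ⟨fun h' => ?_, fun h' => ?_, fun h' => ?_, fun h' => ?_⟩
    · have := key _ _ h _ _ (c2 h'); exact ⟨this.1, by rw [this.2]; decide⟩
    · have := key _ _ h _ _ (c3 h'); exact ⟨this.1, by rw [this.2]; decide⟩
    · have := key _ _ h _ _ (c4 h'); exact ⟨this.1, by rw [this.2]; decide⟩
    · have := key _ _ h _ _ (c5 h'); exact ⟨this.1, by rw [this.2]; decide⟩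
  simp only [singularSet, boundary, Set.mem_ofPred_eq]
  rcases hX.2.2 σ hσ with h | h | h | h | h
  · obtain ⟨m2, m3, m4, m5⟩ := main _ _ (c1 h)
    refine ⟨0, 0, c1 h, ?_, ?_, ?_, ?_, ?_⟩ <;> grind
  · obtain ⟨m2, m3, m4, m5⟩ := main _ _ (c2 h)
    refine ⟨2, 0, c2 h, ?_, ?_, ?_, ?_, ?_⟩ <;> grind
  · obtain ⟨m2, m3, m4, m5⟩ := main _ _ (c3 h)
    refine ⟨4, 0, c3 h, ?_, ?_, ?_, ?_, ?_⟩ <;> grind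
  · obtain ⟨m2, m3, m4, m5⟩ := main _ _ (c4 h)
    refine ⟨0, 2, c4 h, ?_, ?_, ?_, ?_, ?_⟩ <;> grind
  · obtain ⟨m2, m3, m4, m5⟩ := main _ _ (c5 h)
    refine ⟨1, 3, c5 h, ?_, ?_, ?_, ?_, ?_⟩ <;> grind

lemma IsSimplePolyhedron.link_card (hX : IsSimplePolyhedron K) {σ : Finset V} (hσ : σ ∈ K.faces) :
    ∀ τ ∈ (pointLink K σ).faces, τ.card ≤ 2 := by
  rcases hX.2.2 σ hσ with h | h | h | h | h <;> exact h.2.1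

/-- Removing a vertex from the face gives a simplex of the link of that vertex, and all model links
have dimension at most one. -/
lemma IsSimplePolyhedron.card_le (hX : IsSimplePolyhedron K) {σ : Finset V} (hσ : σ ∈ K.faces) :
    σ.card ≤ 3 := by
  by_contra hcon
  obtain ⟨v, hv⟩ := face_nonempty hσ
  have h1 : ({v} : Finset V) ∈ K.faces := face_mono hσ (by simpa using hv) (by simp)
  have h2 := hX.link_card h1 (σ.erase v) ⟨Finset.card_pos.1 (by rw [Finset.card_erase_of_mem hv]; omega),
    by rwa [← Finset.insert_eq, Finset.insert_erase hv], by simp⟩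
  rw [Finset.card_erase_of_mem hv] at h2
  omega

lemma pointLink_adj {σ : Finset V} {x y : V} : (edgeGraph (pointLink K σ)).Adj x y ↔
    x ≠ y ∧ σ ∪ {x, y} ∈ K.faces ∧ ¬ σ ⊆ {x, y} :=
  and_congr_right fun _ => ⟨fun h => h.2, fun h => ⟨by simp, h⟩⟩

lemma pair_eq_union (v x y : V) : ({v} ∪ {x, y} : Finset V) = insert y {v, x} := by
  ext; simp; tauto

/-- The degree of a vertex in a vertex link. -/
lemma linkDeg_vertex {v x : V} (hvx : x ≠ v) :
    linkDeg (pointLink K {v}) x = (cofaces K {v, x}).ncard := by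
  rw [linkDeg]
  congr 1
  ext y
  simp only [Set.mem_ofPred_eq, pointLink_adj, cofaces, pair_eq_union, Finset.singleton_subset_iff,
    Finset.mem_insert, Finset.mem_singleton]
  grind

/-- The link of an interior point of `e` is the suspension of the finite set `cofaces K e`, with the
two ends of `e` as poles. A link edge avoiding `e` would span a face with four vertices. -/
lemma IsSimplePolyhedron.adj_edge (hX : IsSimplePolyhedron K) {e : Finset V} (he : e.card = 2)
    {x y : V} : (edgeGraph (pointLink K e)).Adj x y ↔
      (x ∈ e ∧ y ∈ cofaces K e) ∨ (y ∈ e ∧ x ∈ cofaces K e) := by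
  rw [pointLink_adj]
  constructor
  · rintro ⟨hne, h1, h2⟩
    have hcard := hX.card_le h1
    by_cases hx : x ∈ e <;> by_cases hy : y ∈ e
    · refine absurd ?_ h2
      rw [Finset.eq_of_subset_of_card_le (s := {x, y}) (t := e) (by grind)
        (by rw [he, Finset.card_pair hne])]
    · refine Or.inl ⟨hx, hy, ?_⟩
      rwa [show e ∪ {x, y} = insert y e by grind] at h1
    · refine Or.inr ⟨hy, hx, ?_⟩
      rwa [show e ∪ {x, y} = insert x e by grind] at h1
    · have : (e ∪ {x, y}).card = 4 := by
        rw [Finset.card_union_of_disjoint (by simp [hx, hy]), he, Finset.card_pair hne]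
      omega
  · have key : ∀ x y, x ∈ e → y ∈ cofaces K e → x ≠ y ∧ e ∪ {x, y} ∈ K.faces ∧ ¬ e ⊆ {x, y} := by
      rintro x y hx ⟨hy, h⟩
      refine ⟨by grind, by rwa [show e ∪ {x, y} = insert y e by grind], fun hsub => ?_⟩
      have h2 : e ⊆ {x} := fun z hz => by
        have := hsub hz
        simp only [Finset.mem_insert, Finset.mem_singleton] at this ⊢
        rcases this with h | h
        · exact h
        · exact absurd (h ▸ hz) hy
      have := Finset.card_le_card h2
      rw [he, Finset.card_singleton] at this
      omega
    rintro (⟨hx, hy⟩ | ⟨hy, hx⟩)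
    · exact key x y hx hy
    · obtain ⟨h1, h2, h3⟩ := key y x hy hx
      exact ⟨h1.symm, by rwa [Finset.pair_comm], by rwa [Finset.pair_comm]⟩

lemma IsSimplePolyhedron.linkDeg_edge (hX : IsSimplePolyhedron K) {e : Finset V} (he : e.card = 2)
    {x : V} (hx : x ∈ e) : linkDeg (pointLink K e) x = (cofaces K e).ncard := by
  rw [linkDeg]
  congr 1
  ext y
  rw [Set.mem_ofPred_eq, hX.adj_edge he]
  exact ⟨fun h => h.elim (fun h => h.2) fun h => absurd hx h.2.1, fun h => Or.inl ⟨hx, h⟩⟩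

lemma IsSimplePolyhedron.linkDeg_edge_of_notMem (hX : IsSimplePolyhedron K) {e : Finset V}
    (he : e.card = 2) {x : V} (hx : x ∉ e) :
    linkDeg (pointLink K e) x = 0 ∨ linkDeg (pointLink K e) x = 2 := by
  by_cases h : x ∈ cofaces K e
  · right
    rw [linkDeg, ← he, ← Set.ncard_coe_finset]
    congr 1
    ext y
    rw [Set.mem_ofPred_eq, hX.adj_edge he]
    exact ⟨fun h => h.elim (fun h => absurd h.1 hx) fun h => h.1, fun hy => Or.inr ⟨hy, h⟩⟩
  · left
    rw [linkDeg]
    convert Set.ncard_empty V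
    refine Set.eq_empty_of_forall_notMem fun y hy => ?_
    rw [Set.mem_ofPred_eq, hX.adj_edge he] at hy
    tauto

/-- In the suspension the two poles have the number of cofaces as degree, and all other vertices
have degree two. So degrees three and one can occur only at the poles. -/
lemma IsSimplePolyhedron.edge_facts (hX : IsSimplePolyhedron K) {e : Finset V} (he : e.card = 2)
    (hK : e ∈ K.faces) : (e ∈ singularSet K ↔ (cofaces K e).ncard = 3) ∧
      (e ∈ boundary K ↔ (cofaces K e).ncard = 1) ∧ 1 ≤ (cofaces K e).ncard ∧
      (cofaces K e).ncard ≤ 3 := by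
  obtain ⟨p, q, h, hs, hb, -⟩ := hX.degreeCount hK
  obtain ⟨x, hx⟩ := face_nonempty hK
  have key : ∀ d, d ≠ 0 → d ≠ 2 →
      ({a | linkDeg (pointLink K e) a = d}.Nonempty ↔ (cofaces K e).ncard = d) := by
    intro d h0 h2
    constructor
    · rintro ⟨a, ha⟩
      by_cases hae : a ∈ e
      · exact (hX.linkDeg_edge he hae).symm.trans ha
      · rcases hX.linkDeg_edge_of_notMem he hae with h | h
        · exact absurd (ha.symm.trans h) h0
        · exact absurd (ha.symm.trans h) h2
    · exact fun h => ⟨x, (hX.linkDeg_edge he hx).trans h⟩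
  refine ⟨by rw [hs, ← h.three', key 3 (by decide) (by decide)],
    by rw [hb, ← h.one', key 1 (by decide) (by decide)], ?_⟩
  rw [← hX.linkDeg_edge he hx]
  refine h.bound x ⟨by simp, ?_, fun hsub => ?_⟩
  · rwa [Finset.union_eq_left.2 (by simpa using hx)]
  · have := Finset.card_le_card hsub
    rw [he, Finset.card_singleton] at this
    omega

/-- The link of an interior point of a triangle is the boundary of the triangle, where all degrees
are two. -/
lemma IsSimplePolyhedron.triangle_facts (hX : IsSimplePolyhedron K) {t : Finset V}
    (ht : t.card = 3) (hK : t ∈ K.faces) : t ∉ singularSet K ∧ t ∉ boundary K := by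
  obtain ⟨p, q, h, hs, hb, -⟩ := hX.degreeCount hK
  have hadj : ∀ {x y}, (edgeGraph (pointLink K t)).Adj x y ↔ x ≠ y ∧ x ∈ t ∧ y ∈ t := by
    intro x y
    rw [pointLink_adj]
    refine and_congr_right fun hne => ?_
    constructor
    · rintro ⟨h1, -⟩
      have h2 : t = t ∪ {x, y} :=
        Finset.eq_of_subset_of_card_le Finset.subset_union_left (by rw [ht]; exact hX.card_le h1)
      exact ⟨by rw [h2]; simp, by rw [h2]; simp⟩
    · rintro ⟨hx, hy⟩
      refine ⟨by rwa [Finset.union_eq_left.2 (by grind)], fun hsub => ?_⟩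
      have := Finset.card_le_card hsub
      rw [ht, Finset.card_pair hne] at this
      omega
  have hdeg : ∀ a, linkDeg (pointLink K t) a = 0 ∨ linkDeg (pointLink K t) a = 2 := by
    intro a
    by_cases ha : a ∈ t
    · right
      rw [linkDeg, show 2 = (t.erase a).card by rw [Finset.card_erase_of_mem ha, ht],
        ← Set.ncard_coe_finset]
      congr 1
      ext y
      rw [Set.mem_ofPred_eq, hadj]
      simp only [Finset.coe_erase, Set.mem_sdiff, Finset.mem_coe, Set.mem_singleton_iff]
      grind
    · left
      rw [linkDeg]
      convert Set.ncard_empty V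
      refine Set.eq_empty_of_forall_notMem fun y hy => ?_
      exact ha (hadj.1 hy).2.1
  rw [hs, hb, ← h.three', ← h.one']
  constructor <;> rintro ⟨a, ha⟩ <;> rcases hdeg a with h | h <;> rw [Set.mem_ofPred_eq, h] at ha <;>
    omega

end Local
end SimplePoly

namespace SimplePoly

/-! ### Unions of components of the singular set away from the boundary -/

section SingularPart

variable {V : Type} [DecidableEq V] {K : PreAbstractSimplicialComplex V} {T : Set (Finset V)}

/-- A union of components of the singular set that is disjoint from the boundary. -/
structure IsSingularPart (K : PreAbstractSimplicialComplex V) (T : Set (Finset V)) : Prop where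
  sub : T ⊆ singularSet K
  sat : ∀ a ∈ T, ∀ b ∈ singularSet K, (a ≤ b ∨ b ≤ a) → b ∈ T
  bd : Disjoint T (boundary K)

lemma mem_faces_of_singular {σ : Finset V} (h : σ ∈ singularSet K) : σ ∈ K.faces := by
  rcases h with h | h | h <;> exact h.1

lemma IsSingularPart.mem_faces (hT : IsSingularPart K T) {σ : Finset V} (h : σ ∈ T) :
    σ ∈ K.faces := mem_faces_of_singular (hT.sub h)

lemma IsSingularPart.card_le (hT : IsSingularPart K T) (hX : IsSimplePolyhedron K) {σ : Finset V}
    (h : σ ∈ T) : σ.card ≤ 2 := by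
  have h3 := hX.card_le (hT.mem_faces h)
  by_contra hcon
  exact (hX.triangle_facts (by omega) (hT.mem_faces h)).1 (hT.sub h)

lemma IsSingularPart.cofaces_eq_three (hT : IsSingularPart K T) (hX : IsSimplePolyhedron K)
    {e : Finset V} (he : e.card = 2) (h : e ∈ T) : (cofaces K e).ncard = 3 :=
  (hX.edge_facts he (hT.mem_faces h)).1.1 (hT.sub h)

lemma linkDeg_self (v : V) : linkDeg (pointLink K {v}) v = 0 :=
  linkDeg_eq_zero fun h => h.2.2 le_rfl

lemma pair_mem_of_cofaces {v x : V} (h : (cofaces K {v, x}).ncard ≠ 0) : {v, x} ∈ K.faces := by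
  obtain ⟨y, -, hy⟩ := Set.nonempty_of_ncard_ne_zero h
  exact face_mono hy (Finset.subset_insert _ _) (by simp)

lemma singular_of_linkDeg (hX : IsSimplePolyhedron K) {v x : V}
    (h : linkDeg (pointLink K {v}) x = 3) : x ≠ v ∧ {v, x} ∈ singularSet K := by
  have hne : x ≠ v := by
    rintro rfl
    rw [linkDeg_self] at h
    omega
  rw [linkDeg_vertex hne] at h
  have hK := pair_mem_of_cofaces (by rw [h]; decide)
  exact ⟨hne, (hX.edge_facts (Finset.card_pair hne.symm) hK).1.2 h⟩

lemma linkDeg_of_singular (hX : IsSimplePolyhedron K) {v x : V} (hne : x ≠ v)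
    (h : {v, x} ∈ singularSet K) : linkDeg (pointLink K {v}) x = 3 := by
  rw [linkDeg_vertex hne]
  exact (hX.edge_facts (Finset.card_pair hne.symm) (mem_faces_of_singular h)).1.1 h

/-- The other end `x` has degree three in the link of `v`, and only singular models contain such a
vertex. -/
lemma IsSingularPart.vertex_mem (hT : IsSingularPart K T) (hX : IsSimplePolyhedron K) {v x : V}
    (hne : x ≠ v) (h : {v, x} ∈ T) : {v} ∈ T := by
  have hv : ({v} : Finset V) ∈ K.faces := face_mono (hT.mem_faces h) (by simp) (by simp)
  obtain ⟨p, q, hd, hs, -⟩ := hX.degreeCount hv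
  refine hT.sat _ h _ (hs.2 (hd.three'.1 ⟨x, linkDeg_of_singular hX hne (hT.sub h)⟩)) (Or.inr ?_)
  exact Finset.singleton_subset_iff.2 (Finset.mem_insert_self _ _)

lemma IsSingularPart.down (hT : IsSingularPart K T) (hX : IsSimplePolyhedron K) {σ ρ : Finset V}
    (hσ : σ ∈ T) (h : ρ ⊆ σ) (hne : ρ.Nonempty) : ρ ∈ T := by
  have h1 := hT.card_le hX hσ
  have h2 := Finset.card_le_card h
  have h3 := Finset.card_pos.2 hne
  by_cases heq : ρ.card = σ.card
  · rwa [Finset.eq_of_subset_of_card_le h heq.ge]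
  · obtain ⟨v, rfl⟩ := Finset.card_eq_one.1 (show ρ.card = 1 by omega)
    obtain ⟨x, hx, rfl⟩ := Finset.exists_eq_insert_iff.2 ⟨h, by rw [Finset.card_singleton] at *; omega⟩
    rw [Finset.pair_comm] at hσ
    exact hT.vertex_mem hX (by simpa using hx) hσ

lemma IsSingularPart.setOf_linkDeg (hT : IsSingularPart K T) (hX : IsSimplePolyhedron K) {v : V}
    (hv : {v} ∈ T) : {x | linkDeg (pointLink K {v}) x = 3} = {x | x ≠ v ∧ {v, x} ∈ T} := by
  ext x
  constructor
  · intro h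
    obtain ⟨h1, h2⟩ := singular_of_linkDeg hX h
    exact ⟨h1, hT.sat _ hv _ h2 (Or.inl (by simp))⟩
  · exact fun h => linkDeg_of_singular hX h.1 (hT.sub h.2)

/-- Away from the boundary, the link of a singular vertex is a theta graph or a complete graph; its
vertices of degree three are the directions of the singular edges. -/
lemma IsSingularPart.vertex_deg (hT : IsSingularPart K T) (hX : IsSimplePolyhedron K) {v : V}
    (hv : {v} ∈ T) : (v ∈ trueVertices K → {x | x ≠ v ∧ {v, x} ∈ T}.ncard = 4) ∧
      (v ∉ trueVertices K → {x | x ≠ v ∧ {v, x} ∈ T}.ncard = 2 ∧ HasModel K {v} thetaGraph) := by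
  obtain ⟨p, q, hd, hs, hb, h4, h2, h0⟩ := hX.degreeCount (hT.mem_faces hv)
  rw [← hT.setOf_linkDeg hX hv, hd.three]
  have hq : q = 0 := by
    by_contra hq
    exact Set.disjoint_left.1 hT.bd hv (hb.2 (by omega))
  have hp : 0 < p := hs.1 (hT.sub hv)
  change (HasModel K {v} completeGraph4 → _) ∧ (¬ HasModel K {v} completeGraph4 → _)
  rw [h4, h2]
  have := h0 hq
  omega

/-- Three triangles would make the edge singular and so put it into `T`. A single triangle would
create a vertex of degree one in the link of `v` and so put `{v}` on the boundary. -/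
lemma IsSingularPart.cofaces_eq_two (hT : IsSingularPart K T) (hX : IsSimplePolyhedron K) {v x : V}
    (hv : {v} ∈ T) (hne : x ≠ v) (hK : {v, x} ∈ K.faces) (h : {v, x} ∉ T) :
    (cofaces K {v, x}).ncard = 2 := by
  obtain ⟨h3, h1, hle, hge⟩ := hX.edge_facts (Finset.card_pair hne.symm) hK
  have n3 : (cofaces K {v, x}).ncard ≠ 3 := fun h' =>
    h (hT.sat _ hv _ (h3.2 h') (Or.inl (by simp)))
  have n1 : (cofaces K {v, x}).ncard ≠ 1 := fun h' => by
    obtain ⟨p, q, hd, hs, hb, -⟩ := hX.degreeCount (hT.mem_faces hv)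
    refine Set.disjoint_left.1 hT.bd hv (hb.2 (hd.one'.1 ⟨x, ?_⟩))
    rw [Set.mem_ofPred_eq, linkDeg_vertex hne, h']
  omega

end SingularPart

/-! ### Chains of faces, flags and their completions -/

section Chains

variable {V : Type} [DecidableEq V] {K : PreAbstractSimplicialComplex V} {T : Set (Finset V)}

lemma sd_mono {c d : Finset (Finset V)} (hd : d ∈ (sd K).faces) (h : c ⊆ d) (hne : c.Nonempty) :
    c ∈ (sd K).faces := face_mono hd h hne

/-- The faces that extend a chain. -/
def completions (K : PreAbstractSimplicialComplex V) (c : Finset (Finset V)) : Set (Finset V) :=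
  {σ | σ ∉ c ∧ insert σ c ∈ (sd K).faces}

lemma mem_completions {c : Finset (Finset V)} (hc : c ∈ (sd K).faces) {σ : Finset V} :
    σ ∈ completions K c ↔ σ ∉ c ∧ σ ∈ K.faces ∧ ∀ a ∈ c, σ ⊆ a ∨ a ⊆ σ := by
  refine and_congr_right fun _ => ⟨fun h => ⟨h.2.1 σ (by simp), fun a ha =>
    h.2.2 σ (by simp) a (by simp [ha])⟩, fun h => ⟨by simp, ?_, ?_⟩⟩
  · intro a ha
    rcases Finset.mem_insert.1 ha with rfl | ha
    exacts [h.1, hc.2.1 a ha]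
  · intro a ha b hb
    rcases Finset.mem_insert.1 ha with rfl | ha' <;> rcases Finset.mem_insert.1 hb with rfl | hb'
    exacts [Or.inl le_rfl, h.2 b hb', (h.2 a ha').symm, hc.2.2 a ha' b hb']

lemma card_ne_of_comparable {a b : Finset V} (h : a ⊆ b ∨ b ⊆ a) (hne : a ≠ b) : a.card ≠ b.card := by
  intro heq
  rcases h with h | h
  · exact hne (Finset.eq_of_subset_of_card_le h heq.ge)
  · exact hne (Finset.eq_of_subset_of_card_le h heq.le).symm

lemma subset_of_card_lt {a b : Finset V} (h : a ⊆ b ∨ b ⊆ a) (hlt : a.card < b.card) : a ⊆ b :=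
  h.resolve_right fun h => by have := Finset.card_le_card h; omega

/-- The faces of a chain have distinct cardinalities among 1, 2 and 3, so completing a two-element
chain means supplying the missing one: here a triangle over an edge, in the next two lemmas an edge
or a vertex of a triangle. -/
lemma ncard_completions_ve {v x : V} (hX : IsSimplePolyhedron K) (hne : x ≠ v)
    (hc : {{v}, {v, x}} ∈ (sd K).faces) :
    completions K {{v}, {v, x}} = (fun y => insert y {v, x}) '' cofaces K {v, x} ∧
    (completions K {{v}, {v, x}}).ncard = (cofaces K {v, x}).ncard := by
  have : completions K {{v}, {v, x}} = (fun y => insert y {v, x}) '' cofaces K {v, x} := by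
    ext σ
    rw [mem_completions hc]
    simp only [Finset.mem_insert, Finset.mem_singleton, not_or, forall_eq_or_imp, forall_eq,
      Set.mem_image]
    constructor
    · rintro ⟨⟨h1, h2⟩, hσ, h3, h4⟩
      have c1 := card_ne_of_comparable h3 h1
      have c2 := card_ne_of_comparable h4 h2
      rw [Finset.card_singleton] at c1
      rw [Finset.card_pair hne.symm] at c2
      have c3 := hX.card_le hσ
      have c4 := Finset.card_pos.2 (face_nonempty hσ)
      have h5 := subset_of_card_lt h4.symm (by rw [Finset.card_pair hne.symm]; omega)
      obtain ⟨y, hy, rfl⟩ := Finset.exists_eq_insert_iff.2 ⟨h5, by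
        rw [Finset.card_pair hne.symm]; omega⟩
      exact ⟨y, ⟨hy, hσ⟩, rfl⟩
    · rintro ⟨y, ⟨hy, hK⟩, rfl⟩
      have c1 := Finset.card_insert_of_notMem hy
      rw [Finset.card_pair hne.symm] at c1
      refine ⟨⟨?_, ?_⟩, hK, Or.inr (by simp), Or.inr (Finset.subset_insert _ _)⟩
      · intro h
        rw [h, Finset.card_singleton] at c1
        omega
      · intro h
        rw [h, Finset.card_pair hne.symm] at c1
        omega
  refine ⟨this, ?_⟩
  rw [this, Set.InjOn.ncard_image]
  intro y hy z hz h
  have h1 : y ∈ (insert z {v, x} : Finset V) :=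
    (show (insert y {v, x} : Finset V) = insert z {v, x} from h) ▸ Finset.mem_insert_self _ _
  exact (Finset.mem_insert.1 h1).resolve_right hy.1

lemma ncard_completions_vt {v : V} {t : Finset V} (hX : IsSimplePolyhedron K) (hv : v ∈ t)
    (ht : t.card = 3) (hc : {{v}, t} ∈ (sd K).faces) :
    completions K {{v}, t} = (fun y => {v, y}) '' (t.erase v : Finset V) ∧
    (completions K {{v}, t}).ncard = 2 := by
  have htK : t ∈ K.faces := hc.2.1 t (by simp)
  have : completions K {{v}, t} = (fun y => {v, y}) '' (t.erase v : Finset V) := by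
    ext σ
    rw [mem_completions hc]
    simp only [Finset.mem_insert, Finset.mem_singleton, not_or, forall_eq_or_imp, forall_eq,
      Set.mem_image, Finset.mem_coe, Finset.mem_erase]
    constructor
    · rintro ⟨⟨h1, h2⟩, hσ, h3, h4⟩
      have c1 := card_ne_of_comparable h3 h1
      have c2 := card_ne_of_comparable h4 h2
      rw [Finset.card_singleton] at c1
      rw [ht] at c2
      have c3 := hX.card_le hσ
      have c4 := Finset.card_pos.2 (face_nonempty hσ)
      have h5 := subset_of_card_lt h3.symm (by rw [Finset.card_singleton]; omega)
      have h6 := subset_of_card_lt h4 (by rw [ht]; omega)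
      obtain ⟨y, hy, rfl⟩ := Finset.exists_eq_insert_iff.2 ⟨h5, by
        rw [Finset.card_singleton]; omega⟩
      exact ⟨y, ⟨by simpa using hy, h6 (by simp)⟩, Finset.pair_comm _ _⟩
    · rintro ⟨y, ⟨hy, hyt⟩, rfl⟩
      have c1 : ({v, y} : Finset V).card = 2 := Finset.card_pair hy.symm
      have hsub : {v, y} ⊆ t := by grind
      refine ⟨⟨?_, ?_⟩, face_mono htK hsub (by simp), Or.inr (by simp), Or.inl hsub⟩
      · intro h
        rw [h, Finset.card_singleton] at c1
        omega
      · intro h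
        rw [h, ht] at c1
        omega
  refine ⟨this, ?_⟩
  rw [this, Set.InjOn.ncard_image, Set.ncard_coe_finset, Finset.card_erase_of_mem hv, ht]
  intro y hy z hz h
  have h1 : y ∈ ({v, z} : Finset V) := by rw [← show ({v, y} : Finset V) = {v, z} from h]; simp
  simp only [Finset.mem_insert, Finset.mem_singleton] at h1
  exact h1.resolve_left (Finset.mem_erase.1 hy).1

lemma ncard_completions_et {e t : Finset V} (hX : IsSimplePolyhedron K) (he : e.card = 2)
    (het : e ⊆ t) (ht : t.card = 3) (hc : {e, t} ∈ (sd K).faces) :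
    completions K {e, t} = (fun y => {y}) '' (e : Set V) ∧
    (completions K {e, t}).ncard = 2 := by
  have htK : t ∈ K.faces := hc.2.1 t (by simp)
  have : completions K {e, t} = (fun y => {y}) '' (e : Set V) := by
    ext σ
    rw [mem_completions hc]
    simp only [Finset.mem_insert, Finset.mem_singleton, not_or, forall_eq_or_imp, forall_eq,
      Set.mem_image, Finset.mem_coe]
    constructor
    · rintro ⟨⟨h1, h2⟩, hσ, h3, h4⟩
      have c1 := card_ne_of_comparable h3 h1
      have c2 := card_ne_of_comparable h4 h2
      have c3 := hX.card_le hσ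
      have c4 := Finset.card_pos.2 (face_nonempty hσ)
      obtain ⟨y, rfl⟩ := Finset.card_eq_one.1 (show σ.card = 1 by omega)
      have h5 := subset_of_card_lt h3 (by rw [Finset.card_singleton]; omega)
      exact ⟨y, h5 (by simp), rfl⟩
    · rintro ⟨y, hy, rfl⟩
      refine ⟨⟨?_, ?_⟩, face_mono htK (by simpa using het hy) (by simp),
        Or.inl (by simpa using hy), Or.inl (by simpa using het hy)⟩
      · intro h
        rw [← h, Finset.card_singleton] at he
        omega
      · intro h
        rw [← h, Finset.card_singleton] at ht
        omega
  refine ⟨this, ?_⟩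
  rw [this, Set.ncard_image_of_injective _ Finset.singleton_injective, Set.ncard_coe_finset, he]

/-- A flag of faces. -/
def flag (v x y : V) : Finset (Finset V) := {{v}, {v, x}, insert y {v, x}}

/-- Three distinct vertices of a triangle. -/
def IsFlag (K : PreAbstractSimplicialComplex V) (v x y : V) : Prop :=
  x ≠ v ∧ y ≠ v ∧ y ≠ x ∧ insert y {v, x} ∈ K.faces

lemma IsFlag.card {v x y : V} (h : IsFlag K v x y) : (insert y {v, x} : Finset V).card = 3 := by
  rw [Finset.card_insert_of_notMem (by simp [h.2.1, h.2.2.1]), Finset.card_pair h.1.symm]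

lemma insert_pair_comm (v x y : V) : (insert y {v, x} : Finset V) = insert x {v, y} := by
  ext; simp; tauto

lemma insert_pair_comm' (v x y : V) : (insert y {v, x} : Finset V) = insert y {x, v} := by
  rw [Finset.pair_comm]

lemma IsFlag.swap {v x y : V} (h : IsFlag K v x y) : IsFlag K v y x :=
  ⟨h.2.1, h.1, h.2.2.1.symm, by rw [← insert_pair_comm]; exact h.2.2.2⟩

lemma IsFlag.swap' {v x y : V} (h : IsFlag K v x y) : IsFlag K x v y :=
  ⟨h.1.symm, h.2.2.1, h.2.1, by rw [← insert_pair_comm']; exact h.2.2.2⟩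

lemma isFlag_iff {v x y : V} (hne : x ≠ v) : IsFlag K v x y ↔ y ∈ cofaces K {v, x} := by
  simp only [IsFlag, cofaces, Set.mem_ofPred_eq, Finset.mem_insert, Finset.mem_singleton, not_or]
  tauto

lemma IsFlag.mem_sd {v x y : V} (h : IsFlag K v x y) : flag v x y ∈ (sd K).faces := by
  refine ⟨by simp [flag], ?_, ?_⟩
  · intro a ha
    simp only [flag, Finset.mem_insert, Finset.mem_singleton] at ha
    rcases ha with rfl | rfl | rfl
    · exact face_mono h.2.2.2 (by simp) (by simp)
    · exact face_mono h.2.2.2 (by simp) (by simp)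
    · exact h.2.2.2
  · intro a ha b hb
    simp only [flag, Finset.mem_insert, Finset.mem_singleton] at ha hb
    rcases ha with rfl | rfl | rfl <;> rcases hb with rfl | rfl | rfl <;> simp

lemma IsFlag.card_flag {v x y : V} (h : IsFlag K v x y) : (flag v x y).card = 3 := by
  have h3 := h.card
  have h2 : ({v, x} : Finset V).card = 2 := Finset.card_pair h.1.symm
  have h1 : ({v} : Finset V).card = 1 := Finset.card_singleton v
  rw [flag, Finset.card_eq_three]
  refine ⟨_, _, _, ?_, ?_, ?_, rfl⟩ <;> intro heq
  · rw [heq] at h1; omega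
  · rw [heq] at h1; omega
  · rw [heq] at h2; omega

lemma flag_injective {v x y v' x' y' : V} (h : IsFlag K v x y) (h' : IsFlag K v' x' y')
    (heq : flag v x y = flag v' x' y') : v = v' ∧ x = x' ∧ y = y' := by
  have key : ∀ {a : Finset V}, a ∈ flag v x y → a = {v'} ∨ a = {v', x'} ∨ a = insert y' {v', x'} := by
    intro a ha
    rw [heq] at ha
    simpa [flag] using ha
  have c3 := h.card
  have c3' := h'.card
  have c2 : ({v, x} : Finset V).card = 2 := Finset.card_pair h.1.symm
  have c2' : ({v', x'} : Finset V).card = 2 := Finset.card_pair h'.1.symm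
  have e1 : ({v} : Finset V) = {v'} := by
    rcases key (a := {v}) (by simp [flag]) with h | h | h
    · exact h
    · rw [← h, Finset.card_singleton] at c2'; omega
    · rw [← h, Finset.card_singleton] at c3'; omega
  have e2 : ({v, x} : Finset V) = {v', x'} := by
    rcases key (a := {v, x}) (by simp [flag]) with h | h | h
    · rw [h, Finset.card_singleton] at c2; omega
    · exact h
    · rw [← h] at c3'; omega
  have e3 : (insert y {v, x} : Finset V) = insert y' {v', x'} := by
    rcases key (a := insert y {v, x}) (by simp [flag]) with h | h | h
    · rw [h, Finset.card_singleton] at c3; omega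
    · rw [h] at c3; omega
    · exact h
  obtain rfl := Finset.singleton_injective e1
  have hx : x = x' := by
    have : x ∈ ({v, x'} : Finset V) := e2 ▸ by simp
    simp only [Finset.mem_insert, Finset.mem_singleton] at this
    exact this.resolve_left h.1
  subst hx
  refine ⟨rfl, rfl, ?_⟩
  have : y ∈ (insert y' {v, x} : Finset V) := e3 ▸ by simp
  simp only [Finset.mem_insert, Finset.mem_singleton] at this
  exact this.resolve_right (not_or.2 ⟨h.2.1, h.2.2.1⟩)

lemma card_injOn {c : Finset (Finset V)} (hc : c ∈ (sd K).faces) :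
    Set.InjOn Finset.card (c : Set (Finset V)) := fun a ha b hb h => by
  by_contra hne
  exact card_ne_of_comparable (hc.2.2 a ha b hb) hne h

lemma IsSimplePolyhedron.image_card (hX : IsSimplePolyhedron K) {c : Finset (Finset V)}
    (hc : c ∈ (sd K).faces) : c.image Finset.card ⊆ {1, 2, 3} := by
  intro n hn
  obtain ⟨a, ha, rfl⟩ := Finset.mem_image.1 hn
  have h1 := hX.card_le (hc.2.1 a ha)
  have h2 := Finset.card_pos.2 (face_nonempty (hc.2.1 a ha))
  simp only [Finset.mem_insert, Finset.mem_singleton]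
  omega

lemma IsSimplePolyhedron.chain_card_le (hX : IsSimplePolyhedron K) {c : Finset (Finset V)}
    (hc : c ∈ (sd K).faces) : c.card ≤ 3 := by
  rw [← Finset.card_image_of_injOn (card_injOn hc)]
  exact Finset.card_le_card (hX.image_card hc)

lemma IsSimplePolyhedron.exists_flag (hX : IsSimplePolyhedron K) {c : Finset (Finset V)}
    (hc : c ∈ (sd K).faces) (h3 : c.card = 3) : ∃ v x y, IsFlag K v x y ∧ c = flag v x y := by
  have himg : c.image Finset.card = {1, 2, 3} :=
    Finset.eq_of_subset_of_card_le (hX.image_card hc)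
      (by rw [Finset.card_image_of_injOn (card_injOn hc), h3]; decide)
  have hex : ∀ n ∈ ({1, 2, 3} : Finset ℕ), ∃ a ∈ c, a.card = n := fun n hn => by
    rw [← himg] at hn
    simpa using hn
  obtain ⟨a, ha, ha1⟩ := hex 1 (by decide)
  obtain ⟨b, hb, hb2⟩ := hex 2 (by decide)
  obtain ⟨t, ht, ht3⟩ := hex 3 (by decide)
  have hab := subset_of_card_lt (hc.2.2 a ha b hb) (by omega)
  have hbt := subset_of_card_lt (hc.2.2 b hb t ht) (by omega)
  obtain ⟨v, rfl⟩ := Finset.card_eq_one.1 ha1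
  obtain ⟨x, hx, rfl⟩ := Finset.exists_eq_insert_iff.2 ⟨hab, by rw [ha1, hb2]⟩
  obtain ⟨y, hy, rfl⟩ := Finset.exists_eq_insert_iff.2 ⟨hbt, by rw [hb2, ht3]⟩
  simp only [Finset.mem_insert, Finset.mem_singleton, not_or] at hx hy
  have hf : IsFlag K v x y := ⟨hx, hy.2, hy.1, by rw [insert_pair_comm']; exact hc.2.1 _ ht⟩
  refine ⟨v, x, y, hf, (Finset.eq_of_subset_of_card_le ?_ (by rw [h3, hf.card_flag])).symm⟩
  intro a ha'
  simp only [flag, Finset.mem_insert, Finset.mem_singleton] at ha'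
  rcases ha' with rfl | rfl | rfl
  · exact ha
  · rwa [Finset.pair_comm]
  · rwa [insert_pair_comm']

/-- The shapes of chains with two elements. -/
lemma IsSimplePolyhedron.chain_two (hX : IsSimplePolyhedron K) {c : Finset (Finset V)}
    (hc : c ∈ (sd K).faces) (h2 : c.card = 2) :
    (∃ v x, x ≠ v ∧ c = {{v}, {v, x}}) ∨ (∃ v t, v ∈ t ∧ t.card = 3 ∧ c = {{v}, t}) ∨
      ∃ e t, e.card = 2 ∧ e ⊆ t ∧ t.card = 3 ∧ c = {e, t} := by
  have key : ∀ a b : Finset V, c = {a, b} → a.card < b.card →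
    (∃ v x, x ≠ v ∧ c = {{v}, {v, x}}) ∨ (∃ v t, v ∈ t ∧ t.card = 3 ∧ c = {{v}, t}) ∨
      ∃ e t, e.card = 2 ∧ e ⊆ t ∧ t.card = 3 ∧ c = {e, t} := by
    intro a b hab hlt
    have ha : a ∈ c := hab ▸ by simp
    have hb : b ∈ c := hab ▸ by simp
    have hsub := subset_of_card_lt (hc.2.2 a ha b hb) hlt
    have h1 := Finset.card_pos.2 (face_nonempty (hc.2.1 a ha))
    have h3 := hX.card_le (hc.2.1 b hb)
    by_cases ha1 : a.card = 1
    · obtain ⟨v, rfl⟩ := Finset.card_eq_one.1 ha1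
      by_cases hb2 : b.card = 2
      · obtain ⟨x, hx, rfl⟩ := Finset.exists_eq_insert_iff.2 ⟨hsub, by rw [ha1, hb2]⟩
        exact Or.inl ⟨v, x, by simpa using hx, by rw [hab, Finset.pair_comm x v]⟩
      · exact Or.inr (Or.inl ⟨v, b, hsub (by simp), by omega, hab⟩)
    · exact Or.inr (Or.inr ⟨a, b, by omega, hsub, by omega, hab⟩)
  obtain ⟨a, b, hne, hab⟩ := Finset.card_eq_two.1 h2
  have hcard := card_ne_of_comparable (hc.2.2 a (hab ▸ by simp) b (hab ▸ by simp)) hne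
  rcases lt_or_gt_of_ne hcard with h | h
  · exact key a b hab h
  · exact key b a (by rw [hab, Finset.pair_comm]) h

/-- The two-element subchains of a flag. -/
lemma IsFlag.subset_iff {v x y : V} (h : IsFlag K v x y) {d : Finset (Finset V)} (hd : d.card = 2) :
    d ⊆ flag v x y ↔ d = {{v}, {v, x}} ∨ d = {{v}, insert y {v, x}} ∨
      d = {{v, x}, insert y {v, x}} := by
  have h3 := h.card
  have h2 : ({v, x} : Finset V).card = 2 := Finset.card_pair h.1.symm
  have h1 : ({v} : Finset V).card = 1 := Finset.card_singleton v
  have n12 : ({v} : Finset V) ≠ {v, x} := fun heq => by rw [heq] at h1; omega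
  have n13 : ({v} : Finset V) ≠ insert y {v, x} := fun heq => by rw [heq] at h1; omega
  have n23 : ({v, x} : Finset V) ≠ insert y {v, x} := fun heq => by rw [heq] at h2; omega
  constructor
  · intro hsub
    obtain ⟨σ, hσ, heq⟩ := Finset.exists_eq_insert_iff.2 ⟨hsub, by rw [hd, h.card_flag]⟩
    have hde : d = (flag v x y).erase σ := by rw [← heq, Finset.erase_insert hσ]
    have hmem : σ ∈ flag v x y := heq ▸ Finset.mem_insert_self _ _
    simp only [flag, Finset.mem_insert, Finset.mem_singleton] at hmem
    rcases hmem with rfl | rfl | rfl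
    · right; right
      rw [hde, flag]
      ext a
      simp only [Finset.mem_erase, Finset.mem_insert, Finset.mem_singleton]
      constructor
      · rintro ⟨h1, h2 | h2 | h2⟩
        exacts [absurd h2 h1, Or.inl h2, Or.inr h2]
      · rintro (rfl | rfl)
        exacts [⟨n12.symm, Or.inr (Or.inl rfl)⟩, ⟨n13.symm, Or.inr (Or.inr rfl)⟩]
    · right; left
      rw [hde, flag]
      ext a
      simp only [Finset.mem_erase, Finset.mem_insert, Finset.mem_singleton]
      constructor
      · rintro ⟨h1, h2 | h2 | h2⟩
        exacts [Or.inl h2, absurd h2 h1, Or.inr h2]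
      · rintro (rfl | rfl)
        exacts [⟨n12, Or.inl rfl⟩, ⟨n23.symm, Or.inr (Or.inr rfl)⟩]
    · left
      rw [hde, flag]
      ext a
      simp only [Finset.mem_erase, Finset.mem_insert, Finset.mem_singleton]
      constructor
      · rintro ⟨h1, h2 | h2 | h2⟩
        exacts [Or.inl h2, Or.inr h2, absurd h2 h1]
      · rintro (rfl | rfl)
        exacts [⟨n13, Or.inl rfl⟩, ⟨n23, Or.inr (Or.inl rfl)⟩]
  · rintro (rfl | rfl | rfl) <;> intro a ha <;>
    simp only [flag, Finset.mem_insert, Finset.mem_singleton] at ha ⊢ <;> tauto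

end Chains
end SimplePoly

namespace SimplePoly

/-! ### The regular neighbourhood and its boundary curves -/

section Neighbourhood

variable {V : Type} [DecidableEq V] {K : PreAbstractSimplicialComplex V} {T : Set (Finset V)}

lemma finite_sd (h : K.faces.Finite) : (sd K).faces.Finite := by
  refine (h.toFinset.powerset.finite_toSet).subset fun c hc => ?_
  rw [Finset.mem_coe, Finset.mem_powerset]
  exact fun a ha => h.mem_toFinset.2 (hc.2.1 a ha)

lemma nbd_union : nbd K T ∪ nbdCompl K T = (sd K).faces := by
  ext c
  constructor
  · rintro (h | h) <;> exact h.1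
  · intro h
    obtain ⟨σ, hσ⟩ := h.1
    by_cases hT : σ ∈ T
    · exact Or.inl ⟨h, σ, hσ, hT⟩
    · exact Or.inr ⟨h, σ, hσ, hT⟩

lemma nbd_upClosed {X : Set (Finset (Finset V))} (h1 : nbd K T ⊆ X) (h2 : X ⊆ (sd K).faces) :
    IsUpClosed (nbd K T) X :=
  ⟨h1, fun _ hc _ hd hcd => ⟨h2 hd, let ⟨σ, hσ, hT⟩ := hc.2; ⟨σ, hcd hσ, hT⟩⟩⟩

lemma nbdCompl_upClosed {X : Set (Finset (Finset V))} (h1 : nbdCompl K T ⊆ X)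
    (h2 : X ⊆ (sd K).faces) : IsUpClosed (nbdCompl K T) X :=
  ⟨h1, fun _ hc _ hd hcd => ⟨h2 hd, let ⟨σ, hσ, hT⟩ := hc.2; ⟨σ, hcd hσ, hT⟩⟩⟩

lemma mem_nbdBoundary {c : Finset (Finset V)} : c ∈ nbdBoundary K T ↔
    c ∈ (sd K).faces ∧ (∃ σ ∈ c, σ ∈ T) ∧ ∃ σ ∈ c, σ ∉ T :=
  ⟨fun h => ⟨h.1.1, h.1.2, h.2.2⟩, fun h => ⟨⟨h.1, h.2.1⟩, h.1, h.2.2⟩⟩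

lemma nbdBoundary_up {c d : Finset (Finset V)} (hc : c ∈ nbdBoundary K T) (hd : d ∈ (sd K).faces)
    (h : c ⊆ d) : d ∈ nbdBoundary K T := by
  rw [mem_nbdBoundary] at hc ⊢
  obtain ⟨-, ⟨σ, hσ, h1⟩, ⟨τ, hτ, h2⟩⟩ := hc
  exact ⟨hd, ⟨σ, h hσ, h1⟩, ⟨τ, h hτ, h2⟩⟩

lemma two_le_card_of_mem {c : Finset (Finset V)} (hc : c ∈ nbdBoundary K T) : 2 ≤ c.card := by
  obtain ⟨-, ⟨σ, hσ, h1⟩, ⟨τ, hτ, h2⟩⟩ := mem_nbdBoundary.1 hc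
  exact Finset.one_lt_card.2 ⟨σ, hσ, τ, hτ, fun h => h2 (h ▸ h1)⟩

/-- An element of the boundary is a chain with members inside and outside `T`, so it has at least
two elements, and at most three by dimension. This leaves no room for three-term chains. -/
lemma isGraphPoset_nbdBoundary (hX : IsSimplePolyhedron K) : IsGraphPoset (nbdBoundary K T) := by
  intro x hx y hy z hz hxy hyz
  have h1 := two_le_card_of_mem hx
  have h2 := Finset.card_lt_card hxy
  have h3 := Finset.card_lt_card hyz
  have h4 := hX.chain_card_le (mem_nbdBoundary.1 hz).1
  omega

lemma nbrs_of_card_two (hX : IsSimplePolyhedron K) {c : Finset (Finset V)}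
    (hc : c ∈ nbdBoundary K T) (h2 : c.card = 2) :
    nbrs (nbdBoundary K T) c = (fun σ => insert σ c) '' completions K c := by
  ext d
  constructor
  · rintro ⟨hd, h | h⟩
    · have h3 := hX.chain_card_le (mem_nbdBoundary.1 hd).1
      have h4 := Finset.card_lt_card h
      obtain ⟨σ, hσ, rfl⟩ := Finset.exists_eq_insert_iff.2 ⟨h.subset, by omega⟩
      exact ⟨σ, ⟨hσ, (mem_nbdBoundary.1 hd).1⟩, rfl⟩
    · have h3 := two_le_card_of_mem hd
      have h4 := Finset.card_lt_card h
      omega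
  · rintro ⟨σ, ⟨hσ, hd⟩, rfl⟩
    exact ⟨nbdBoundary_up hc hd (Finset.subset_insert _ _),
      Or.inl (Finset.ssubset_insert hσ)⟩

lemma insert_injOn (c : Finset (Finset V)) :
    Set.InjOn (fun σ => insert σ c) (completions K c) := by
  intro σ hσ τ hτ h
  have : σ ∈ insert τ c := (show insert σ c = insert τ c from h) ▸ Finset.mem_insert_self _ _
  exact (Finset.mem_insert.1 this).resolve_right hσ.1

lemma IsSingularPart.flag_vertex (hT : IsSingularPart K T) (hX : IsSimplePolyhedron K) {v x y : V}
    (hc : flag v x y ∈ nbdBoundary K T) : {v} ∈ T := by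
  obtain ⟨σ, hσ, h1⟩ := (mem_nbdBoundary.1 hc).2.1
  refine hT.down hX h1 ?_ (by simp)
  simp only [flag, Finset.mem_insert, Finset.mem_singleton] at hσ
  rcases hσ with rfl | rfl | rfl <;> simp

lemma IsSingularPart.triangle_notMem (hT : IsSingularPart K T) (hX : IsSimplePolyhedron K)
    {t : Finset V} (ht : t.card = 3) : t ∉ T := fun h => by
  have := hT.card_le hX h
  omega

lemma IsSingularPart.flag_mem (hT : IsSingularPart K T) (hX : IsSimplePolyhedron K) {v x y : V}
    (h : IsFlag K v x y) (hv : {v} ∈ T) : flag v x y ∈ nbdBoundary K T :=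
  mem_nbdBoundary.2 ⟨h.mem_sd, ⟨{v}, by simp [flag], hv⟩, ⟨insert y {v, x}, by simp [flag],
    hT.triangle_notMem hX h.card⟩⟩

lemma IsSingularPart.vt_mem (hT : IsSingularPart K T) (hX : IsSimplePolyhedron K) {v x y : V}
    (h : IsFlag K v x y) (hv : {v} ∈ T) : {{v}, insert y {v, x}} ∈ nbdBoundary K T :=
  mem_nbdBoundary.2 ⟨sd_mono h.mem_sd (by
    intro a ha
    simp only [flag, Finset.mem_insert, Finset.mem_singleton] at ha ⊢
    tauto) (by simp), ⟨{v}, by simp, hv⟩, ⟨insert y {v, x}, by simp,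
    hT.triangle_notMem hX h.card⟩⟩

/-- The vertex is in `T` and the triangle is not. Of the three two-element subchains exactly one
fails to straddle `T`, and the middle edge decides which. -/
lemma IsSingularPart.nbrs_flag (hT : IsSingularPart K T) (hX : IsSimplePolyhedron K) {v x y : V}
    (h : IsFlag K v x y) (hv : {v} ∈ T) :
    nbrs (nbdBoundary K T) (flag v x y) = {d | d = {{v}, insert y {v, x}} ∨
      ({v, x} ∈ T ∧ d = {{v, x}, insert y {v, x}}) ∨ ({v, x} ∉ T ∧ d = {{v}, {v, x}})} := by
  have hc := hT.flag_mem hX h hv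
  have hvt := hT.vt_mem hX h hv
  have ht := hT.triangle_notMem hX h.card
  have c3 := h.card
  have c2 : ({v, x} : Finset V).card = 2 := Finset.card_pair h.1.symm
  have c1 : ({v} : Finset V).card = 1 := Finset.card_singleton v
  have hlt : ∀ {d : Finset (Finset V)}, d.card = 2 → d ⊆ flag v x y → d < flag v x y := by
    intro d hd hsub
    refine lt_of_le_of_ne hsub fun heq => ?_
    rw [heq, h.card_flag] at hd
    omega
  have n12 : ({v} : Finset V) ≠ {v, x} := fun heq => by rw [heq] at c1; omega
  have n13 : ({v} : Finset V) ≠ insert y {v, x} := fun heq => by rw [heq] at c1; omega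
  have n23 : ({v, x} : Finset V) ≠ insert y {v, x} := fun heq => by rw [heq] at c2; omega
  ext d
  constructor
  · rintro ⟨hd, hlt' | hlt'⟩
    · have h3 := hX.chain_card_le (mem_nbdBoundary.1 hd).1
      have h4 := Finset.card_lt_card hlt'
      rw [h.card_flag] at h4
      omega
    · have h3 := two_le_card_of_mem hd
      have h4 := Finset.card_lt_card hlt'
      rw [h.card_flag] at h4
      obtain ⟨-, ⟨σ, hσ, hσT⟩, ⟨τ, hτ, hτT⟩⟩ := mem_nbdBoundary.1 hd
      rcases (h.subset_iff (show d.card = 2 by omega)).1 hlt'.subset with rfl | rfl | rfl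
      · refine Or.inr (Or.inr ⟨?_, rfl⟩)
        simp only [Finset.mem_insert, Finset.mem_singleton] at hτ
        rcases hτ with rfl | rfl
        exacts [absurd hv hτT, hτT]
      · exact Or.inl rfl
      · refine Or.inr (Or.inl ⟨?_, rfl⟩)
        simp only [Finset.mem_insert, Finset.mem_singleton] at hσ
        rcases hσ with rfl | rfl
        exacts [hσT, absurd hσT ht]
  · have hmem : ∀ d : Finset (Finset V), d ⊆ flag v x y → d.Nonempty → d ∈ (sd K).faces :=
      fun d hd hne => sd_mono h.mem_sd hd hne
    rintro (rfl | ⟨he, rfl⟩ | ⟨he, rfl⟩)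
    · have := (h.subset_iff (Finset.card_pair n13)).2 (Or.inr (Or.inl rfl))
      exact ⟨hvt, Or.inr (hlt (Finset.card_pair n13) this)⟩
    · have := (h.subset_iff (Finset.card_pair n23)).2 (Or.inr (Or.inr rfl))
      exact ⟨mem_nbdBoundary.2 ⟨hmem _ this (by simp), ⟨_, by simp, he⟩, ⟨_, by simp, ht⟩⟩,
        Or.inr (hlt (Finset.card_pair n23) this)⟩
    · have := (h.subset_iff (Finset.card_pair n12)).2 (Or.inl rfl)
      exact ⟨mem_nbdBoundary.2 ⟨hmem _ this (by simp), ⟨_, by simp, hv⟩, ⟨_, by simp, he⟩⟩,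
        Or.inr (hlt (Finset.card_pair n12) this)⟩

lemma pair_ne_of_mem {a b c d : Finset V} (h : a ≠ c) (h' : a ≠ d) :
    ({a, b} : Finset (Finset V)) ≠ {c, d} := fun heq => by
  have : a ∈ ({c, d} : Finset (Finset V)) := heq ▸ by simp
  simp only [Finset.mem_insert, Finset.mem_singleton] at this
  tauto

/-- Two-element chains have two completions; for a vertex in an edge this is `cofaces_eq_two`, as
the edge must lie outside `T`. A flag has two neighbours by `nbrs_flag`. -/
lemma IsSingularPart.isRegularPoset (hT : IsSingularPart K T) (hX : IsSimplePolyhedron K) :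
    IsRegularPoset (nbdBoundary K T) := by
  refine ⟨isGraphPoset_nbdBoundary hX, fun c hc => ?_⟩
  have hcK := (mem_nbdBoundary.1 hc).1
  have h2 := two_le_card_of_mem hc
  have h3 := hX.chain_card_le hcK
  by_cases hcard : c.card = 2
  · rw [nbrs_of_card_two hX hc hcard, Set.InjOn.ncard_image (insert_injOn c)]
    rcases hX.chain_two hcK hcard with ⟨v, x, hne, rfl⟩ | ⟨v, t, hv, ht, rfl⟩ |
      ⟨e, t, he, het, ht, rfl⟩
    · rw [(ncard_completions_ve hX hne hcK).2]
      obtain ⟨-, ⟨σ, hσ, hσT⟩, ⟨τ, hτ, hτT⟩⟩ := mem_nbdBoundary.1 hc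
      have hvT : {v} ∈ T := by
        refine hT.down hX hσT ?_ (by simp)
        simp only [Finset.mem_insert, Finset.mem_singleton] at hσ
        rcases hσ with rfl | rfl <;> simp
      refine hT.cofaces_eq_two hX hvT hne (hcK.2.1 _ (by simp)) ?_
      simp only [Finset.mem_insert, Finset.mem_singleton] at hτ
      rcases hτ with rfl | rfl
      exacts [absurd hvT hτT, hτT]
    · exact (ncard_completions_vt hX hv ht hcK).2
    · exact (ncard_completions_et hX he het ht hcK).2
  · obtain ⟨v, x, y, h, rfl⟩ := hX.exists_flag hcK (by omega)
    rw [hT.nbrs_flag hX h (hT.flag_vertex hX hc)]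
    have c3 := h.card
    have c2 : ({v, x} : Finset V).card = 2 := Finset.card_pair h.1.symm
    have c1 : ({v} : Finset V).card = 1 := Finset.card_singleton v
    have n12 : ({v} : Finset V) ≠ {v, x} := fun heq => by rw [heq] at c1; omega
    have n13 : ({v} : Finset V) ≠ insert y {v, x} := fun heq => by rw [heq] at c1; omega
    have n23 : ({v, x} : Finset V) ≠ insert y {v, x} := fun heq => by rw [heq] at c2; omega
    by_cases he : {v, x} ∈ T
    · rw [← Set.ncard_pair (pair_ne_of_mem (b := insert y {v, x}) n12 n13)]
      congr 1
      ext d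
      simp [he]
    · have hne : ({{v}, insert y {v, x}} : Finset (Finset V)) ≠ {{v}, {v, x}} := by
        rw [Finset.pair_comm]
        exact pair_ne_of_mem n13.symm n23.symm
      rw [← Set.ncard_pair hne]
      congr 1
      ext d
      simp [he]

/-! ### The neighbourhood retracts to the singular part -/

lemma chainsIn_subset (hT : IsSingularPart K T) : (orderComplex T).faces ⊆ nbd K T := fun _ hc =>
  ⟨⟨hc.1, fun a ha => hT.mem_faces (hc.2.1 a ha), hc.2.2⟩,
    let ⟨σ, hσ⟩ := hc.1; ⟨σ, hσ, hc.2.1 σ hσ⟩⟩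

open Classical in
/-- The part of a chain in a given set. -/
noncomputable def chainPart (T : Set (Finset V)) (c : Finset (Finset V)) : Finset (Finset V) :=
  c.filter (· ∈ T)

lemma mem_chainPart {c : Finset (Finset V)} {σ : Finset V} :
    σ ∈ chainPart T c ↔ σ ∈ c ∧ σ ∈ T := by simp [chainPart]

lemma chainPart_subset (c : Finset (Finset V)) : chainPart T c ⊆ c := fun _ h => (mem_chainPart.1 h).1

lemma chainPart_mono {c d : Finset (Finset V)} (h : c ⊆ d) : chainPart T c ⊆ chainPart T d :=
  fun _ h' => mem_chainPart.2 ⟨h (mem_chainPart.1 h').1, (mem_chainPart.1 h').2⟩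

lemma chainPart_mem {c : Finset (Finset V)} (hc : c ∈ nbd K T) :
    chainPart T c ∈ (orderComplex T).faces := by
  obtain ⟨σ, hσ, hσT⟩ := hc.2
  exact ⟨⟨σ, mem_chainPart.2 ⟨hσ, hσT⟩⟩, fun a ha => (mem_chainPart.1 ha).2,
    fun a ha b hb => hc.1.2.2 a (chainPart_subset c ha) b (chainPart_subset c hb)⟩

lemma chainPart_id {c : Finset (Finset V)} (hc : c ∈ (orderComplex T).faces) :
    chainPart T c = c := Finset.Subset.antisymm (chainPart_subset c) fun a ha =>
  mem_chainPart.2 ⟨ha, hc.2.1 a ha⟩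

lemma h0_eq_of_retract {α : Type} [PartialOrder α] {S N : Set α} (hSN : S ⊆ N) (r : α → α)
    (hr : ∀ x ∈ N, r x ∈ S) (hmono : ∀ x ∈ N, ∀ y ∈ N, x ≤ y → r x ≤ r y)
    (hle : ∀ x ∈ N, r x ≤ x) (hid : ∀ x ∈ S, r x = x) : h0 N = h0 S := by
  refine Nat.card_congr
    { toFun := Quot.map (fun x : N => (⟨r x, hr x x.2⟩ : S)) fun x y h => hmono x x.2 y y.2 h
      invFun := compMap hSN
      left_inv := ?_
      right_inv := ?_ }
  · rintro ⟨x⟩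
    exact Quot.sound (hle x x.2)
  · rintro ⟨x⟩
    exact congr_arg (Quot.mk _) (Subtype.ext (hid x x.2))

lemma IsSingularPart.chain_card (hT : IsSingularPart K T) (hX : IsSimplePolyhedron K)
    {c : Finset (Finset V)} (hc : c ∈ (orderComplex T).faces) : c.card ≤ 2 := by
  have hcN := (chainsIn_subset hT hc).1
  by_contra hcon
  obtain ⟨v, x, y, h, rfl⟩ := hX.exists_flag hcN (by have := hX.chain_card_le hcN; omega)
  exact hT.triangle_notMem hX h.card (hc.2.1 _ (by simp [flag]))

lemma IsSingularPart.isGraphPoset_chains (hT : IsSingularPart K T) (hX : IsSimplePolyhedron K) :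
    IsGraphPoset (orderComplex T).faces := by
  intro x hx y hy z hz hxy hyz
  have h1 := Finset.card_pos.2 hx.1
  have h2 := Finset.card_lt_card hxy
  have h3 := Finset.card_lt_card hyz
  have h4 := hT.chain_card hX hz
  omega

lemma IsSingularPart.chain_shape (hT : IsSingularPart K T) (hX : IsSimplePolyhedron K)
    {c : Finset (Finset V)} (hc : c ∈ (orderComplex T).faces) :
    (∃ v, {v} ∈ T ∧ c = {{v}}) ∨ (∃ e ∈ T, e.card = 2 ∧ c = {e}) ∨
      ∃ v x, x ≠ v ∧ {v} ∈ T ∧ {v, x} ∈ T ∧ c = {{v}, {v, x}} := by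
  have h2 := hT.chain_card hX hc
  have h1 := Finset.card_pos.2 hc.1
  have hcN := (chainsIn_subset hT hc).1
  by_cases hcard : c.card = 1
  · obtain ⟨σ, rfl⟩ := Finset.card_eq_one.1 hcard
    have hσ := hc.2.1 σ (by simp)
    have h3 := hT.card_le hX hσ
    have h4 := Finset.card_pos.2 (face_nonempty (hT.mem_faces hσ))
    by_cases h5 : σ.card = 1
    · obtain ⟨v, rfl⟩ := Finset.card_eq_one.1 h5
      exact Or.inl ⟨v, hσ, rfl⟩
    · exact Or.inr (Or.inl ⟨σ, hσ, by omega, rfl⟩)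
  · rcases hX.chain_two hcN (by omega) with ⟨v, x, hne, rfl⟩ | ⟨v, t, hv, ht, rfl⟩ |
      ⟨e, t, he, het, ht, rfl⟩
    · exact Or.inr (Or.inr ⟨v, x, hne, hc.2.1 _ (by simp), hc.2.1 _ (by simp), rfl⟩)
    · exact absurd (hc.2.1 t (by simp)) (hT.triangle_notMem hX ht)
    · exact absurd (hc.2.1 t (by simp)) (hT.triangle_notMem hX ht)

lemma chain_ve_mem {v x : V} (hv : {v} ∈ T) (he : {v, x} ∈ T) :
    {{v}, {v, x}} ∈ (orderComplex T).faces := by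
  refine ⟨by simp, by simp [hv, he], ?_⟩
  intro a ha b hb
  simp only [Finset.mem_insert, Finset.mem_singleton] at ha hb
  rcases ha with rfl | rfl <;> rcases hb with rfl | rfl <;> simp

lemma chain_single_mem {σ : Finset V} (h : σ ∈ T) : {σ} ∈ (orderComplex T).faces :=
  ⟨by simp, by simpa using h, by simp⟩

lemma chain_ve_card {v x : V} (hne : x ≠ v) : ({{v}, {v, x}} : Finset (Finset V)).card = 2 :=
  Finset.card_pair fun h => by
    have := congr_arg Finset.card h
    rw [Finset.card_singleton, Finset.card_pair hne.symm] at this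
    omega

lemma IsSingularPart.nbrs_vertex (hT : IsSingularPart K T) (hX : IsSimplePolyhedron K) {v : V}
    (hv : {v} ∈ T) : nbrs (orderComplex T).faces {{v}} =
      (fun x => {{v}, {v, x}}) '' {x | x ≠ v ∧ {v, x} ∈ T} := by
  ext c
  constructor
  · rintro ⟨hc, h | h⟩
    · rcases hT.chain_shape hX hc with ⟨w, hw, rfl⟩ | ⟨e, he, he2, rfl⟩ | ⟨w, x, hne, hw, he, rfl⟩
      · have := Finset.card_lt_card h; simp at this
      · have := Finset.card_lt_card h; simp at this
      · have h1 : ({v} : Finset V) ∈ ({{w}, {w, x}} : Finset (Finset V)) := h.subset (by simp)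
        simp only [Finset.mem_insert, Finset.mem_singleton] at h1
        rcases h1 with h1 | h1
        · obtain rfl := Finset.singleton_injective h1
          exact ⟨x, ⟨hne, he⟩, rfl⟩
        · have := congr_arg Finset.card h1
          rw [Finset.card_singleton, Finset.card_pair hne.symm] at this
          omega
    · have h1 := Finset.card_lt_card h
      have h2 := Finset.card_pos.2 hc.1
      rw [Finset.card_singleton] at h1
      omega
  · rintro ⟨x, ⟨hne, he⟩, rfl⟩
    refine ⟨chain_ve_mem hv he, Or.inl (lt_of_le_of_ne (by simp) fun h => ?_)⟩
    have := congr_arg Finset.card h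
    rw [chain_ve_card hne, Finset.card_singleton] at this
    omega

lemma IsSingularPart.ncard_nbrs_vertex (hT : IsSingularPart K T) (hX : IsSimplePolyhedron K) {v : V}
    (hv : {v} ∈ T) :
    (nbrs (orderComplex T).faces {{v}}).ncard = {x | x ≠ v ∧ {v, x} ∈ T}.ncard := by
  rw [hT.nbrs_vertex hX hv, Set.InjOn.ncard_image]
  intro x hx y hy h
  have h1 : ({v, x} : Finset V) ∈ ({{v}, {v, y}} : Finset (Finset V)) :=
    (show ({{v}, {v, x}} : Finset (Finset V)) = {{v}, {v, y}} from h) ▸ by simp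
  simp only [Finset.mem_insert, Finset.mem_singleton] at h1
  rcases h1 with h1 | h1
  · have := congr_arg Finset.card h1
    rw [Finset.card_singleton, Finset.card_pair hx.1.symm] at this
    omega
  · have : x ∈ ({v, y} : Finset V) := h1 ▸ by simp
    simp only [Finset.mem_insert, Finset.mem_singleton] at this
    exact this.resolve_left hx.1

lemma IsSingularPart.ncard_nbrs_edge (hT : IsSingularPart K T) (hX : IsSimplePolyhedron K)
    {e : Finset V} (he : e ∈ T) (h2 : e.card = 2) :
    (nbrs (orderComplex T).faces {e}).ncard = 2 := by
  have : nbrs (orderComplex T).faces {e} = (fun v => {{v}, e}) '' (e : Set V) := by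
    ext c
    constructor
    · rintro ⟨hc, h | h⟩
      · rcases hT.chain_shape hX hc with ⟨w, hw, rfl⟩ | ⟨e, he, he2, rfl⟩ | ⟨w, x, hne, hw, he, rfl⟩
        · have := Finset.card_lt_card h; simp at this
        · have := Finset.card_lt_card h; simp at this
        · have h1 : e ∈ ({{w}, {w, x}} : Finset (Finset V)) := h.subset (by simp)
          simp only [Finset.mem_insert, Finset.mem_singleton] at h1
          rcases h1 with rfl | rfl
          · simp at h2
          · exact ⟨w, by simp, rfl⟩
      · have h1 := Finset.card_lt_card h
        have h2 := Finset.card_pos.2 hc.1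
        rw [Finset.card_singleton] at h1
        omega
    · rintro ⟨v, hv, rfl⟩
      obtain ⟨x, hx, hxe⟩ := Finset.exists_eq_insert_iff.2
        ⟨(Finset.singleton_subset_iff.2 hv : {v} ⊆ e), by rw [Finset.card_singleton, h2]⟩
      rw [Finset.pair_comm] at hxe
      subst hxe
      have hne : x ≠ v := by simpa using hx
      refine ⟨chain_ve_mem (hT.vertex_mem hX hne he) he, Or.inl (lt_of_le_of_ne (by simp)
        fun h => ?_)⟩
      have := congr_arg Finset.card h
      rw [chain_ve_card hne, Finset.card_singleton] at this
      omega
  rw [this, Set.InjOn.ncard_image, Set.ncard_coe_finset, h2]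
  intro x hx y hy h
  have h1 : ({x} : Finset V) ∈ ({{y}, e} : Finset (Finset V)) :=
    (show ({{x}, e} : Finset (Finset V)) = {{y}, e} from h) ▸ by simp
  simp only [Finset.mem_insert, Finset.mem_singleton] at h1
  rcases h1 with h1 | h1
  · exact Finset.singleton_injective h1
  · rw [← h1] at h2
    simp at h2

lemma IsSingularPart.ncard_nbrs_ve (hT : IsSingularPart K T) (hX : IsSimplePolyhedron K)
    {v x : V} (hne : x ≠ v) (hv : {v} ∈ T) (he : {v, x} ∈ T) :
    (nbrs (orderComplex T).faces {{v}, {v, x}}).ncard = 2 := by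
  have hcard := chain_ve_card (V := V) hne
  have n12 : ({{v}} : Finset (Finset V)) ≠ {{v, x}} := fun h => by
    have := congr_arg Finset.card (Finset.singleton_injective h)
    rw [Finset.card_singleton, Finset.card_pair hne.symm] at this
    omega
  rw [← Set.ncard_pair n12]
  congr 1
  ext c
  simp only [Set.mem_insert_iff, Set.mem_singleton_iff]
  constructor
  · rintro ⟨hc, h | h⟩
    · have h1 := Finset.card_lt_card h
      have h2 := hT.chain_card hX hc
      omega
    · have h1 := Finset.card_lt_card h
      have h2 := Finset.card_pos.2 hc.1
      obtain ⟨σ, rfl⟩ := Finset.card_eq_one.1 (show c.card = 1 by omega)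
      have h3 := h.subset (Finset.mem_singleton_self σ)
      simp only [Finset.mem_insert, Finset.mem_singleton] at h3
      exact h3.imp (congr_arg _) (congr_arg _)
  · have hlt : ∀ σ ∈ ({{v}, {v, x}} : Finset (Finset V)), {σ} < ({{v}, {v, x}} : Finset (Finset V)) :=
      fun σ hσ => lt_of_le_of_ne (by simpa using hσ) fun h => by
        have := congr_arg Finset.card h
        rw [hcard, Finset.card_singleton] at this
        omega
    rintro (rfl | rfl)
    · exact ⟨chain_single_mem hv, Or.inr (hlt _ (by simp))⟩
    · exact ⟨chain_single_mem he, Or.inr (hlt _ (by simp))⟩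

/-- The first cohomology of the neighbourhood counts the components and the true vertices. -/
lemma IsSingularPart.h1_nbd (F : Type) [Field F] (hT : IsSingularPart K T)
    (hX : IsSimplePolyhedron K) :
    h1 F (nbd K T) = h0 (nbd K T) + {v ∈ trueVertices K | {v} ∈ T}.ncard := by
  have hfin : (nbd K T).Finite := (finite_sd hX.1).subset fun _ h => h.1
  have : Finite (nbd K T) := hfin
  have hfin' : (orderComplex T).faces.Finite := hfin.subset (chainsIn_subset hT)
  have : Finite (orderComplex T).faces := hfin'
  have hr : ∀ c ∈ nbd K T, chainPart T c ∈ (orderComplex T).faces := fun c hc => chainPart_mem hc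
  -- Keeping only the members in `T` retracts the neighbourhood downwards onto the chains in `T`,
  -- the subdivided singular graph. There the chains `{{v}}` at true vertices have valence four and
  -- all others valence two.
  rw [h1_eq_of_retract (chainsIn_subset hT) (chainPart T) hr (fun _ _ _ _ h => chainPart_mono h)
    (fun c _ => chainPart_subset c) fun c hc => chainPart_id hc,
    h0_eq_of_retract (chainsIn_subset hT) (chainPart T) hr (fun _ _ _ _ h => chainPart_mono h)
    (fun c _ => chainPart_subset c) fun c hc => chainPart_id hc]
  have hinj : Function.Injective fun v : V => ({{v}} : Finset (Finset V)) := fun v w h =>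
    Finset.singleton_injective (Finset.singleton_injective h)
  rw [(hT.isGraphPoset_chains hX).h1_eq_add F (W := (fun v => {{v}}) ''
    {v ∈ trueVertices K | {v} ∈ T}), Set.ncard_image_of_injective _ hinj]
  · rintro _ ⟨v, hv, rfl⟩
    exact chain_single_mem hv.2
  · rintro _ ⟨v, hv, rfl⟩
    rw [hT.ncard_nbrs_vertex hX hv.2]
    exact (hT.vertex_deg hX hv.2).1 hv.1
  · intro c hc hnot
    rcases hT.chain_shape hX hc with ⟨w, hw, rfl⟩ | ⟨e, he, he2, rfl⟩ | ⟨w, x, hne, hw, he, rfl⟩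
    · rw [hT.ncard_nbrs_vertex hX hw]
      exact ((hT.vertex_deg hX hw).2 fun h => hnot ⟨w, ⟨h, hw⟩, rfl⟩).1
    · exact hT.ncard_nbrs_edge hX he he2
    · exact hT.ncard_nbrs_ve hX hne hw he

lemma nbd_connected (hsub : T ⊆ K.faces) (hT : IsConnectedSet T) : IsConnectedSet (nbd K T) := by
  have hone : ∀ σ ∈ T, ({σ} : Finset (Finset V)) ∈ nbd K T := fun σ hσ =>
    ⟨⟨by simp, by simpa using hsub hσ, by simp⟩, σ, by simp, hσ⟩
  obtain ⟨σ₀, h₀⟩ := hT.1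
  have key : ∀ τ, Relation.ReflTransGen (Step T) σ₀ τ → ∃ hτ : τ ∈ T,
      comp (hone σ₀ h₀) = comp (hone τ hτ) := by
    intro τ h
    induction h with
    | refl => exact ⟨h₀, rfl⟩
    | @tail b c _ h ih =>
      obtain ⟨hb, ih⟩ := ih
      refine ⟨h.1, ih.trans ?_⟩
      have hbc : ({b, c} : Finset (Finset V)) ∈ nbd K T := by
        refine ⟨⟨by simp, by simp [hsub hb, hsub h.1], ?_⟩, b, by simp, hb⟩
        intro x hx y hy
        simp only [Finset.mem_insert, Finset.mem_singleton] at hx hy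
        rcases hx with rfl | rfl <;> rcases hy with rfl | rfl
        exacts [Or.inl le_rfl, h.2, h.2.symm, Or.inl le_rfl]
      exact (comp_eq_of_comparable _ hbc (Or.inl (by simp))).trans
        (comp_eq_of_comparable _ _ (Or.inr (by simp)))
  have key2 : ∀ c (hc : c ∈ nbd K T), comp (hone σ₀ h₀) = comp hc := by
    intro c hc
    obtain ⟨σ, hσ, hσT⟩ := hc.2
    obtain ⟨_, h⟩ := key σ (hT.2 σ₀ h₀ σ hσT)
    exact h.trans (comp_eq_of_comparable _ _ (Or.inl (by simpa using hσ)))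
  refine isConnectedSet_iff.2 ⟨⟨_, hone σ₀ h₀⟩, ⟨?_⟩⟩
  rintro ⟨a⟩ ⟨b⟩
  exact (key2 a a.2).symm.trans (key2 b b.2)

end Neighbourhood
end SimplePoly

namespace SimplePoly

/-! ### The pieces of the complement and their homology -/

section Pieces

variable {V : Type} [DecidableEq V] {K : PreAbstractSimplicialComplex V} {T : Set (Finset V)}

/-- Acyclicity is given for the poset of faces, while the neighbourhood and its complement consist
of chains of faces, one subdivision further. -/
lemma isZero_sd (hfin : K.faces.Finite) (hac : IsAcyclic K.faces) {k : ℕ} (hk : 1 ≤ k) :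
    IsZero (homologyOf (sd K).faces k) :=
  isZero_homology_orderComplex hfin hk (hac.2 k hk)

lemma isCoboundary_sd {F : Type} [Field F] (hfin : K.faces.Finite) (hac : IsAcyclic K.faces)
    {φ : Finset (Finset V) → Finset (Finset V) → F} (h : IsCocycle (sd K).faces φ) :
    IsCoboundary (sd K).faces φ :=
  isCoboundary_of_isZero (isZero_sd hfin hac le_rfl) h

lemma sd_connected (h : IsConnectedSet K.faces) : IsConnectedSet (sd K).faces := by
  have h1 := nbd_connected le_rfl h
  have h2 : nbd K K.faces = (sd K).faces := by
    ext c
    refine ⟨fun h => h.1, fun h => ⟨h, ?_⟩⟩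
    obtain ⟨σ, hσ⟩ := h.1
    exact ⟨σ, hσ, h.2.1 σ hσ⟩
  rwa [h2] at h1

lemma chainCover_nbd : ChainCover (nbd K T) (nbdCompl K T) :=
  IsUpClosed.chainCover (nbd_upClosed Set.subset_union_left nbd_union.le)
    (nbdCompl_upClosed Set.subset_union_right nbd_union.le)

/-- Mayer-Vietoris in degree one for the neighbourhood and its complement. -/
lemma h1_nbdBoundary (F : Type) [Field F] (hfin : K.faces.Finite) (hac : IsAcyclic K.faces) :
    h1 F (nbdBoundary K T) = h1 F (nbd K T) + h1 F (nbdCompl K T) := by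
  have : Finite (nbd K T) := (finite_sd hfin).subset fun _ h => h.1
  have : Finite (nbdCompl K T) := (finite_sd hfin).subset fun _ h => h.1
  refine h1_inter F chainCover_nbd ?_ ?_ <;> rw [nbd_union]
  · exact isZero_sd hfin hac (by decide)
  · exact isZero_sd hfin hac le_rfl

/-- Mayer-Vietoris in degree zero for the neighbourhood and its complement. -/
lemma h0_nbdBoundary (hfin : K.faces.Finite) (hac : IsAcyclic K.faces)
    (hne : (nbdBoundary K T).Nonempty) :
    h0 (nbdBoundary K T) + 1 ≤ h0 (nbd K T) + h0 (nbdCompl K T) := by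
  have f1 : Finite (nbd K T) := (finite_sd hfin).subset fun _ h => h.1
  have f2 : Finite (nbdCompl K T) := (finite_sd hfin).subset fun _ h => h.1
  have f3 : Finite ↑(nbd K T ∩ nbdCompl K T) := (finite_sd hfin).subset fun _ h => h.1.1
  have h := finrank_LC_le (F := ℚ) (nbd_upClosed (K := K) (T := T) Set.subset_union_left nbd_union.le)
    (nbdCompl_upClosed (K := K) (T := T) Set.subset_union_right nbd_union.le)
    (fun φ hφ => by rw [nbd_union] at hφ ⊢; exact isCoboundary_sd hfin hac hφ) hne
  rwa [finrank_LC, finrank_LC, finrank_LC] at h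

/-- A cocycle on a union of components of the complement is a coboundary if this holds on the
boundary. -/
lemma isCoboundary_piece {F : Type} [Field F] (hfin : K.faces.Finite) (hac : IsAcyclic K.faces)
    {A : Set (Finset (Finset V))} (hA : A ⊆ nbdCompl K T) (hsep : IsSeparated A (nbdCompl K T \ A))
    {φ : Finset (Finset V) → Finset (Finset V) → F} (hφ : IsCocycle A φ)
    (h : IsCoboundary (A ∩ nbdBoundary K T) φ) : IsCoboundary A φ := by
  have hY : A ∪ nbdCompl K T \ A = nbdCompl K T := Set.union_sdiff_cancel hA
  -- The union `A` of pieces is glued to everything else, namely the neighbourhood together with the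
  -- other pieces. The two meet exactly in the boundary of `A`.
  have hU : A ∪ (nbd K T ∪ nbdCompl K T \ A) = (sd K).faces := by
    rw [Set.union_left_comm, hY, nbd_union]
  have hYup : IsUpClosed (nbdCompl K T) (sd K).faces :=
    nbdCompl_upClosed (fun _ h => h.1) le_rfl
  have hNup : IsUpClosed (nbd K T) (sd K).faces := nbd_upClosed (fun _ h => h.1) le_rfl
  have hlift : ∀ B, IsUpClosed B (nbdCompl K T) → IsUpClosed B (sd K).faces := fun B hB =>
    ⟨hB.1.trans hYup.1, fun x hx y hy hxy => hB.2 x hx y (hYup.2 x (hB.1 hx) y hy hxy) hxy⟩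
  have hA1 : IsUpClosed A (sd K).faces := hlift A (hY ▸ hsep.upClosed_left)
  have hA2 : IsUpClosed (nbdCompl K T \ A) (sd K).faces :=
    hlift _ (by
      have := hsep.upClosed_right
      rwa [hY] at this)
  have hB : IsUpClosed (nbd K T ∪ nbdCompl K T \ A) (sd K).faces := by
    refine ⟨Set.union_subset hNup.1 hA2.1, ?_⟩
    rintro x (hx | hx) y hy hxy
    exacts [Or.inl (hNup.2 x hx y hy hxy), Or.inr (hA2.2 x hx y hy hxy)]
  have hI : A ∩ (nbd K T ∪ nbdCompl K T \ A) = A ∩ nbdBoundary K T := by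
    ext x
    constructor
    · rintro ⟨hx, h | h⟩
      exacts [⟨hx, h, hA hx⟩, absurd hx h.2]
    · exact fun h => ⟨h.1, Or.inl h.2.1⟩
  refine isCoboundary_of_inter (B := nbd K T ∪ nbdCompl K T \ A) (by rwa [hU]) (by rwa [hU])
    (fun ψ hψ => by rw [hU] at hψ ⊢; exact isCoboundary_sd hfin hac hψ) hφ (by rwa [hI])

lemma h1_piece_le (F : Type) [Field F] (hfin : K.faces.Finite) (hac : IsAcyclic K.faces)
    {A : Set (Finset (Finset V))} (hA : A ⊆ nbdCompl K T)
    (hsep : IsSeparated A (nbdCompl K T \ A)) : h1 F A ≤ h1 F (A ∩ nbdBoundary K T : Set _) := by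
  have : Finite ↑(A ∩ nbdBoundary K T) := (finite_sd hfin).subset fun _ h => (hA h.1).1
  exact h1_le_of_restrict Set.inter_subset_left fun φ hφ h =>
    isCoboundary_piece hfin hac hA hsep hφ h

lemma IsSingularPart.nbdBoundary_nonempty (hT : IsSingularPart K T) (hX : IsSimplePolyhedron K)
    (hne : T.Nonempty) : (nbdBoundary K T).Nonempty := by
  obtain ⟨σ, hσ⟩ := hne
  obtain ⟨v, hv⟩ := face_nonempty (hT.mem_faces hσ)
  have hvT : {v} ∈ T := hT.down hX hσ (by simpa using hv) (by simp)
  obtain ⟨x, hx⟩ : {x | x ≠ v ∧ {v, x} ∈ T}.Nonempty := by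
    refine Set.nonempty_of_ncard_ne_zero ?_
    by_cases h : v ∈ trueVertices K
    · rw [(hT.vertex_deg hX hvT).1 h]; decide
    · rw [((hT.vertex_deg hX hvT).2 h).1]; decide
  obtain ⟨y, hy⟩ : (cofaces K {v, x}).Nonempty := by
    refine Set.nonempty_of_ncard_ne_zero ?_
    rw [hT.cofaces_eq_three hX (Finset.card_pair hx.1.symm) hx.2]
    decide
  exact ⟨_, hT.flag_mem hX ((isFlag_iff hx.1).2 hy) hvT⟩

/-- A component away from the boundary would be closed under comparability in the connected `sd K`,
hence all of it. But the chain `{σ}` with `σ ∈ T` is not in the complement. -/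
lemma component_meets_boundary (hX : IsSimplePolyhedron K) (hsub : T ⊆ K.faces) (hne : T.Nonempty)
    {C : Set (Finset (Finset V))} (hC : IsComponent C (nbdCompl K T)) :
    (C ∩ nbdBoundary K T).Nonempty := by
  by_contra hcon
  have hcl : ∀ a ∈ C, ∀ b ∈ (sd K).faces, (a ≤ b ∨ b ≤ a) → b ∈ C := by
    intro a ha b hb hab
    have haN : ∀ σ ∈ a, σ ∉ T := fun σ hσ hσT => hcon ⟨a, ha, ⟨(hC.1 ha).1, σ, hσ, hσT⟩, hC.1 ha⟩
    refine hC.2.2 a ha b ⟨hb, ?_⟩ hab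
    rcases hab with hab | hab
    · obtain ⟨σ, hσ, h⟩ := (hC.1 ha).2
      exact ⟨σ, hab hσ, h⟩
    · obtain ⟨σ, hσ⟩ := hb.1
      exact ⟨σ, hσ, haN σ (hab hσ)⟩
  have h := (sd_connected hX.2.1).eq_of_closed (hC.1.trans fun _ h => h.1) hC.2.1.1 hcl
  obtain ⟨σ, hσ⟩ := hne
  have h2 : ({σ} : Finset (Finset V)) ∈ C := by
    rw [h]
    exact ⟨by simp, by simpa using hsub hσ, by simp⟩
  obtain ⟨τ, hτ, h3⟩ := (hC.1 h2).2
  rw [Finset.mem_singleton] at hτ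
  exact h3 (hτ ▸ hσ)

/-- The components of the complement and those of the boundary of a connected neighbourhood. -/
lemma IsSingularPart.components (hT : IsSingularPart K T) (hX : IsSimplePolyhedron K)
    (hac : IsAcyclic K.faces) (hc : IsConnectedSet T) :
    (∀ C, IsComponent C (nbdCompl K T) → IsComponent (C ∩ nbdBoundary K T) (nbdBoundary K T)) ∧
      h0 (nbdBoundary K T) = h0 (nbdCompl K T) := by
  have hsub : T ⊆ K.faces := fun σ hσ => hT.mem_faces hσ
  have : Finite (nbdBoundary K T) := (finite_sd hX.1).subset fun _ h => h.1.1
  refine isComponent_inter Set.inter_subset_right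
    (fun C hC => component_meets_boundary hX hsub hc.1 hC) ?_
  -- As the neighbourhood is connected, this says that the boundary has at most as many components
  -- as the complement.
  have h := h0_nbdBoundary hX.1 hac (hT.nbdBoundary_nonempty hX hc.1)
  rw [h0_eq_one_iff.2 (nbd_connected hsub hc)] at h
  omega

lemma IsSingularPart.h1_component_le (F : Type) [Field F] (hT : IsSingularPart K T)
    (hX : IsSimplePolyhedron K) (hac : IsAcyclic K.faces) (hc : IsConnectedSet T)
    {C : Set (Finset (Finset V))} (hC : IsComponent C (nbdCompl K T)) : h1 F C ≤ 1 := by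
  have h := h1_piece_le F hX.1 hac hC.1 hC.isSeparated
  have h2 := (hT.components hX hac hc).1 C hC
  have : Finite ↑(C ∩ nbdBoundary K T) := (finite_sd hX.1).subset fun _ h => h.2.1.1
  rwa [((hT.isRegularPoset hX).component h2).h1_eq F, h0_eq_one_iff.2 h2.2.1] at h

/-- Integrally, the homology of `C` is a summand of that of the complement, which by Mayer-Vietoris
is a summand of that of the one-dimensional boundary. -/
lemma IsSingularPart.exists_embedding (hT : IsSingularPart K T) (hX : IsSimplePolyhedron K)
    (hac : IsAcyclic K.faces) {C : Set (Finset (Finset V))} (hC : IsComponent C (nbdCompl K T)) :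
    (∃ f : homologyOf C 1 →+ (Pairs (nbdBoundary K T) → ℤ), Function.Injective f) ∧
      ∀ k, 2 ≤ k → IsZero (homologyOf C k) := by
  have : Finite (nbdBoundary K T) := (finite_sd hX.1).subset fun _ h => h.1.1
  have hD := (hT.isRegularPoset hX).1
  have hY : ∀ k, 1 ≤ k → Nonempty (homologyOf (nbdBoundary K T) k ≃+
      (homologyOf (nbd K T) k × homologyOf (nbdCompl K T) k)) := by
    intro k hk
    refine mv_equiv_of_union chainCover_nbd ?_ ?_ <;> rw [nbd_union]
    exacts [isZero_sd hX.1 hac (by omega), isZero_sd hX.1 hac hk]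
  have hCY : ∀ k, 1 ≤ k → Nonempty (homologyOf (nbdCompl K T) k ≃+
      (homologyOf C k × homologyOf (nbdCompl K T \ C : Set _) k)) := by
    intro k hk
    have h := mv_equiv_of_disjoint
      (IsUpClosed.chainCover hC.isSeparated.upClosed_left hC.isSeparated.upClosed_right)
      (Set.disjoint_iff_inter_eq_empty.1 hC.isSeparated.1) k hk
    rwa [hC.union_sdiff] at h
  have hemb : ∀ k, 1 ≤ k → ∃ f : homologyOf C k →+ homologyOf (nbdBoundary K T) k,
      Function.Injective f := by
    intro k hk
    obtain ⟨e⟩ := hY k hk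
    obtain ⟨e'⟩ := hCY k hk
    refine ⟨e.symm.toAddMonoidHom.comp ((AddMonoidHom.inr _ _).comp
      (e'.symm.toAddMonoidHom.comp (AddMonoidHom.inl _ _))), ?_⟩
    intro x y hxy
    have h1 := e.symm.injective hxy
    have h2 := e'.symm.injective (congr_arg Prod.snd h1)
    exact congr_arg Prod.fst h2
  constructor
  · obtain ⟨f, hf⟩ := hemb 1 le_rfl
    obtain ⟨g, hg⟩ := hD.exists_embedding
    exact ⟨g.comp f, hg.comp hf⟩
  · intro k hk
    obtain ⟨f, hf⟩ := hemb k (by omega)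
    have := isZero_iff_subsingleton.1 (hD.isZero_homology hk)
    exact isZero_iff_subsingleton.2 hf.subsingleton

/-- The first homology of a piece is free of finite rank and the higher groups vanish, so the
dimension over one field settles the integral homology. -/
lemma IsSingularPart.piece_type (F : Type) [Field F] (hT : IsSingularPart K T)
    (hX : IsSimplePolyhedron K) (hac : IsAcyclic K.faces) {C : Set (Finset (Finset V))}
    (hC : IsComponent C (nbdCompl K T)) :
    (IsAcyclic C ↔ h1 F C = 0) ∧ (IsHomologyCircle C ↔ h1 F C = 1) := by
  have : Finite (nbdBoundary K T) := (finite_sd hX.1).subset fun _ h => h.1.1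
  obtain ⟨⟨f, hf⟩, h2⟩ := hT.exists_embedding hX hac hC
  have hz := homology_zero_iso_of_connected hC.2.1
  refine ⟨⟨fun h => h1_of_isZero F (h.2 1 le_rfl), fun h => ⟨hz, fun k hk => ?_⟩⟩,
    ⟨fun h => h1_of_iso F h.2.1, fun h => ⟨hz, iso_of_h1 F f hf h, h2⟩⟩⟩
  rcases hk.eq_or_lt with rfl | hk
  · exact isZero_of_h1 F f hf h
  · exact h2 k hk

/-- The number of components of the boundary. -/
lemma IsSingularPart.card_boundary (F : Type) [Field F] (hT : IsSingularPart K T)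
    (hX : IsSimplePolyhedron K) (hac : IsAcyclic K.faces) :
    h0 (nbdBoundary K T) =
      h0 (nbd K T) + {v ∈ trueVertices K | {v} ∈ T}.ncard + h1 F (nbdCompl K T) := by
  have : Finite (nbdBoundary K T) := (finite_sd hX.1).subset fun _ h => h.1.1
  rw [← (hT.isRegularPoset hX).h1_eq F, h1_nbdBoundary F hX.1 hac, hT.h1_nbd F hX]

lemma ncard_split {α : Type} {P : Set α → Prop} {f : Set α → ℕ} (hfin : {C | P C}.Finite)
    (h : ∀ C, P C → f C ≤ 1) :
    {C | P C ∧ f C = 0}.ncard + {C | P C ∧ f C = 1}.ncard = {C | P C}.ncard := by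
  rw [← Set.ncard_union_eq (Set.disjoint_left.2 fun C h1 h2 => by have := h1.2.symm.trans h2.2; omega)
    (hfin.subset fun _ h => h.1) (hfin.subset fun _ h => h.1)]
  congr 1
  ext C
  simp only [Set.mem_union, Set.mem_ofPred_eq]
  have := h C
  constructor
  · rintro (h | h) <;> exact h.1
  · intro hC
    have := h C hC
    rcases (show f C = 0 ∨ f C = 1 by omega) with h | h
    exacts [Or.inl ⟨hC, h⟩, Or.inr ⟨hC, h⟩]

lemma IsComponent.isSingularPart {S' : Set (Finset V)} (hS' : IsComponent S' (singularSet K))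
    (hbd : Disjoint S' (boundary K)) : IsSingularPart K S' := ⟨hS'.1, hS'.2.2, hbd⟩

theorem boundary_and_pieces (hX : IsSimplePolyhedron K) (hac : IsAcyclic K.faces)
    (S' : Set (Finset V)) (hS' : IsComponent S' (singularSet K))
    (hbd : Disjoint S' (boundary K))
    (n m : ℕ) (hn : {v ∈ trueVertices K | {v} ∈ S'}.ncard = n)
    (hm : {γ | IsComponent γ (nbdBoundary K S')}.ncard = m) :
    (∀ γ, IsComponent γ (nbdBoundary K S') → IsSubdivisionOf (orderComplex γ) circleGraph) ∧
    n + 1 ≤ m ∧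
    IsConnectedSet (nbd K S') ∧
    {A | IsComponent A (nbdCompl K S') ∧ IsAcyclic A}.ncard = n + 1 ∧
    {B | IsComponent B (nbdCompl K S') ∧ IsHomologyCircle B}.ncard = m - (n + 1) ∧
    (∀ C, IsComponent C (nbdCompl K S') → IsAcyclic C ∨ IsHomologyCircle C) := by
  have hT := hS'.isSingularPart hbd
  have hc := hS'.2.1
  have hN : IsConnectedSet (nbd K S') := nbd_connected (fun σ hσ => hT.mem_faces hσ) hc
  have fD : Finite (nbdBoundary K S') := (finite_sd hX.1).subset fun _ h => h.1.1
  have fY : (nbdCompl K S').Finite := (finite_sd hX.1).subset fun _ h => h.1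
  have fY' : Finite (nbdCompl K S') := fY
  have hle : ∀ C, IsComponent C (nbdCompl K S') → h1 ℚ C ≤ 1 := fun C hC =>
    hT.h1_component_le ℚ hX hac hc hC
  have e1 := hT.card_boundary ℚ hX hac
  have e2 := (hT.components hX hac hc).2
  have e3 := ncard_components_h1 ℚ _ fY hle
  have e4 := ncard_split (P := fun C => IsComponent C (nbdCompl K S')) finite_components hle
  rw [h0_eq_one_iff.2 hN, hn] at e1
  rw [ncard_components] at hm e4
  have s1 : {A | IsComponent A (nbdCompl K S') ∧ IsAcyclic A} =
      {A | IsComponent A (nbdCompl K S') ∧ h1 ℚ A = 0} :=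
    Set.ext fun A => and_congr_right fun hA => (hT.piece_type ℚ hX hac hA).1
  have s2 : {A | IsComponent A (nbdCompl K S') ∧ IsHomologyCircle A} =
      {A | IsComponent A (nbdCompl K S') ∧ h1 ℚ A = 1} :=
    Set.ext fun A => and_congr_right fun hA => (hT.piece_type ℚ hX hac hA).2
  rw [s1, s2]
  -- At this point `m` equals both `1 + n + h1 Y` and `h0 Y`, where `Y` is the complement. Exactly
  -- `h1 Y` components have dimension one, and the remaining `n + 1` have dimension zero.
  refine ⟨fun γ hγ => ?_, by omega, hN, by omega, by omega, fun C hC => ?_⟩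
  · have : Finite γ := Finite.Set.subset _ hγ.1
    exact ((hT.isRegularPoset hX).component hγ).isSubdivisionOf_circle hγ.2.1
  · rw [(hT.piece_type ℚ hX hac hC).1, (hT.piece_type ℚ hX hac hC).2]
    have := hle C hC
    omega

end Pieces
end SimplePoly

namespace SimplePoly

/-! ### Stokes' theorem modulo two and half lives, half dies -/

section Stokes

open Classical

variable {α : Type} [PartialOrder α]

/-- Stokes' theorem modulo two. -/
lemma stokes_sum (A : Finset α) (D : Set α) {f : α → ZMod 2} {φ : α → α → ZMod 2}
    (hf : ∀ x ∈ A, ∀ y ∈ A, x < y → f x = f y) (hφ : IsCocycle (A : Set α) φ)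
    (hpar : ∀ x ∈ A, ∀ y ∈ A, x < y →
      ((A.filter fun w => y < w ∨ w < x ∨ (x < w ∧ w < y)).card : ZMod 2) =
        if x ∈ D ∧ y ∈ D then 1 else 0) :
    ∑ x ∈ A, ∑ y ∈ A, (if x < y ∧ x ∈ D ∧ y ∈ D then f x * φ x y else 0) = 0 := by
  let I : α → α → ZMod 2 := fun x y => if x < y then 1 else 0
  -- This is the integral of `f` times the coboundary of `φ` over all triangles; each term vanishes
  -- by the cocycle condition.
  have h1 : ∑ x ∈ A, ∑ y ∈ A, ∑ z ∈ A, I x y * I y z * (f x * (φ x y + φ y z + φ x z)) = 0 := by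
    refine Finset.sum_eq_zero fun x hx => Finset.sum_eq_zero fun y hy =>
      Finset.sum_eq_zero fun z hz => ?_
    by_cases hxy : x < y
    · by_cases hyz : y < z
      · rw [hφ x hx y hy z hz hxy.le hyz.le, CharTwo.add_self_eq_zero, mul_zero, mul_zero]
      · simp [I, hyz]
    · simp [I, hxy]
  -- The sum over triangles is regrouped by edges. An edge `x < y` appears once for each third
  -- vertex, which lies above, below or between. As `f` is locally constant, it may be evaluated at
  -- the lower end of each edge.
  have h2 : ∑ x ∈ A, ∑ y ∈ A, ∑ z ∈ A, I x y * I y z * (f x * (φ x y + φ y z + φ x z)) =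
      (∑ x ∈ A, ∑ y ∈ A, ∑ z ∈ A, I x y * (f x * φ x y) * I y z) +
      (∑ x ∈ A, ∑ y ∈ A, ∑ z ∈ A, I x y * (f x * φ x y) * I z x) +
      ∑ x ∈ A, ∑ y ∈ A, ∑ z ∈ A, I x y * (f x * φ x y) * (I x z * I z y) := by
    have e1 : ∑ x ∈ A, ∑ y ∈ A, ∑ z ∈ A, I x y * (f x * φ x y) * I z x =
        ∑ x ∈ A, ∑ y ∈ A, ∑ z ∈ A, I x y * I y z * (f x * φ y z) := by
      calc _ = ∑ x ∈ A, ∑ y ∈ A, ∑ z ∈ A, I y z * (f y * φ y z) * I x y := by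
            rw [Finset.sum_comm' (t' := A) (s' := fun _ => A) (by tauto)]
            rw [Finset.sum_comm]
            conv_lhs => 
              enter [2, x]
              rw [Finset.sum_comm]
            rw [Finset.sum_comm]
        _ = _ := by
            refine Finset.sum_congr rfl fun x hx => Finset.sum_congr rfl fun y hy =>
              Finset.sum_congr rfl fun z hz => ?_
            by_cases hxy : x < y
            · rw [hf x hx y hy hxy]; ring
            · simp [I, hxy]
    have e2 : ∑ x ∈ A, ∑ y ∈ A, ∑ z ∈ A, I x y * (f x * φ x y) * (I x z * I z y) =
        ∑ x ∈ A, ∑ y ∈ A, ∑ z ∈ A, I x y * I y z * (f x * φ x z) := by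
      refine Finset.sum_congr rfl fun x hx => ?_
      rw [Finset.sum_comm]
      refine Finset.sum_congr rfl fun y hy => Finset.sum_congr rfl fun z hz => ?_
      by_cases hxy : x < y
      · by_cases hyz : y < z
        · simp [I, hxy, hyz, hxy.trans hyz]
        · simp [I, hyz]
      · simp [I, hxy]
    rw [e1, e2, ← Finset.sum_add_distrib, ← Finset.sum_add_distrib]
    refine Finset.sum_congr rfl fun x hx => ?_
    rw [← Finset.sum_add_distrib, ← Finset.sum_add_distrib]
    refine Finset.sum_congr rfl fun y hy => ?_
    rw [← Finset.sum_add_distrib, ← Finset.sum_add_distrib]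
    refine Finset.sum_congr rfl fun z hz => ?_
    ring
  rw [h2, ← Finset.sum_add_distrib, ← Finset.sum_add_distrib] at h1
  refine Eq.trans ?_ h1
  refine Finset.sum_congr rfl fun x hx => ?_
  rw [← Finset.sum_add_distrib, ← Finset.sum_add_distrib]
  refine Finset.sum_congr rfl fun y hy => ?_
  rw [← Finset.mul_sum, ← Finset.mul_sum, ← Finset.mul_sum, ← mul_add, ← mul_add,
    ← Finset.sum_add_distrib, ← Finset.sum_add_distrib]
  by_cases hxy : x < y
  -- The number of triangles on an edge is odd precisely for boundary edges, so only these survive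
  -- modulo two.
  · have h3 : ∑ w ∈ A, (I y w + I w x + I x w * I w y) =
        if x ∈ D ∧ y ∈ D then 1 else 0 := by
      rw [← hpar x hx y hy hxy, Finset.natCast_card_filter]
      refine Finset.sum_congr rfl fun w _ => ?_
      by_cases h1 : y < w
      · have n1 : ¬ w < x := fun h => lt_irrefl _ (h1.trans (h.trans hxy))
        have n2 : ¬ w < y := h1.not_gt
        simp [I, h1, n1, n2]
      · by_cases h2 : w < x
        · have n1 : ¬ x < w := h2.not_gt
          simp [I, h1, h2, n1]
        · by_cases h3 : x < w <;> by_cases h4 : w < y <;> simp [I, h1, h2, h3, h4]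
    rw [h3]
    by_cases hD : x ∈ D ∧ y ∈ D <;> simp [I, hxy, hD]
  · simp [I, hxy]

/-- The extension of a function on a subset by zero. -/
noncomputable def extendZero {F : Type} [Zero F] {A : Set α} (f : A → F) (x : α) : F :=
  if h : x ∈ A then f ⟨x, h⟩ else 0

/-- Each `x` contributes `g x` once for each of its two neighbours. Modulo two this kills
coboundaries on a union of circles. -/
lemma sum_regular {F : Type} [Field F] (D : Finset α) (hD : ∀ x ∈ D, (nbrs (D : Set α) x).ncard = 2)
    (g : α → F) : ∑ x ∈ D, ∑ y ∈ D, (if x < y then g y + g x else 0) = 2 * ∑ x ∈ D, g x := by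
  have h1 : ∑ x ∈ D, ∑ y ∈ D, (if x < y then g y + g x else 0) =
      ∑ x ∈ D, ∑ y ∈ D, (if y < x ∨ x < y then g x else 0) := by
    have : ∀ x y : α, (if y < x ∨ x < y then g x else 0) =
        (if y < x then g x else 0) + if x < y then g x else 0 := fun x y => by
      by_cases h : y < x
      · simp [h, h.not_gt]
      · simp [h]
    simp only [this, Finset.sum_add_distrib]
    rw [Finset.sum_comm (f := fun x y => if y < x then g x else 0), ← Finset.sum_add_distrib]
    refine Finset.sum_congr rfl fun x _ => ?_
    rw [← Finset.sum_add_distrib]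
    refine Finset.sum_congr rfl fun y _ => ?_
    split_ifs <;> simp
  rw [h1, Finset.mul_sum]
  refine Finset.sum_congr rfl fun x hx => ?_
  rw [← Finset.sum_filter, Finset.sum_const]
  have : (D.filter fun y => y < x ∨ x < y).card = 2 := by
    rw [← hD x hx, ← Set.ncard_coe_finset]
    congr 1
    ext y
    simp [nbrs, or_comm]
  rw [this, nsmul_eq_mul, Nat.cast_ofNat]

/-- A nondegenerate pairing with the cocycles on `D` that vanishes on the cocycles on `A` bounds the
dimension of the first cohomology of `A`. -/
lemma finrank_add_h1_le {F : Type} [Field F] {A D : Set α} [Finite D] (hDA : D ⊆ A) {U : Type}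
    [AddCommGroup U] [Module F U] (pr : U →ₗ[F] (α → α → F) →ₗ[F] F)
    (hA : ∀ u φ, IsCocycle A φ → pr u φ = 0) (hD : ∀ u φ, IsCoboundary D φ → pr u φ = 0)
    (hnd : ∀ u, (∀ φ, IsCocycle D φ → pr u φ = 0) → u = 0)
    (hcob : ∀ φ : α → α → F, IsCocycle A φ → IsCoboundary D φ → IsCoboundary A φ) :
    Module.finrank F U + h1 F A ≤ h1 F D := by
  let j : H1 F A →ₗ[F] H1 F D :=
    Submodule.mapQ _ _ ((Z1 F A).subtype.codRestrict _ fun φ => IsCocycle.mono φ.2 hDA)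
      fun φ (hφ : IsCoboundary A φ.1) => IsCoboundary.mono hφ hDA
  have hj : Function.Injective j := by
    rw [injective_iff_map_eq_zero]
    intro x hx
    obtain ⟨φ, rfl⟩ := Submodule.mkQ_surjective _ x
    exact (Submodule.Quotient.mk_eq_zero _).2
      (hcob φ.1 φ.2 ((Submodule.Quotient.mk_eq_zero _).1 hx))
  let ℓ : U →ₗ[F] Module.Dual F (H1 F D) :=
    { toFun := fun u => Submodule.liftQ _ ((pr u).comp (Z1 F D).subtype) fun φ hφ => hD u φ.1 hφ
      map_add' := fun u w => by
        refine LinearMap.ext fun x => ?_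
        obtain ⟨φ, rfl⟩ := Submodule.mkQ_surjective _ x
        exact LinearMap.congr_fun (pr.map_add u w) φ.1
      map_smul' := fun c u => by
        refine LinearMap.ext fun x => ?_
        obtain ⟨φ, rfl⟩ := Submodule.mkQ_surjective _ x
        exact LinearMap.congr_fun (pr.map_smul c u) φ.1 }
  have hℓ : Function.Injective ℓ := by
    rw [injective_iff_map_eq_zero]
    intro u hu
    refine hnd u fun φ hφ => ?_
    exact LinearMap.congr_fun hu (Submodule.Quotient.mk ⟨φ, hφ⟩)
  -- `U` embeds in the annihilator of the image of `H1 F A`, whose dimension is `h1 F D - h1 F A`.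
  have hrange : ∀ u, ℓ u ∈ (LinearMap.range j).dualAnnihilator := by
    intro u
    rw [Submodule.mem_dualAnnihilator]
    rintro _ ⟨x, rfl⟩
    obtain ⟨φ, rfl⟩ := Submodule.mkQ_surjective _ x
    exact hA u φ.1 φ.2
  have d1 : Module.finrank F U ≤ Module.finrank F (LinearMap.range j).dualAnnihilator :=
    LinearMap.finrank_le_finrank_of_injective (f := ℓ.codRestrict _ hrange)
      (by intro u w h; exact hℓ (congr_arg Subtype.val h))
  have d2 := Subspace.finrank_add_finrank_dualAnnihilator_eq (LinearMap.range j)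
  rw [LinearMap.finrank_range_of_inj hj] at d2
  simp only [h1]
  omega

/-- Half lives, half dies, modulo two. -/
lemma h0_add_h1_le {A D : Set α} [Finite A] (hreg : IsRegularPoset (A ∩ D))
    (hpar : ∀ x ∈ A, ∀ y ∈ A, x < y →
      (({w ∈ A | y < w ∨ w < x ∨ (x < w ∧ w < y)}.ncard : ℕ) : ZMod 2) =
        if x ∈ D ∧ y ∈ D then 1 else 0)
    (hcob : ∀ φ : α → α → ZMod 2, IsCocycle A φ → IsCoboundary (A ∩ D) φ → IsCoboundary A φ)
    (hLC : ∀ f ∈ LC (ZMod 2) A, (∀ x : A, (x : α) ∈ D → f x = 0) → f = 0) :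
    h0 A + h1 (ZMod 2) A ≤ h0 (A ∩ D) := by
  have fD : Finite ↑(A ∩ D) := Finite.Set.subset A Set.inter_subset_left
  let sA : Finset α := (Set.toFinite A).toFinset
  let sD : Finset α := (Set.toFinite (A ∩ D)).toFinset
  have hsA : ∀ {x}, x ∈ sA ↔ x ∈ A := (Set.toFinite A).mem_toFinset
  have hsD : ∀ {x}, x ∈ sD ↔ x ∈ A ∩ D := (Set.toFinite (A ∩ D)).mem_toFinset
  have hext : ∀ (f : LC (ZMod 2) A), ∀ x ∈ A, ∀ y ∈ A, x < y →
      extendZero f.1 x = extendZero f.1 y := fun f x hx y hy h => by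
    simp only [extendZero, dif_pos hx, dif_pos hy]
    exact mem_LC.1 f.2 _ _ (show (⟨x, hx⟩ : A) ≤ ⟨y, hy⟩ from h.le)
  -- The pairing integrates `f` times `φ` over the boundary curves. It vanishes on restrictions from
  -- `A` by `stokes_sum` and on coboundaries by `sum_regular`.
  let pr : LC (ZMod 2) A →ₗ[ZMod 2] (α → α → ZMod 2) →ₗ[ZMod 2] ZMod 2 :=
    LinearMap.mk₂ (ZMod 2)
      (fun f φ => ∑ x ∈ sD, ∑ y ∈ sD, if x < y then extendZero f.1 x * φ x y else 0)
      (fun f g φ => by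
        simp only [← Finset.sum_add_distrib]
        refine Finset.sum_congr rfl fun x _ => Finset.sum_congr rfl fun y _ => ?_
        have : extendZero (f + g).1 x = extendZero f.1 x + extendZero g.1 x := by
          by_cases h : x ∈ A <;> simp [extendZero, h]
        split_ifs
        · rw [this]; ring
        · simp)
      (fun c f φ => by
        simp only [smul_eq_mul, Finset.mul_sum]
        refine Finset.sum_congr rfl fun x _ => Finset.sum_congr rfl fun y _ => ?_
        have : extendZero (c • f).1 x = c * extendZero f.1 x := by
          by_cases h : x ∈ A <;> simp [extendZero, h]
        split_ifs
        · rw [this]; ring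
        · simp)
      (fun f φ ψ => by
        simp only [← Finset.sum_add_distrib]
        refine Finset.sum_congr rfl fun x _ => Finset.sum_congr rfl fun y _ => ?_
        split_ifs
        · simp only [Pi.add_apply]; ring
        · simp)
      (fun c f φ => by
        simp only [smul_eq_mul, Finset.mul_sum]
        refine Finset.sum_congr rfl fun x _ => Finset.sum_congr rfl fun y _ => ?_
        split_ifs
        · simp only [Pi.smul_apply, smul_eq_mul]; ring
        · simp)
  have hpr : ∀ f φ, pr f φ = ∑ x ∈ sD, ∑ y ∈ sD, if x < y then extendZero f.1 x * φ x y else 0 :=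
    fun f φ => rfl
  have claim1 : ∀ f φ, IsCocycle A φ → pr f φ = 0 := by
    intro f φ hφ
    have hAs : (sA : Set α) = A := (Set.toFinite A).coe_toFinset
    have h := stokes_sum sA D (f := extendZero f.1) (φ := φ)
      (fun x hx y hy => hext f x (hsA.1 hx) y (hsA.1 hy)) (by rwa [hAs]) (by
        intro x hx y hy hxy
        rw [← hpar x (hsA.1 hx) y (hsA.1 hy) hxy, ← Set.ncard_coe_finset]
        congr 3
        ext w
        simp [hsA])
    rw [hpr]
    refine Eq.trans ?_ h
    have hsub : sD ⊆ sA := fun x hx => hsA.2 (hsD.1 hx).1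
    have hnot : ∀ x ∈ sA, x ∉ sD → x ∉ D := fun x hx hn hD => hn (hsD.2 ⟨hsA.1 hx, hD⟩)
    rw [← Finset.sum_subset hsub]
    · refine Finset.sum_congr rfl fun x hx => ?_
      rw [← Finset.sum_subset hsub]
      · refine Finset.sum_congr rfl fun y hy => ?_
        simp [(hsD.1 hx).2, (hsD.1 hy).2]
      · intro y hy hn
        simp [hnot y hy hn]
    · intro x hx hn
      simp [hnot x hx hn]
  have claim2 : ∀ f φ, IsCoboundary (A ∩ D) φ → pr f φ = 0 := by
    rintro f φ ⟨g, hg⟩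
    have hDs : (sD : Set α) = A ∩ D := (Set.toFinite (A ∩ D)).coe_toFinset
    have h := sum_regular sD (fun x hx => by rw [hDs]; exact hreg.2 x (hsD.1 hx))
      fun x => extendZero f.1 x * g x
    rw [hpr]
    refine Eq.trans ?_ (h.trans (by rw [show (2 : ZMod 2) = 0 from rfl, zero_mul]))
    refine Finset.sum_congr rfl fun x hx => Finset.sum_congr rfl fun y hy => ?_
    split_ifs with hxy
    · rw [hg x (hsD.1 hx) y (hsD.1 hy) hxy.le, CharTwo.sub_eq_add,
        hext f x (hsD.1 hx).1 y (hsD.1 hy).1 hxy]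
      ring
    · rfl
  -- The indicator of a single boundary pair is a cocycle and reads off the value of `f` there. So
  -- `f` vanishes on the boundary, and `hLC` applies.
  have claim3 : ∀ f, (∀ φ, IsCocycle (A ∩ D) φ → pr f φ = 0) → f = 0 := by
    intro f hf
    have key : ∀ x ∈ A ∩ D, ∀ y ∈ A ∩ D, x < y → extendZero f.1 x = 0 := by
      intro x hx y hy hxy
      rw [← hf (fun a b => if a = x ∧ b = y then 1 else 0)
        (hreg.1.isCocycle fun a _ => if_neg fun h => hxy.ne (h.1.symm.trans h.2)), hpr]
      rw [Finset.sum_eq_single x, Finset.sum_eq_single y]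
      · simp [hxy]
      · intro b _ hb
        simp [hb]
      · exact fun h => absurd (hsD.2 hy) h
      · intro a _ ha
        simp [ha]
      · exact fun h => absurd (hsD.2 hx) h
    refine Subtype.ext (hLC f.1 f.2 fun x hx => ?_)
    have hxA : (x : α) ∈ A ∩ D := ⟨x.2, hx⟩
    have hx' : extendZero f.1 (x : α) = f.1 x := by simp [extendZero]
    rw [← hx']
    obtain ⟨y, hy, h⟩ : (nbrs (A ∩ D) x).Nonempty :=
      Set.nonempty_of_ncard_ne_zero (by rw [hreg.2 x hxA]; decide)
    rcases h with h | h
    · exact key x hxA y hy h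
    · rw [← hext f y hy.1 x x.2 h]
      exact key y hy x hxA h
  have d1 := finrank_add_h1_le Set.inter_subset_left pr claim1 claim2 claim3 hcob
  rwa [finrank_LC, hreg.h1_eq (ZMod 2)] at d1

end Stokes
end SimplePoly

namespace SimplePoly

/-! ### Circulations on unions of circles -/

section Circulations

open Classical

variable {α : Type} [PartialOrder α] {Q : Set α}

/-- The functionals on the pairs of a regular graph poset that vanish on coboundaries: the weights
of the two pairs at any element add up to zero. -/
lemma IsRegularPoset.exists_circulations (F : Type) [Field F] [Finite Q] (hQ : IsRegularPoset Q) :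
    ∃ (U : Type) (_ : AddCommGroup U) (_ : Module F U) (_ : Module.Finite F U)
      (o : α → α → U →ₗ[F] F), Module.finrank F U = h0 Q ∧
      (∀ u, (∀ a ∈ Q, ∀ b ∈ Q, a < b → o a b u = 0) → u = 0) ∧
      (∀ u a b, o a b u = o b a u) ∧
      ∀ u, ∀ a ∈ Q, ∀ b c, b ≠ c → nbrs Q a = {b, c} → o a b u + o a c u = 0 := by
  have fP : Fintype (Pairs Q) := Fintype.ofFinite _
  let ind : α → α → Pairs Q → F := fun a b p =>
    if ((p.1.1 : α) = a ∧ (p.1.2 : α) = b) ∨ ((p.1.1 : α) = b ∧ (p.1.2 : α) = a) then 1 else 0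
  -- The functionals killing all coboundaries are the one-cycles of the graph, and their dimension
  -- is `h1`, hence `h0`. The weight `o a b` is the value at the pair formed by `a` and `b` in
  -- either order.
  refine ⟨(LinearMap.range (dmap F Q)).dualAnnihilator, inferInstance, inferInstance,
    inferInstance, fun a b => (Module.Dual.eval F _ (ind a b)).comp (Submodule.subtype _),
    ?_, ?_, ?_, ?_⟩
  · have d1 := Subspace.finrank_add_finrank_dualAnnihilator_eq (LinearMap.range (dmap F Q))
    have d2 := finrank_coker_dmap (F := F) (Q := Q)
    have d3 := hQ.1.h1_eq (F := F)
    rw [hQ.h1_eq F] at d3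
    rw [Module.finrank_fintype_fun_eq_card, ← Nat.card_eq_fintype_card] at d1
    omega
  · intro u h
    refine Subtype.ext (LinearMap.pi_ext' fun p => LinearMap.ext_ring ?_)
    refine Eq.trans ?_ (h p.1.1 p.1.1.2 p.1.2 p.1.2.2 p.2)
    refine congr_arg u.1 (funext fun r => ?_)
    have hr : ¬ ((r.1.1 : α) = p.1.2 ∧ (r.1.2 : α) = p.1.1) := fun ⟨h1, h2⟩ =>
      lt_asymm p.2 (show (p.1.2 : α) < p.1.1 from h1 ▸ h2 ▸ r.2)
    simp only [LinearMap.coe_single, Pi.single_apply, ind, hr, or_false]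
    congr 1
    simp only [Subtype.ext_iff, Prod.ext_iff]
  · intro u a b
    exact congr_arg u.1 (funext fun p => if_congr or_comm rfl rfl)
  · intro u a ha b c hbc hn
    have hu := (Submodule.mem_dualAnnihilator _).1 u.2 _ ⟨fun x => if (x : α) = a then 1 else 0, rfl⟩
    have hb : b ∈ nbrs Q a := by simp [hn]
    have hc : c ∈ nbrs Q a := by simp [hn]
    have hmem : ∀ r : α, r ∈ Q → (a < r ∨ r < a) → r = b ∨ r = c := fun r h1 h2 => by
      have : r ∈ nbrs Q a := ⟨h1, h2⟩
      simpa [hn] using this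
    change u.1 (ind a b) + u.1 (ind a c) = 0
    rw [← map_add]
    -- In a graph poset `a` is the lower end of both its pairs or the upper end of both. So the
    -- coboundary of the indicator of `a` is minus or plus the sum of the indicators of the two
    -- pairs.
    rcases hb.2 with hab | hba
    · rw [← neg_eq_zero, ← map_neg]
      refine Eq.trans (congr_arg u.1 (funext fun p => ?_)) hu
      have h2 : (p.1.2 : α) ≠ a := fun h => hQ.1 _ p.1.1.2 a ha b hb.1 (h ▸ p.2) hab
      by_cases h1 : (p.1.1 : α) = a
      · rcases hmem p.1.2 p.1.2.2 (Or.inl (h1 ▸ p.2)) with h3 | h3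
        · simp [ind, dmap, h1, h3, hbc, h3 ▸ h2]
        · simp [ind, dmap, h1, h3, hbc.symm, h3 ▸ h2]
      · simp [ind, dmap, h1, h2]
    · refine Eq.trans (congr_arg u.1 (funext fun p => ?_)) hu
      have h2 : (p.1.1 : α) ≠ a := fun h => hQ.1 b hb.1 a ha _ p.1.2.2 hba (h ▸ p.2)
      by_cases h1 : (p.1.2 : α) = a
      · rcases hmem p.1.1 p.1.1.2 (Or.inr (h1 ▸ p.2)) with h3 | h3
        · simp [ind, dmap, h1, h3, hbc, h3 ▸ h2]
        · simp [ind, dmap, h1, h3, hbc.symm, h3 ▸ h2]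
      · simp [ind, dmap, h1, h2]

end Circulations

/-! ### Orienting singular circles and their links -/

section EdgeFlow

variable {V : Type} [DecidableEq V] {K : PreAbstractSimplicialComplex V} {T : Set (Finset V)}

lemma pointLink_adj_iff {v x y : V} : (edgeGraph (pointLink K {v})).Adj x y ↔ IsFlag K v x y := by
  rw [pointLink_adj, pair_eq_union, IsFlag]
  simp only [Finset.singleton_subset_iff, Finset.mem_insert, Finset.mem_singleton, not_or]
  constructor
  · rintro ⟨h1, h2, h3, h4⟩
    exact ⟨Ne.symm h3, Ne.symm h4, Ne.symm h1, h2⟩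
  · rintro ⟨h1, h2, h3, h4⟩
    exact ⟨Ne.symm h3, h4, Ne.symm h1, Ne.symm h2⟩

/-- The flow on the link of a singular point that is not a true vertex. -/
lemma IsSingularPart.exists_link_flow (hT : IsSingularPart K T) (hX : IsSimplePolyhedron K) {v : V}
    (hv : {v} ∈ T) (hno : v ∉ trueVertices K) :
    ∃ (a b : V) (f : V → V → ℤ), a ≠ b ∧ (∀ x, (x ≠ v ∧ {v, x} ∈ T) ↔ x = a ∨ x = b) ∧
      (∀ x y, f x y = - f y x) ∧ (∀ y, IsFlag K v a y → f a y = 1) ∧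
      (∀ y, IsFlag K v b y → f b y = -1) ∧ (∀ x y, ¬ IsFlag K v x y → f x y = 0) ∧
      ∀ x, x ≠ a → x ≠ b → ∀ B : Finset V, (∀ y, IsFlag K v x y → y ∈ B) →
        ∑ y ∈ B, f x y = 0 := by
  obtain ⟨a, b, f, hab, ha, hb, ho, h1, h2, h3, h4, h5⟩ :=
    exists_theta_flow ((hT.vertex_deg hX hv).2 hno).2.2
  simp only [pointLink_adj_iff] at h2 h3 h4 h5
  refine ⟨a, b, f, hab, fun x => ?_, h1, h2, h3, h4, h5⟩
  have hset := Set.ext_iff.1 (hT.setOf_linkDeg hX hv)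
  constructor
  · intro hx
    by_contra! h
    have hd : linkDeg (pointLink K {v}) x = 3 := (hset x).2 hx
    have : {x} ∈ (pointLink K {v}).faces := by
      refine ⟨by simp, ?_, by simpa using hx.1.symm⟩
      have := hT.mem_faces hx.2
      rwa [Finset.insert_eq] at this
    have := ho x this h.1 h.2
    omega
  · rintro (rfl | rfl)
    · exact (hset _).1 ha
    · exact (hset _).1 hb

/-- The chains in a singular part without true vertices. -/
lemma IsSingularPart.isRegularPoset_chains (hT : IsSingularPart K T) (hX : IsSimplePolyhedron K)
    (hno : ∀ v ∈ trueVertices K, {v} ∉ T) : IsRegularPoset (orderComplex T).faces := by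
  refine ⟨hT.isGraphPoset_chains hX, fun c hc => ?_⟩
  rcases hT.chain_shape hX hc with ⟨w, hw, rfl⟩ | ⟨e, he, he2, rfl⟩ | ⟨w, x, hne, hw, he, rfl⟩
  · rw [hT.ncard_nbrs_vertex hX hw]
    exact ((hT.vertex_deg hX hw).2 fun h => hno w h hw).1
  · exact hT.ncard_nbrs_edge hX he he2
  · exact hT.ncard_nbrs_ve hX hne hw he

lemma IsSingularPart.h0_chains (hT : IsSingularPart K T) :
    h0 (orderComplex T).faces = h0 (nbd K T) :=
  (h0_eq_of_retract (chainsIn_subset hT) (chainPart T) (fun _ hc => chainPart_mem hc)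
    (fun _ _ _ _ h => chainPart_mono h) (fun c _ => chainPart_subset c)
    fun _ hc => chainPart_id hc).symm

lemma eq_of_ncard_two {α : Type} {s : Set α} {b c : α} (h : s.ncard = 2) (hb : b ∈ s) (hc : c ∈ s)
    (hbc : b ≠ c) : s = {b, c} := by
  refine (Set.eq_of_subset_of_ncard_le (Set.insert_subset hb (Set.singleton_subset_iff.2 hc)) ?_
    (Set.finite_of_ncard_ne_zero (by omega))).symm
  rw [Set.ncard_pair hbc, h]

lemma vertex_lt {v x : V} (hne : x ≠ v) : ({{v}} : Finset (Finset V)) < {{v}, {v, x}} := by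
  refine (Finset.singleton_subset_iff.2 (by simp)).ssubset_of_ne fun h => ?_
  have := congr_arg Finset.card h
  rw [chain_ve_card hne, Finset.card_singleton] at this
  omega

lemma edge_lt {v x : V} (hne : x ≠ v) : ({{v, x}} : Finset (Finset V)) < {{v}, {v, x}} := by
  refine (Finset.singleton_subset_iff.2 (by simp)).ssubset_of_ne fun h => ?_
  have := congr_arg Finset.card h
  rw [chain_ve_card hne, Finset.card_singleton] at this
  omega

lemma singleton_ne_pair {v w x : V} (hne : x ≠ w) : ({v} : Finset V) ≠ {w, x} := fun h => by
  have := congr_arg Finset.card h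
  rw [Finset.card_pair hne.symm, Finset.card_singleton] at this
  omega

lemma IsSingularPart.chain_lt (hT : IsSingularPart K T) (hX : IsSimplePolyhedron K)
    {c d : Finset (Finset V)} (hc : c ∈ (orderComplex T).faces) (hd : d ∈ (orderComplex T).faces)
    (h : c < d) : ∃ v x, x ≠ v ∧ {v, x} ∈ T ∧ d = {{v}, {v, x}} ∧ (c = {{v}} ∨ c = {{v, x}}) := by
  have h1 := Finset.card_pos.2 hc.1
  have h2 := Finset.card_lt_card (h)
  rcases hT.chain_shape hX hd with ⟨w, hw, rfl⟩ | ⟨e, he, he2, rfl⟩ | ⟨w, x, hne, hw, he, rfl⟩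
  · rw [Finset.card_singleton] at h2
    omega
  · rw [Finset.card_singleton] at h2
    omega
  · rw [chain_ve_card hne] at h2
    obtain ⟨a, rfl⟩ := Finset.card_eq_one.1 (show c.card = 1 by omega)
    have := h.le (Finset.mem_singleton_self a)
    rw [Finset.mem_insert, Finset.mem_singleton] at this
    refine ⟨w, x, hne, he, rfl, ?_⟩
    rcases this with rfl | rfl
    exacts [Or.inl rfl, Or.inr rfl]

/-- Orientations of the edges of a singular part without true vertices. -/
lemma IsSingularPart.exists_orientations (F : Type) [Field F] (hT : IsSingularPart K T)
    (hX : IsSimplePolyhedron K) (hno : ∀ v ∈ trueVertices K, {v} ∉ T) :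
    ∃ (U : Type) (_ : AddCommGroup U) (_ : Module F U) (_ : Module.Finite F U)
      (o : V → V → U →ₗ[F] F), Module.finrank F U = h0 (nbd K T) ∧
      (∀ u, (∀ v x, x ≠ v → {v, x} ∈ T → o v x u = 0) → u = 0) ∧
      (∀ u v x, x ≠ v → {v, x} ∈ T → o v x u + o x v u = 0) ∧
      ∀ u v x y, x ≠ v → y ≠ v → x ≠ y → {v, x} ∈ T → {v, y} ∈ T → o v x u + o v y u = 0 := by
  have hfin : (nbd K T).Finite := (finite_sd hX.1).subset fun _ h => h.1
  have : Finite (orderComplex T).faces := hfin.subset (chainsIn_subset hT)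
  have hR := hT.isRegularPoset_chains hX hno
  have hmv : ∀ {v x}, x ≠ v → {v, x} ∈ T →
      {{v}, {v, x}} ∈ nbrs (orderComplex T).faces {{v}} := fun hne he =>
    ⟨chain_ve_mem (hT.vertex_mem hX hne he) he, Or.inl (vertex_lt hne)⟩
  have hme : ∀ {v x}, x ≠ v → {v, x} ∈ T →
      {{v}, {v, x}} ∈ nbrs (orderComplex T).faces {{v, x}} := fun hne he =>
    ⟨chain_ve_mem (hT.vertex_mem hX hne he) he, Or.inl (edge_lt hne)⟩
  obtain ⟨U, _, _, _, o, hU, hinj, hsymm, hflow⟩ := hR.exists_circulations F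
  have hve : ∀ u v x, x ≠ v → {v, x} ∈ T →
      o {{v}} {{v}, {v, x}} u + o {{v, x}} {{v}, {v, x}} u = 0 := by
    intro u v x hne he
    have hv := hT.vertex_mem hX hne he
    have hd : ({{v}} : Finset (Finset V)) ≠ {{v, x}} := fun h =>
      singleton_ne_pair hne (Finset.singleton_injective h)
    have m0 : {{v}, {v, x}} ∈ (orderComplex T).faces := chain_ve_mem hv he
    have m1 : {{v}} ∈ nbrs (orderComplex T).faces {{v}, {v, x}} :=
      ⟨chain_single_mem hv, Or.inr (vertex_lt hne)⟩
    have m2 : {{v, x}} ∈ nbrs (orderComplex T).faces {{v}, {v, x}} :=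
      ⟨chain_single_mem he, Or.inr (edge_lt hne)⟩
    rw [hsymm u {{v}}, hsymm u {{v, x}}]
    exact hflow u _ m0 _ _ hd (eq_of_ncard_two (hR.2 _ m0) m1 m2 hd)
  -- Subdivision splits an edge `e = {v, x}` into four pairs, along `{{v}}`, `{{v}, e}`, `{e}`,
  -- `{{x}, e}`, `{{x}}`. The orientation `o v x` is the weight of the pair at `v`. The weight
  -- changes sign at each of the three inner elements, which makes the orientation antisymmetric.
  refine ⟨U, _, _, inferInstance, fun v x => o {{v}} {{v}, {v, x}}, hU.trans hT.h0_chains,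
    ?_, ?_, ?_⟩
  · intro u hu
    refine hinj u fun c hc d hd hcd => ?_
    obtain ⟨v, x, hne, he, rfl, hcv⟩ := hT.chain_lt hX hc hd hcd
    have h1 := hu v x hne he
    have h2 := hve u v x hne he
    rw [h1, zero_add] at h2
    rcases hcv with rfl | rfl
    exacts [h1, h2]
  · intro u v x hne he
    have he' : {x, v} ∈ T := by rwa [Finset.pair_comm]
    have hd : ({{v}, {v, x}} : Finset (Finset V)) ≠ {{x}, {x, v}} := fun h => by
      have : ({v} : Finset V) ∈ ({{x}, {x, v}} : Finset (Finset V)) := by rw [← h]; simp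
      rw [Finset.mem_insert, Finset.mem_singleton, Finset.singleton_inj] at this
      rcases this with h | h
      · exact hne h.symm
      · exact singleton_ne_pair hne.symm h
    have m0 := hme hne.symm he'
    rw [Finset.pair_comm x v] at m0
    have h1 := hve u v x hne he
    have h2 := hve u x v hne.symm he'
    rw [Finset.pair_comm x v] at h2 hd
    beta_reduce
    rw [Finset.pair_comm x v]
    have h := hflow u _ (chain_single_mem he) _ _ hd
      (eq_of_ncard_two (hT.ncard_nbrs_edge hX he (Finset.card_pair hne.symm)) (hme hne he) m0 hd)
    linear_combination h1 + h2 - h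
  · intro u v x y hx hy hxy hvx hvy
    have hv := hT.vertex_mem hX hx hvx
    have hd : ({{v}, {v, x}} : Finset (Finset V)) ≠ {{v}, {v, y}} := fun h => by
      have : ({v, x} : Finset V) ∈ ({{v}, {v, y}} : Finset (Finset V)) := by rw [← h]; simp
      rw [Finset.mem_insert, Finset.mem_singleton] at this
      have : x ∈ ({v, y} : Finset V) := by
        rcases this with h | h
        · exact absurd h.symm (singleton_ne_pair hx)
        · rw [← h]; simp
      simp [hx, hxy] at this
    exact hflow u _ (chain_single_mem hv) _ _ hd
      (eq_of_ncard_two (hR.2 _ (chain_single_mem hv)) (hmv hx hvx) (hmv hy hvy) hd)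

end EdgeFlow
end SimplePoly

namespace SimplePoly

/-! ### Boundary curves around singular circles, modulo three -/

section TripleCover

variable {V : Type} [DecidableEq V] {K : PreAbstractSimplicialComplex V} {T : Set (Finset V)}

open Classical in
/-- The flows on the links of the vertices of a singular part without true vertices, scaled by an
orientation. -/
lemma IsSingularPart.exists_flows (F : Type) [Field F] (hT : IsSingularPart K T)
    (hX : IsSimplePolyhedron K) (hno : ∀ v ∈ trueVertices K, {v} ∉ T) :
    ∃ (U : Type) (_ : AddCommGroup U) (_ : Module F U) (_ : Module.Finite F U)
      (o : V → V → U →ₗ[F] F) (q : V → V → V → U →ₗ[F] F), Module.finrank F U = h0 (nbd K T) ∧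
      (∀ u, (∀ v x, x ≠ v → {v, x} ∈ T → o v x u = 0) → u = 0) ∧
      (∀ u v x, x ≠ v → {v, x} ∈ T → o v x u + o x v u = 0) ∧
      (∀ u v x y, q v x y u = - q v y x u) ∧
      (∀ u v x y, IsFlag K v x y → {v, x} ∈ T → q v x y u = o v x u) ∧
      (∀ u v x y, ¬ (IsFlag K v x y ∧ {v} ∈ T) → q v x y u = 0) ∧
      ∀ u v x, {v, x} ∉ T → ∀ B : Finset V, (∀ y, IsFlag K v x y → y ∈ B) →
        ∑ y ∈ B, q v x y u = 0 := by
  obtain ⟨U, _, _, _, o, hU, hinj, hanti, hflow⟩ := hT.exists_orientations F hX hno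
  have hex : ∀ v : V, ∃ (a b : V) (f : V → V → ℤ), {v} ∈ T → (a ≠ b ∧
      (∀ x, (x ≠ v ∧ {v, x} ∈ T) ↔ x = a ∨ x = b) ∧
      (∀ x y, f x y = - f y x) ∧ (∀ y, IsFlag K v a y → f a y = 1) ∧
      (∀ y, IsFlag K v b y → f b y = -1) ∧ (∀ x y, ¬ IsFlag K v x y → f x y = 0) ∧
      ∀ x, x ≠ a → x ≠ b → ∀ B : Finset V, (∀ y, IsFlag K v x y → y ∈ B) →
        ∑ y ∈ B, f x y = 0) := by
    intro v
    by_cases hv : {v} ∈ T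
    · obtain ⟨a, b, f, h⟩ := hT.exists_link_flow hX hv fun h => hno v h hv
      exact ⟨a, b, f, fun _ => h⟩
    · exact ⟨v, v, fun _ _ => 0, fun h => absurd h hv⟩
  choose a b f hf using hex
  -- In the theta graph around `v` the flow from `a v` to `b v` is scaled by the orientation of the
  -- edge towards `a v`. At `b v` both the flow and the orientation change sign, so the scaled flow
  -- equals `o v x` at either branch vertex.
  refine ⟨U, _, _, inferInstance, o,
    fun v x y => if {v} ∈ T then (f v x y : F) • o v (a v) else 0, hU, hinj, hanti, ?_, ?_, ?_, ?_⟩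
  · intro u v x y
    by_cases hv : {v} ∈ T
    · simp only [hv, if_true, LinearMap.smul_apply, smul_eq_mul]
      rw [(hf v hv).2.2.1 x y]
      push_cast
      ring
    · simp [hv]
  · intro u v x y h he
    have hv := hT.vertex_mem hX h.1 he
    obtain ⟨hab, hset, -, h1, h2, -, -⟩ := hf v hv
    simp only [hv, if_true, LinearMap.smul_apply, smul_eq_mul]
    rcases (hset x).1 ⟨h.1, he⟩ with rfl | rfl
    · rw [h1 y h]
      simp
    · rw [h2 y h]
      have ha := (hset (a v)).2 (Or.inl rfl)
      have := hflow u v _ _ ha.1 h.1 hab ha.2 he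
      push_cast
      linear_combination -this
  · intro u v x y h
    by_cases hv : {v} ∈ T
    · have hn : ¬ IsFlag K v x y := fun h' => h ⟨h', hv⟩
      simp [hv, (hf v hv).2.2.2.2.2.1 x y hn]
    · simp [hv]
  · intro u v x hx B hB
    by_cases hv : {v} ∈ T
    · obtain ⟨hab, hset, -, -, -, -, h3⟩ := hf v hv
      simp only [hv, if_true, LinearMap.smul_apply, smul_eq_mul]
      rw [← Finset.sum_mul, ← Int.cast_sum, h3 x _ _ B hB, Int.cast_zero, zero_mul]
      · rintro rfl
        exact hx ((hset _).2 (Or.inl rfl)).2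
      · rintro rfl
        exact hx ((hset _).2 (Or.inr rfl)).2
    · simp [hv]

lemma sum_eq_zero_of_antisymm {ι F : Type} [Field F] (h2 : (2 : F) ≠ 0) (s : Finset ι)
    {f : ι → ι → F} (h : ∀ x y, f x y = - f y x) : ∑ x ∈ s, ∑ y ∈ s, f x y = 0 := by
  have h1 : ∑ x ∈ s, ∑ y ∈ s, f x y = - ∑ x ∈ s, ∑ y ∈ s, f x y := by
    conv_lhs => rw [Finset.sum_comm]
    simp only [← Finset.sum_neg_distrib]
    exact Finset.sum_congr rfl fun x _ => Finset.sum_congr rfl fun y _ => h y x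
  have h3 : (2 : F) * ∑ x ∈ s, ∑ y ∈ s, f x y = 0 := by linear_combination h1
  exact (mul_eq_zero.1 h3).resolve_left h2

/-- A singular edge lies in three triangles, so a constant summed over them vanishes modulo three.
-/
lemma IsSingularPart.sum_flags (hT : IsSingularPart K T) (hX : IsSimplePolyhedron K) {v x : V}
    (he : {v, x} ∈ T) {s : Finset V} (hs : ∀ y, IsFlag K v x y → y ∈ s) {g : V → ZMod 3} {c : ZMod 3}
    (h1 : ∀ y, IsFlag K v x y → g y = c) (h2 : ∀ y, ¬ IsFlag K v x y → g y = 0) :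
    ∑ y ∈ s, g y = 0 := by
  classical
  by_cases hne : x = v
  · exact Finset.sum_eq_zero fun y _ => h2 y fun h => h.1 hne
  have hcard : (s.filter fun y => IsFlag K v x y).card = 3 := by
    rw [← hT.cofaces_eq_three hX (Finset.card_pair (Ne.symm hne)) he, ← Set.ncard_coe_finset]
    congr 1
    ext y
    simp only [Finset.coe_filter, Set.mem_ofPred_eq, ← isFlag_iff hne]
    exact ⟨fun h => h.2, fun h => ⟨hs y h, h⟩⟩
  rw [← Finset.sum_filter_add_sum_filter_not s (fun y => IsFlag K v x y),
    Finset.sum_congr rfl fun y hy => h1 y (Finset.mem_filter.1 hy).2,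
    Finset.sum_congr rfl fun y hy => h2 y (Finset.mem_filter.1 hy).2, Finset.sum_const, hcard,
    Finset.sum_const_zero, add_zero, nsmul_eq_mul]
  rw [show ((3 : ℕ) : ZMod 3) = 0 from rfl, zero_mul]

open Classical in
/-- The boundary of a neighbourhood of a singular part without true vertices has at least twice as
many components as the neighbourhood. -/
theorem IsSingularPart.two_mul_h0_nbd_le (hT : IsSingularPart K T) (hX : IsSimplePolyhedron K)
    (hac : IsAcyclic K.faces) (hno : ∀ v ∈ trueVertices K, {v} ∉ T) :
    2 * h0 (nbd K T) ≤ h0 (nbdBoundary K T) := by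
  obtain ⟨U, _, _, _, o, q, hU, hinj, hanti, hq1, hq2, hq3, hq4⟩ := hT.exists_flows (ZMod 3) hX hno
  have fD : Finite (nbdBoundary K T) := (finite_sd hX.1).subset fun _ h => h.1.1
  have hfin : {v : V | {v} ∈ K.faces}.Finite :=
    hX.1.preimage Finset.singleton_injective.injOn
  let s : Finset V := hfin.toFinset
  have hs : ∀ {v x y}, IsFlag K v x y → y ∈ s := fun {v x y} h =>
    hfin.mem_toFinset.2 (face_mono h.2.2.2 (by simp) (by simp))
  have hs1 : ∀ {v x y}, IsFlag K v x y → x ∈ s := fun h => hs h.swap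
  have hs2 : ∀ {v x y}, IsFlag K v x y → v ∈ s := fun h => hs h.swap'.swap
  -- By `nbrs_flag`, `c1` and `c2` are the two neighbours of the flag on the boundary curves.
  let c1 : V → V → V → Finset (Finset V) := fun v x y => {{v}, insert y {v, x}}
  let c2 : V → V → V → Finset (Finset V) := fun v x y =>
    if {v, x} ∈ T then {{v, x}, insert y {v, x}} else {{v}, {v, x}}
  let ev : Finset (Finset V) → Finset (Finset V) →
      (Finset (Finset V) → Finset (Finset V) → ZMod 3) →ₗ[ZMod 3] ZMod 3 := fun a b =>
    { toFun := fun φ => φ a b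
      map_add' := fun _ _ => rfl
      map_smul' := fun _ _ => rfl }
  -- The cochain is integrated over a one-chain on the boundary curves: along each flag, the flow `q
  -- v x y` runs from `c1` through the flag to `c2`.
  let pr : U →ₗ[ZMod 3] (Finset (Finset V) → Finset (Finset V) → ZMod 3) →ₗ[ZMod 3] ZMod 3 :=
    ∑ v ∈ s, ∑ x ∈ s, ∑ y ∈ s, (q v x y).smulRight
      (ev (c1 v x y) (flag v x y) - ev (c2 v x y) (flag v x y))
  have hpr : ∀ u φ, pr u φ = ∑ v ∈ s, ∑ x ∈ s, ∑ y ∈ s,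
      q v x y u * (φ (c1 v x y) (flag v x y) - φ (c2 v x y) (flag v x y)) := by
    intro u φ
    simp only [pr, LinearMap.sum_apply, LinearMap.smulRight_apply, LinearMap.smul_apply,
      LinearMap.sub_apply, smul_eq_mul]
    rfl
  have hmem : ∀ {v x y}, IsFlag K v x y → {v} ∈ T → flag v x y ∈ nbdBoundary K T ∧
      c1 v x y ∈ nbdBoundary K T ∧ c2 v x y ∈ nbdBoundary K T ∧ c1 v x y ⊆ flag v x y ∧
      c2 v x y ⊆ flag v x y := by
    intro v x y h hv
    refine ⟨hT.flag_mem hX h hv, hT.vt_mem hX h hv, ?_, ?_, ?_⟩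
    · have h1 : c2 v x y ∈ nbrs (nbdBoundary K T) (flag v x y) := by
        rw [hT.nbrs_flag hX h hv]
        by_cases he : {v, x} ∈ T <;> simp [c2, he]
      exact h1.1
    · intro a ha
      simp only [c1, Finset.mem_insert, Finset.mem_singleton] at ha
      rcases ha with rfl | rfl <;> simp [flag]
    · intro a ha
      by_cases he : {v, x} ∈ T <;>
        simp only [c2, he, if_true, if_false, Finset.mem_insert, Finset.mem_singleton] at ha <;>
        rcases ha with rfl | rfl <;> simp [flag]
  have h2 : (2 : ZMod 3) ≠ 0 := by decide
  -- The one-chain is a cycle. Flow is conserved at the nodes `{{v}, t}` by antisymmetry of `q`, at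
  -- the nodes `{e, t}` with `e ∈ T` because the orientations from the two ends of `e` cancel, and
  -- at the nodes `{{v}, e}` with `e ∉ T` by Kirchhoff's law in the link of `v`. The antisymmetric
  -- sums vanish because two is invertible modulo three.
  have hD : ∀ u φ, IsCoboundary (nbdBoundary K T) φ → pr u φ = 0 := by
    rintro u φ ⟨g, hg⟩
    rw [hpr]
    have e1 : ∑ v ∈ s, ∑ x ∈ s, ∑ y ∈ s, q v x y u * g (c1 v x y) = 0 := by
      refine Finset.sum_eq_zero fun v _ => sum_eq_zero_of_antisymm h2 s fun x y => ?_
      have : c1 v x y = c1 v y x := by simp only [c1, insert_pair_comm v x y]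
      rw [this, hq1 u v x y]
      ring
    have e2 : ∑ v ∈ s, ∑ x ∈ s, ∑ y ∈ s,
        (if {v, x} ∈ T then q v x y u * g {{v, x}, insert y {v, x}} else 0) = 0 := by
      rw [Finset.sum_congr rfl fun v _ => Finset.sum_comm, Finset.sum_comm]
      refine Finset.sum_eq_zero fun y _ => sum_eq_zero_of_antisymm h2 s fun v x => ?_
      rw [Finset.pair_comm x v]
      by_cases he : {v, x} ∈ T
      · rw [if_pos he, if_pos he]
        by_cases h : IsFlag K v x y
        · rw [hq2 u v x y h he, hq2 u x v y h.swap' (by rwa [Finset.pair_comm])]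
          linear_combination g {{v, x}, insert y {v, x}} * hanti u v x h.1 he
        · rw [hq3 u v x y fun h' => h h'.1, hq3 u x v y fun h' => h h'.1.swap']
          simp
      · rw [if_neg he, if_neg he, neg_zero]
    have e3 : ∑ v ∈ s, ∑ x ∈ s, ∑ y ∈ s,
        (if {v, x} ∈ T then 0 else q v x y u * g {{v}, {v, x}}) = 0 := by
      refine Finset.sum_eq_zero fun v _ => Finset.sum_eq_zero fun x _ => ?_
      by_cases he : {v, x} ∈ T
      · simp [he]
      · simp only [he, if_false]
        rw [← Finset.sum_mul, hq4 u v x he s fun y h => hs h, zero_mul]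
    have e4 : ∀ v x y, q v x y u * (φ (c1 v x y) (flag v x y) - φ (c2 v x y) (flag v x y)) =
        (if {v, x} ∈ T then q v x y u * g {{v, x}, insert y {v, x}} else 0) +
        (if {v, x} ∈ T then 0 else q v x y u * g {{v}, {v, x}}) - q v x y u * g (c1 v x y) := by
      intro v x y
      by_cases h : IsFlag K v x y ∧ {v} ∈ T
      · obtain ⟨m1, m2, m3, m4, m5⟩ := hmem h.1 h.2
        rw [hg _ m2 _ m1 m4, hg _ m3 _ m1 m5]
        by_cases he : {v, x} ∈ T
        · simp only [c2, he, if_true]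
          ring
        · simp only [c2, he, if_false]
          ring
      · simp [hq3 u v x y h]
    simp only [e4, Finset.sum_sub_distrib, Finset.sum_add_distrib]
    rw [e1, e2, e3]
    ring
  -- Up to a coboundary, `φ` may be replaced by its pullback along the retraction onto the singular
  -- circles. Over each singular edge the three sheets then contribute equally, so the total is zero
  -- modulo three; flags over other edges are collapsed.
  have hA : ∀ u φ, IsCocycle (nbd K T) φ → pr u φ = 0 := by
    intro u φ hφ
    let r := chainPart T
    have hr : ∀ c ∈ nbd K T, r c ∈ nbd K T := fun c hc => chainsIn_subset hT (chainPart_mem hc)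
    have hcb : IsCoboundary (nbdBoundary K T) (φ - fun x y => φ (r x) (r y)) := by
      refine ⟨fun x => φ (r x) x, fun x hx y hy hxy => ?_⟩
      have a1 := hφ _ (hr x hx.1) _ (hr y hy.1) _ hy.1 (chainPart_mono hxy) (chainPart_subset y)
      have a2 := hφ _ (hr x hx.1) _ hx.1 _ hy.1 (chainPart_subset x) hxy
      simp only [Pi.sub_apply]
      linear_combination a1 - a2
    have h0 : pr u (fun x y => φ (r x) (r y)) = 0 := by
      rw [hpr]
      refine Finset.sum_eq_zero fun v _ => Finset.sum_eq_zero fun x _ => ?_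
      have hTt : ∀ {y}, IsFlag K v x y → insert y {v, x} ∉ T := fun h =>
        hT.triangle_notMem hX h.card
      by_cases he : {v, x} ∈ T
      · refine hT.sum_flags hX he (fun y h => hs h)
          (c := o v x u * (φ {{v}} {{v}, {v, x}} - φ {{v, x}} {{v}, {v, x}})) ?_ ?_
        · intro y h
          have hv := hT.vertex_mem hX h.1 he
          have r1 : r (c1 v x y) = {{v}} := by
            ext a
            simp only [r, c1, mem_chainPart, Finset.mem_insert, Finset.mem_singleton]
            exact ⟨fun ⟨h1, h2⟩ => h1.resolve_right fun h3 => hTt h (h3 ▸ h2),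
              fun h1 => ⟨Or.inl h1, h1 ▸ hv⟩⟩
          have r2 : r (c2 v x y) = {{v, x}} := by
            ext a
            simp only [r, c2, he, if_true, mem_chainPart, Finset.mem_insert, Finset.mem_singleton]
            exact ⟨fun ⟨h1, h2⟩ => h1.resolve_right fun h3 => hTt h (h3 ▸ h2),
              fun h1 => ⟨Or.inl h1, h1 ▸ he⟩⟩
          have r3 : r (flag v x y) = {{v}, {v, x}} := by
            ext a
            simp only [r, flag, mem_chainPart, Finset.mem_insert, Finset.mem_singleton]
            constructor
            · rintro ⟨rfl | rfl | rfl, h2⟩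
              exacts [Or.inl rfl, Or.inr rfl, absurd h2 (hTt h)]
            · rintro (rfl | rfl)
              exacts [⟨Or.inl rfl, hv⟩, ⟨Or.inr (Or.inl rfl), he⟩]
          rw [r1, r2, r3, hq2 u v x y h he]
        · intro y h
          rw [hq3 u v x y fun h' => h h'.1, zero_mul]
      · refine Finset.sum_eq_zero fun y _ => ?_
        by_cases h : IsFlag K v x y ∧ {v} ∈ T
        · have : r (c1 v x y) = r (c2 v x y) := by
            ext a
            simp only [r, c1, c2, he, if_false, mem_chainPart, Finset.mem_insert,
              Finset.mem_singleton]
            constructor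
            · rintro ⟨rfl | rfl, h2⟩
              exacts [⟨Or.inl rfl, h2⟩, absurd h2 (hTt h.1)]
            · rintro ⟨rfl | rfl, h2⟩
              exacts [⟨Or.inl rfl, h2⟩, absurd h2 he]
          rw [this, sub_self, mul_zero]
        · rw [hq3 u v x y h, zero_mul]
    have h1 := hD u _ hcb
    rwa [map_sub, h0, sub_zero] at h1
  -- For a singular edge, the indicator of the pair formed by `c1` and the flag of an adjacent
  -- triangle recovers the orientation `o v x u`.
  have hnd : ∀ u, (∀ φ, IsCocycle (nbdBoundary K T) φ → pr u φ = 0) → u = 0 := by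
    intro u hu
    refine hinj u fun v x hne he => ?_
    have hv := hT.vertex_mem hX hne he
    obtain ⟨y, hy⟩ : (cofaces K {v, x}).Nonempty := Set.nonempty_of_ncard_ne_zero (by
      rw [hT.cofaces_eq_three hX (Finset.card_pair hne.symm) he]; decide)
    have hfl := (isFlag_iff hne).2 hy
    have hlt : c1 v x y ≠ flag v x y := fun h => by
      have := hfl.card_flag
      rw [← h] at this
      have h2 : (c1 v x y).card ≤ 2 := Finset.card_le_two
      omega
    have h := hu (fun a b => if a = c1 v x y ∧ b = flag v x y then 1 else 0)
      ((isGraphPoset_nbdBoundary hX).isCocycle fun a _ =>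
        if_neg fun h => hlt (h.1.symm.trans h.2))
    rw [hpr] at h
    have hother : ∀ v' x' y', (v', x', y') ≠ (v, x, y) → q v' x' y' u *
        ((if c1 v' x' y' = c1 v x y ∧ flag v' x' y' = flag v x y then 1 else 0) -
          (if c2 v' x' y' = c1 v x y ∧ flag v' x' y' = flag v x y then 1 else 0)) = 0 := by
      intro v' x' y' hne'
      by_cases h' : IsFlag K v' x' y' ∧ {v'} ∈ T
      · have : flag v' x' y' ≠ flag v x y := fun heq => by
          obtain ⟨rfl, rfl, rfl⟩ := flag_injective h'.1 hfl heq
          exact hne' rfl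
        simp [this]
      · rw [hq3 u _ _ _ h', zero_mul]
    rw [Finset.sum_eq_single v, Finset.sum_eq_single x, Finset.sum_eq_single y] at h
    · have hc : c2 v x y ≠ c1 v x y := by
        simp only [c1, c2, he, if_true]
        refine (pair_ne_of_mem (singleton_ne_pair hne) fun h => ?_).symm
        have := hfl.card
        rw [← h, Finset.card_singleton] at this
        omega
      simpa [hc, hq2 u v x y hfl he] using h
    · exact fun y' _ h' => hother _ _ _ fun h => h' (congr_arg (fun p => p.2.2) h)
    · exact fun h => absurd (hs hfl) h
    · exact fun x' _ h' => Finset.sum_eq_zero fun y' _ => hother _ _ _ fun h => h' (congr_arg (fun p => p.2.1) h)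
    · exact fun h => absurd (hs1 hfl) h
    · exact fun v' _ h' => Finset.sum_eq_zero fun x' _ => Finset.sum_eq_zero fun y' _ =>
        hother _ _ _ fun h => h' (congr_arg (fun p => p.1) h)
    · exact fun h => absurd (hs2 hfl) h
  have hcob : ∀ φ : Finset (Finset V) → Finset (Finset V) → ZMod 3, IsCocycle (nbd K T) φ →
      IsCoboundary (nbdBoundary K T) φ → IsCoboundary (nbd K T) φ := fun φ hφ h =>
    isCoboundary_of_inter (nbd_upClosed Set.subset_union_left nbd_union.le)
      (nbdCompl_upClosed Set.subset_union_right nbd_union.le)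
      (fun ψ hψ => by
        rw [nbd_union] at hψ ⊢
        exact isCoboundary_sd hX.1 hac hψ) hφ h
  -- The bound is `dim U + h1 N ≤ h1 D`, with `N` the neighbourhood and `D` its boundary. Without
  -- true vertices both terms on the left equal `h0 N`, while `h1 D` equals `h0 D`.
  have hle := finrank_add_h1_le (D := nbdBoundary K T) Set.inter_subset_left pr hA hD hnd hcob
  have he : {v ∈ trueVertices K | {v} ∈ T} = ∅ := Set.eq_empty_of_forall_notMem fun v hv =>
    hno v hv.1 hv.2
  rw [hU, (hT.isRegularPoset hX).h1_eq (ZMod 3), hT.h1_nbd _ hX, he, Set.ncard_empty] at hle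
  omega

end TripleCover
end SimplePoly

namespace SimplePoly

/-! ### Nonsingular parts of the complement are surfaces -/

section ClosedPieces

variable {V : Type} [DecidableEq V] {K : PreAbstractSimplicialComplex V} {T : Set (Finset V)}

/-- If a closed simple polyhedron is not singular at the point `σ` of an edge or triangle, then
the chains that contain `σ` have two completions. -/
lemma ncard_completions_eq_two (hX : IsSimplePolyhedron K) (hcl : boundary K = ∅)
    {c : Finset (Finset V)} (hc : c ∈ (sd K).faces) (h2 : c.card = 2) {σ : Finset V} (hσ : σ ∈ c)
    (hns : σ ∉ singularSet K) : (completions K c).ncard = 2 := by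
  rcases hX.chain_two hc h2 with ⟨v, x, hne, rfl⟩ | ⟨v, t, hv, ht, rfl⟩ | ⟨e, t, he, het, ht, rfl⟩
  · rw [(ncard_completions_ve hX hne hc).2]
    have hK : {v, x} ∈ K.faces := hc.2.1 _ (by simp)
    have he : ({v, x} : Finset V).card = 2 := Finset.card_pair hne.symm
    obtain ⟨h1, h3, h4, h5⟩ := hX.edge_facts he hK
    have hb : (cofaces K {v, x}).ncard ≠ 1 := fun h => by
      have := h3.2 h
      rw [hcl] at this
      exact this
    have hs : (cofaces K {v, x}).ncard ≠ 3 := fun h => by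
      have hS : IsSingularPart K (singularSet K) :=
        ⟨le_rfl, fun _ _ _ h _ => h, by rw [hcl]; exact Set.disjoint_empty _⟩
      rw [Finset.mem_insert, Finset.mem_singleton] at hσ
      rcases hσ with rfl | rfl
      exacts [hns (hS.vertex_mem hX hne (h1.2 h)), hns (h1.2 h)]
    omega
  · exact (ncard_completions_vt hX hv ht hc).2
  · exact (ncard_completions_et hX he het ht hc).2

open Classical in
/-- The complement of the neighbourhood is a surface away from the singular set: its boundary is
that of the neighbourhood. -/
lemma parity_nbdCompl (hX : IsSimplePolyhedron K) (hcl : boundary K = ∅)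
    {A : Set (Finset (Finset V))} (hA : A ⊆ nbdCompl K T)
    (hsat : ∀ x ∈ A, ∀ w ∈ nbdCompl K T, (x ≤ w ∨ w ≤ x) → w ∈ A)
    (hns : ∀ σ, {σ} ∈ A → σ ∉ singularSet K) {x y : Finset (Finset V)} (hx : x ∈ A) (hy : y ∈ A)
    (hxy : x < y) :
    (({w ∈ A | y < w ∨ w < x ∨ (x < w ∧ w < y)}.ncard : ℕ) : ZMod 2) =
      if x ∈ nbdBoundary K T ∧ y ∈ nbdBoundary K T then 1 else 0 := by
  have hxs := (hA hx).1
  have hys := (hA hy).1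
  have hlt : x.card < y.card := Finset.card_lt_card hxy
  have h3 := hX.chain_card_le hys
  have h1 := Finset.card_pos.2 hxs.1
  have hcard : ∀ {w}, w ∈ A → 1 ≤ w.card ∧ w.card ≤ 3 := fun hw =>
    ⟨Finset.card_pos.2 (hA hw).1.1, hX.chain_card_le (hA hw).1⟩
  -- If `x` has two elements, then `y` is a full flag and the third vertices are the singletons of
  -- members of `x` outside `T`. There are two of them, or one when `x` meets `T`, that is, when the
  -- edge lies on the boundary.
  by_cases hx2 : x.card = 2
  · have hset : {w ∈ A | y < w ∨ w < x ∨ (x < w ∧ w < y)} =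
        (fun σ => {σ}) '' ((x.filter fun σ => σ ∉ T : Finset _) : Set (Finset V)) := by
      ext w
      simp only [Set.mem_ofPred_eq, Set.mem_image, Finset.coe_filter]
      constructor
      · rintro ⟨hw, h | h | h⟩
        · have := Finset.card_lt_card h
          have := (hcard hw).2
          omega
        · have h4 := Finset.card_lt_card h
          have h5 := (hcard hw).1
          obtain ⟨σ, rfl⟩ := Finset.card_eq_one.1 (show w.card = 1 by omega)
          obtain ⟨τ, hτ, hT⟩ := (hA hw).2
          rw [Finset.mem_singleton] at hτ
          exact ⟨σ, ⟨h.subset (by simp), hτ ▸ hT⟩, rfl⟩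
        · have := Finset.card_lt_card h.1
          have := Finset.card_lt_card h.2
          omega
      · rintro ⟨σ, ⟨hσ, hT⟩, rfl⟩
        have hle : ({σ} : Finset (Finset V)) ⊆ x := Finset.singleton_subset_iff.2 hσ
        refine ⟨hsat x hx _ ⟨sd_mono hxs hle (by simp), σ, by simp, hT⟩ (Or.inr hle),
          Or.inr (Or.inl (hle.ssubset_of_ne fun h => ?_))⟩
        rw [← h, Finset.card_singleton] at hx2
        omega
    rw [hset, Set.ncard_image_of_injective _ Finset.singleton_injective, Set.ncard_coe_finset]
    have hD : (x ∈ nbdBoundary K T ∧ y ∈ nbdBoundary K T) ↔ ∃ σ ∈ x, σ ∈ T := by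
      constructor
      · exact fun h => h.1.1.2
      · intro h
        have : x ∈ nbdBoundary K T := mem_nbdBoundary.2 ⟨hxs, h, (hA hx).2⟩
        exact ⟨this, nbdBoundary_up this hys hxy.le⟩
    simp only [hD]
    have hxT := (hA hx).2
    obtain ⟨a, b, hab, rfl⟩ := Finset.card_eq_two.1 hx2
    by_cases ha : a ∈ T <;> by_cases hb : b ∈ T
    · simp [ha, hb] at hxT
    · simp [Finset.filter_insert, Finset.filter_singleton, ha, hb]
    · simp [Finset.filter_insert, Finset.filter_singleton, ha, hb]
    · simp [Finset.filter_insert, Finset.filter_singleton, ha, hb, hab]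
      rfl
  -- A one-element `x` is never on the boundary. The third vertices are the two completions of `y`,
  -- or, when `y` is a full flag, the two chains strictly between `x` and `y`.
  · have hx1 : x.card = 1 := by omega
    obtain ⟨a, rfl⟩ := Finset.card_eq_one.1 hx1
    have haT : a ∉ T := by
      obtain ⟨τ, hτ, hT⟩ := (hA hx).2
      rw [Finset.mem_singleton] at hτ
      exact hτ ▸ hT
    have hay : a ∈ y := hxy.le (by simp)
    have hD : ¬ (({a} : Finset (Finset V)) ∈ nbdBoundary K T ∧ y ∈ nbdBoundary K T) := fun h => by
      have := two_le_card_of_mem h.1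
      omega
    rw [if_neg hD]
    have hmem : ∀ {w}, a ∈ w → w ∈ (sd K).faces → w ∈ A := fun {w} haw hw =>
      hsat _ hx _ ⟨hw, a, haw, haT⟩ (Or.inl (Finset.singleton_subset_iff.2 haw))
    suffices h : {w ∈ A | y < w ∨ w < {a} ∨ ({a} < w ∧ w < y)}.ncard = 2 by rw [h]; rfl
    by_cases hy2 : y.card = 2
    · rw [← ncard_completions_eq_two hX hcl hys hy2 hay (hns a hx), ← Set.InjOn.ncard_image
        (insert_injOn y)]
      congr 1
      ext w
      constructor
      · rintro ⟨hw, h | h | h⟩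
        · have h4 := Finset.card_lt_card h
          have h5 := (hcard hw).2
          obtain ⟨σ, hσ, rfl⟩ := Finset.exists_eq_insert_iff.2 ⟨h.subset, by omega⟩
          exact ⟨σ, ⟨hσ, (hA hw).1⟩, rfl⟩
        · have := Finset.card_lt_card h
          have := (hcard hw).1
          omega
        · have := Finset.card_lt_card h.1
          have := Finset.card_lt_card h.2
          omega
      · rintro ⟨σ, ⟨hσ, hw⟩, rfl⟩
        exact ⟨hmem (Finset.mem_insert_of_mem hay) hw, Or.inl (Finset.ssubset_insert hσ)⟩
    · have hset : {w ∈ A | y < w ∨ w < {a} ∨ ({a} < w ∧ w < y)} =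
          (fun τ => {a, τ}) '' ((y.erase a : Finset _) : Set (Finset V)) := by
        ext w
        constructor
        · rintro ⟨hw, h | h | h⟩
          · have := Finset.card_lt_card h
            have := (hcard hw).2
            omega
          · have := Finset.card_lt_card h
            have := (hcard hw).1
            omega
          · have h4 := Finset.card_lt_card h.1
            have h5 := Finset.card_lt_card h.2
            obtain ⟨τ, hτ, rfl⟩ := Finset.exists_eq_insert_iff.2 ⟨h.1.subset, by omega⟩
            rw [Finset.mem_singleton] at hτ
            exact
              ⟨τ, Finset.mem_coe.2 (Finset.mem_erase.2 ⟨hτ, h.2.subset (Finset.mem_insert_self _ _)⟩),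
                Finset.pair_comm _ _⟩
        · rintro ⟨τ, hτ, rfl⟩
          rw [Finset.mem_coe, Finset.mem_erase] at hτ
          have hle : ({a, τ} : Finset (Finset V)) ⊆ y := by
            simp [Finset.insert_subset_iff, hay, hτ.2]
          have hc : ({a, τ} : Finset (Finset V)).card = 2 := Finset.card_pair (Ne.symm hτ.1)
          refine ⟨hmem (by simp) (sd_mono hys hle (by simp)), Or.inr (Or.inr ⟨?_, ?_⟩)⟩
          · refine (Finset.singleton_subset_iff.2 (by simp)).ssubset_of_ne fun h => ?_
            have h : ({a} : Finset (Finset V)) = {a, τ} := h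
            rw [← h] at hc
            omega
          · exact hle.ssubset_of_ne fun h => hy2 (h ▸ hc)
      rw [hset, Set.InjOn.ncard_image, Set.ncard_coe_finset, Finset.card_erase_of_mem hay]
      · omega
      · intro τ hτ ρ hρ h
        rw [Finset.mem_coe, Finset.mem_erase] at hτ
        have : τ ∈ ({a, ρ} : Finset (Finset V)) :=
          (show ({a, τ} : Finset (Finset V)) = {a, ρ} from h) ▸ by simp
        simpa [hτ.1] using this

lemma IsSeparated.mono {α : Type} [PartialOrder α] {A B A' B' : Set α} (h : IsSeparated A B)
    (hA : A' ⊆ A) (hB : B' ⊆ B) : IsSeparated A' B' :=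
  ⟨h.1.mono hA hB, fun a ha b hb => h.2 a (hA ha) b (hB hb)⟩

/-- The boundary curves of a nonsingular part of the complement of the neighbourhood. -/
lemma IsSingularPart.h0_add_h1_piece_le (hT : IsSingularPart K T) (hX : IsSimplePolyhedron K)
    (hac : IsAcyclic K.faces) (hcl : boundary K = ∅) (hne : T.Nonempty)
    {A : Set (Finset (Finset V))} (hA : A ⊆ nbdCompl K T)
    (hsep : IsSeparated A (nbdCompl K T \ A)) (hns : ∀ σ, {σ} ∈ A → σ ∉ singularSet K) :
    h0 A + h1 (ZMod 2) A ≤ h0 (A ∩ nbdBoundary K T) := by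
  classical
  have fA : Finite A := (finite_sd hX.1).subset fun _ h => (hA h).1
  have hsat : ∀ x ∈ A, ∀ w ∈ nbdCompl K T, (x ≤ w ∨ w ≤ x) → w ∈ A := fun x hx w hw h => by
    by_contra hwA
    exact hsep.2 x hx w ⟨hw, hwA⟩ h
  have hreg := hT.isRegularPoset hX
  refine h0_add_h1_le ⟨?_, ?_⟩ (fun x hx y hy hxy => ?_) (fun φ hφ h => ?_) (fun f hf hz => ?_)
  · exact fun x hx y hy z hz => hreg.1 x hx.2 y hy.2 z hz.2
  · intro x hx
    rw [← hreg.2 x hx.2]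
    congr 1
    ext y
    exact ⟨fun h => ⟨h.1.2, h.2⟩,
      fun h => ⟨⟨hsat x hx.1 y h.1.2 (h.2.imp le_of_lt le_of_lt), h.1⟩, h.2⟩⟩
  · rw [parity_nbdCompl hX hcl hA hsat hns hx hy hxy]
  · exact isCoboundary_piece hX.1 hac hA hsep hφ h
  -- A locally constant function on `A` that vanishes on the boundary stays locally constant when
  -- extended by zero to the connected `sd K`. It is zero at the chains `{σ}` with `σ ∈ T`, hence
  -- everywhere.
  · have hlc : ∀ x ∈ (sd K).faces, ∀ y ∈ (sd K).faces, x ≤ y → extendZero f x = extendZero f y := by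
      intro x hx y hy hxy
      by_cases hxA : x ∈ A
      · have hyA : y ∈ A := hsat x hxA y
          ⟨hy, let ⟨σ, hσ, h⟩ := (hA hxA).2; ⟨σ, hxy hσ, h⟩⟩ (Or.inl hxy)
        simp only [extendZero, dif_pos hxA, dif_pos hyA]
        exact mem_LC.1 hf ⟨x, hxA⟩ ⟨y, hyA⟩ hxy
      · by_cases hyA : y ∈ A
        · have hxT : x ∉ nbdCompl K T := fun h => hxA (hsat y hyA x h (Or.inr hxy))
          obtain ⟨σ, hσ⟩ := hx.1
          have hσT : σ ∈ T := by
            by_contra h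
            exact hxT ⟨hx, σ, hσ, h⟩
          have : y ∈ nbdBoundary K T := ⟨⟨hy, σ, hxy hσ, hσT⟩, hA hyA⟩
          simp [extendZero, hxA, hyA, hz ⟨y, hyA⟩ this]
        · simp [extendZero, hxA, hyA]
    obtain ⟨σ, hσ⟩ := hne
    have hσs : ({σ} : Finset (Finset V)) ∈ (sd K).faces := ⟨by simp, by simpa using hT.mem_faces hσ,
      by simp⟩
    have hσA : ({σ} : Finset (Finset V)) ∉ A := fun h => by
      obtain ⟨τ, hτ, hh⟩ := (hA h).2
      rw [Finset.mem_singleton] at hτ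
      exact hh (hτ ▸ hσ)
    funext x
    have h := (sd_connected hX.2.1).eq_of_locallyConstant hlc (hA x.2).1 hσs
    simpa [extendZero, hσA] using h

/-- Members of one chain are comparable, and saturation keeps comparable singular faces in the same
part. So no chain meets both parts. -/
lemma IsSingularPart.isSeparated_nbd {T₁ T₂ : Set (Finset V)} (h₁ : IsSingularPart K T₁)
    (h₂ : IsSingularPart K T₂) (hd : Disjoint T₁ T₂) : IsSeparated (nbd K T₁) (nbd K T₂) := by
  have key : ∀ c ∈ (sd K).faces, ∀ σ ∈ c, ∀ τ ∈ c, σ ∈ T₁ → τ ∈ T₂ → False :=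
    fun c hc σ hσ τ hτ h h' =>
      Set.disjoint_left.1 hd (h₁.sat σ h τ (h₂.sub h') (hc.2.2 σ hσ τ hτ)) h'
  constructor
  · rw [Set.disjoint_left]
    rintro c ⟨hc, σ, hσ, h⟩ ⟨-, τ, hτ, h'⟩
    exact key c hc σ hσ τ hτ h h'
  · rintro c ⟨hc, σ, hσ, h⟩ d ⟨hd, τ, hτ, h'⟩ (hcd | hcd)
    · exact key d hd σ (hcd hσ) τ hτ h h'
    · exact key c hc σ hσ τ (hcd hτ) h h'

lemma nbd_union_parts {T₁ T₂ : Set (Finset V)} : nbd K (T₁ ∪ T₂) = nbd K T₁ ∪ nbd K T₂ := by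
  ext c
  constructor
  · rintro ⟨hc, σ, hσ, h | h⟩
    exacts [Or.inl ⟨hc, σ, hσ, h⟩, Or.inr ⟨hc, σ, hσ, h⟩]
  · rintro (⟨hc, σ, hσ, h⟩ | ⟨hc, σ, hσ, h⟩)
    exacts [⟨hc, σ, hσ, Or.inl h⟩, ⟨hc, σ, hσ, Or.inr h⟩]

lemma IsSingularPart.union {T₁ T₂ : Set (Finset V)} (h₁ : IsSingularPart K T₁)
    (h₂ : IsSingularPart K T₂) : IsSingularPart K (T₁ ∪ T₂) :=
  ⟨Set.union_subset h₁.sub h₂.sub,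
    fun a ha b hb h => ha.imp (fun ha => h₁.sat a ha b hb h) (fun ha => h₂.sat a ha b hb h),
    h₁.bd.union_left h₂.bd⟩

lemma IsSingularPart.nbdBoundary_union {T₁ T₂ : Set (Finset V)} (h₁ : IsSingularPart K T₁)
    (h₂ : IsSingularPart K T₂) (hd : Disjoint T₁ T₂) :
    nbdBoundary K (T₁ ∪ T₂) = nbdBoundary K T₁ ∪ nbdBoundary K T₂ := by
  have hs := (h₁.isSeparated_nbd h₂ hd).1
  have hn : nbd K (T₁ ∪ T₂) = nbd K T₁ ∪ nbd K T₂ := nbd_union_parts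
  ext c
  constructor
  · rintro ⟨hc, -, σ, hσ, h⟩
    rw [hn] at hc
    exact hc.imp (fun hc => ⟨hc, hc.1, σ, hσ, fun h' => h (Or.inl h')⟩)
      fun hc => ⟨hc, hc.1, σ, hσ, fun h' => h (Or.inr h')⟩
  · rintro (⟨hc, -, σ, hσ, h⟩ | ⟨hc, -, σ, hσ, h⟩)
    · refine ⟨hn ▸ Or.inl hc, hc.1, σ, hσ, fun h' => ?_⟩
      exact Set.disjoint_left.1 hs hc ⟨hc.1, σ, hσ, h'.resolve_left h⟩
    · refine ⟨hn ▸ Or.inr hc, hc.1, σ, hσ, fun h' => ?_⟩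
      exact Set.disjoint_left.1 hs ⟨hc.1, σ, hσ, h'.resolve_right h⟩ hc

end ClosedPieces
end SimplePoly

namespace SimplePoly

/-! ### Homology circles in a closed polyhedron contain vertices -/

section CirclePieces

variable {V : Type} [DecidableEq V] {K : PreAbstractSimplicialComplex V}

/-- In a closed acyclic simple polyhedron the homology circles among the pieces have vertices. -/
theorem exists_trueVertex_of_isHomologyCircle (hX : IsSimplePolyhedron K) (hac : IsAcyclic K.faces)
    {S' : Set (Finset V)} (hS' : IsComponent S' (singularSet K)) (hcl : boundary K = ∅)
    {B : Set (Finset (Finset V))} (hB : IsComponent B (nbdCompl K S')) (hBc : IsHomologyCircle B) :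
    ∃ v ∈ trueVertices K, ({{v}} : Finset (Finset V)) ∈ B := by
  by_contra! hno
  have hT := hS'.isSingularPart (by rw [hcl]; exact Set.disjoint_empty _)
  have hsd : ∀ {Q : Set (Finset (Finset V))}, Q ⊆ (sd K).faces → Finite Q := fun h =>
    (finite_sd hX.1).subset h
  have hsub : ∀ {T : Set (Finset V)}, nbdCompl K T ⊆ (sd K).faces := fun h => h.1
  have hsubN : ∀ {T : Set (Finset V)}, nbd K T ⊆ (sd K).faces := fun h => h.1
  have hsubD : ∀ {T : Set (Finset V)}, nbdBoundary K T ⊆ (sd K).faces := fun h => h.1.1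
  -- the singular set inside the piece
  let E : Set (Finset V) := {σ ∈ singularSet K | {σ} ∈ B}
  have hES : Disjoint S' E := by
    rw [Set.disjoint_left]
    rintro σ hσ ⟨-, h⟩
    obtain ⟨τ, hτ, hn⟩ := (hB.1 h).2
    rw [Finset.mem_singleton] at hτ
    exact hn (hτ ▸ hσ)
  have hup : ∀ {c σ}, c ∈ (sd K).faces → σ ∈ c → {σ} ∈ B → c ∈ B := fun {c σ} hc hσ h => by
    obtain ⟨τ, hτ, hn⟩ := (hB.1 h).2
    rw [Finset.mem_singleton] at hτ
    exact hB.2.2 _ h c ⟨hc, σ, hσ, hτ ▸ hn⟩ (Or.inl (Finset.singleton_subset_iff.2 hσ))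
  have hE : IsSingularPart K E := by
    refine ⟨fun _ h => h.1, fun a ha b hb h => ⟨hb, ?_⟩, by rw [hcl]; exact Set.disjoint_empty _⟩
    have hbS : b ∉ S' := fun hbS =>
      Set.disjoint_left.1 hES (hT.sat b hbS a ha.1 h.symm) ha
    have hab : ({a, b} : Finset (Finset V)) ∈ (sd K).faces := by
      refine ⟨by simp, by simp [mem_faces_of_singular ha.1, mem_faces_of_singular hb], ?_⟩
      simp only [Finset.mem_insert, Finset.mem_singleton]
      rintro x (rfl | rfl) y (rfl | rfl)
      exacts [Or.inl le_rfl, h, h.symm, Or.inl le_rfl]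
    -- Membership in the piece passes from `{a}` to the chain `{a, b}` and from there to `{b}`,
    -- which stays in the complement because `b` is not in `S'`.
    exact hB.2.2 _ (hup hab (by simp) ha.2) {b}
      ⟨sd_mono hab (by simp) (by simp), b, by simp, hbS⟩ (Or.inr (by simp))
  have hU := hT.union hE
  -- the complement of the neighbourhood of both parts
  have hsep := hB.isSeparated
  let A : Set (Finset (Finset V)) := nbdCompl K (S' ∪ E) ∩ B
  have hAB : A ⊆ B := Set.inter_subset_right
  have hsepA : IsSeparated A (nbdCompl K S' \ B) := hsep.mono hAB le_rfl
  have hY : nbdCompl K (S' ∪ E) = A ∪ nbdCompl K S' \ B := by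
    ext c
    constructor
    · intro hc
      by_cases hcB : c ∈ B
      · exact Or.inl ⟨hc, hcB⟩
      · obtain ⟨h, σ, hσ, hn⟩ := hc
        exact Or.inr ⟨⟨h, σ, hσ, fun h' => hn (Or.inl h')⟩, hcB⟩
    · rintro (h | ⟨⟨h, σ, hσ, hn⟩, hcB⟩)
      · exact h.1
      · exact ⟨h, σ, hσ, fun h' => h'.elim hn fun h' => hcB (hup h hσ h'.2)⟩
  have hYA : nbdCompl K (S' ∪ E) \ A ⊆ nbdCompl K S' \ B := by
    rintro c ⟨hc, hn⟩
    rw [hY] at hc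
    exact hc.resolve_left hn
  have fA : Finite A := hsd fun _ h => h.1.1
  have fO : Finite ↑(nbdCompl K S' \ B) := hsd fun _ h => h.1.1
  have fB : Finite B := hsd fun _ h => (hB.1 h).1
  have fY : Finite (nbdCompl K S') := hsd hsub
  have fN : Finite (nbd K S') := hsd hsubN
  have fN' : Finite (nbd K E) := hsd hsubN
  have fD : Finite (nbdBoundary K S') := hsd hsubD
  have fD' : Finite (nbdBoundary K E) := hsd hsubD
  have hns : ∀ σ, {σ} ∈ A → σ ∉ singularSet K := by
    rintro σ ⟨⟨-, τ, hτ, hn⟩, hσB⟩ hσ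
    rw [Finset.mem_singleton] at hτ
    exact hn (Or.inr (hτ ▸ ⟨hσ, hσB⟩))
  -- the boundary curves
  have hsN := hT.isSeparated_nbd hE hES
  have hsD : IsSeparated (nbdBoundary K S') (nbdBoundary K E) :=
    hsN.mono (fun _ h => h.1) fun _ h => h.1
  have hDU := hT.nbdBoundary_union hE hES
  have hDE : nbdBoundary K E ⊆ B := by
    rintro c ⟨⟨hc, σ, hσ, h⟩, -⟩
    exact hup hc hσ h.2
  have hAD : A ∩ nbdBoundary K (S' ∪ E) = B ∩ nbdBoundary K S' ∪ nbdBoundary K E := by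
    ext c
    constructor
    · rintro ⟨⟨-, hcB⟩, hc⟩
      rw [hDU] at hc
      exact hc.imp (fun h => ⟨hcB, h⟩) id
    · intro h
      have h1 : c ∈ nbdBoundary K (S' ∪ E) := hDU ▸ h.imp (fun h => h.2) id
      exact ⟨⟨h1.2, h.elim (fun h => h.1) fun h => hDE h⟩, h1⟩
  have hcomp := hT.components hX hac hS'.2.1
  -- the numbers of components
  have e1 := hT.piece_type (ZMod 2) hX hac hB
  have e2 : h1 (ZMod 2) (nbdCompl K S') = 1 + h1 (ZMod 2) (nbdCompl K S' \ B : Set _) := by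
    rw [← e1.2.1 hBc, ← h1_union_of_disjoint hsep.upClosed_left hsep.upClosed_right hsep.1,
      hB.union_sdiff]
  have e3 := h0_sdiff hB
  have e4 := hT.card_boundary (ZMod 2) hX hac
  have e5 := hcomp.2
  have e6 := h0_eq_one_iff.2 (nbd_connected (fun σ hσ => hT.mem_faces hσ) hS'.2.1)
  have e7 := hU.card_boundary (ZMod 2) hX hac
  have e8 := h0_nbdBoundary (T := S' ∪ E) hX.1 hac
    (hU.nbdBoundary_nonempty hX (hS'.2.1.1.mono Set.subset_union_left))
  have e9 : h0 A + h1 (ZMod 2) A ≤ h0 (A ∩ nbdBoundary K (S' ∪ E)) := hU.h0_add_h1_piece_le hX hac hcl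
    (hS'.2.1.1.mono Set.subset_union_left) Set.inter_subset_left (hsepA.mono le_rfl hYA) hns
  have e10 := hE.two_mul_h0_nbd_le hX hac fun v hv h => hno v hv h.2
  have e11 : {v ∈ trueVertices K | {v} ∈ S' ∪ E} = {v ∈ trueVertices K | {v} ∈ S'} :=
    Set.ext fun v => and_congr_right fun hv => or_iff_left fun h => hno v hv h.2
  have e12 : h0 (B ∩ nbdBoundary K S') = 1 := h0_eq_one_iff.2 (hcomp.1 B hB).2.1
  have fBD : Finite ↑(B ∩ nbdBoundary K S') := hsd fun _ h => h.2.1.1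
  rw [hAD, h0_union (hsD.mono Set.inter_subset_right le_rfl), e12] at e9
  rw [nbd_union_parts, h0_union hsN, hDU, h0_union hsD, hY] at e7 e8
  rw [h0_union hsepA] at e8
  rw [h1_union_of_disjoint hsepA.upClosed_left hsepA.upClosed_right hsepA.1, e11] at e7
  -- Put `d = h0 (nbdBoundary K E)`, `ν = h0 (nbd K E)`, `a = h0 A` and `b = h1 A`. Comparing `e7`
  -- with `e4` and `e2` gives `d + 1 = ν + b`. From `e8`, `e3` and `e5` comes `d + 1 ≤ ν + a`, so `b
  -- ≤ a`; and `e9`, which reads `a + b ≤ 1 + d`, gives `a ≤ ν`. But `e10`, which reads `2 * ν ≤ d`,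
  -- forces `ν + 1 ≤ b`, a contradiction.
  omega

end CirclePieces
end SimplePoly

theorem mainTheorem6 {V : Type} [DecidableEq V] (K : PreAbstractSimplicialComplex V)
    (hX : IsSimplePolyhedron K) (hac : IsAcyclic K.faces)
    (S' : Set (Finset V)) (hS' : IsComponent S' (singularSet K))
    (hbd : Disjoint S' (boundary K))
    (n m : ℕ) (hn : {v ∈ trueVertices K | {v} ∈ S'}.ncard = n) (hn1 : 1 ≤ n)
    (hm : {γ | IsComponent γ (nbdBoundary K S')}.ncard = m) :
    -- the components of `∂Nbd(S')` are simple closed curves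
    (∀ γ, IsComponent γ (nbdBoundary K S') → IsSubdivisionOf (orderComplex γ) circleGraph) ∧
    n + 1 ≤ m ∧
    -- they split `X` into `Nbd(S')`, `n + 1` acyclic pieces and `m - n - 1` homology-circles
    IsConnectedSet (nbd K S') ∧
    {A | IsComponent A (nbdCompl K S') ∧ IsAcyclic A}.ncard = n + 1 ∧
    {B | IsComponent B (nbdCompl K S') ∧ IsHomologyCircle B}.ncard = m - (n + 1) ∧
    (∀ C, IsComponent C (nbdCompl K S') → IsAcyclic C ∨ IsHomologyCircle C) ∧
    -- if `X` is closed, every homology-circle piece contains a vertex of `X`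
    (boundary K = ∅ → ∀ B, IsComponent B (nbdCompl K S') → IsHomologyCircle B →
      ∃ v ∈ trueVertices K, ({{v}} : Finset (Finset V)) ∈ B) := by
  obtain ⟨h1, h2, h3, h4, h5, h6⟩ := boundary_and_pieces hX hac S' hS' hbd n m hn hm
  exact ⟨h1, h2, h3, h4, h5, h6, fun hcl _ hB hBc =>
    exists_trueVertex_of_isHomologyCircle hX hac hS' hcl hB hBc⟩
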